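/- Let $\beta\in(0,2)$. There exists a constant $C\ge 1$, depending only on $\beta$, such that the following holds for every $d\in\mathbb{N}$, every probability space $(\Omega_0,\mathcal{F}_0,\mathbb{P}_0)$ and every integrable real random variable $X$ on the product probability space $(\Omega_*,\mathcal{F}_*,\mathbb{P}_*)=(\Omega_0^{\mathbb{Z}^d},\mathcal{F}_0^{\mathbb{Z}^d},\mathbb{P}_0^{\mathbb{Z}^d})$. For $\Gamma\subseteq\mathbb{Z}^d$ let $\mathcal{F}_*(\Gamma)$ be the $\sigma$-algebra generated by the coordinate maps $\omega\mapsto\omega(z)$, $z\in\Gamma$, and set $$X_z' := \mathbb{E}_*\!\left[X \,\middle|\, \mathcal{F}_*(\mathbb{Z}^d\setminus\{z\})\right],\qquad \mathbb{V}_*[X] := \sum_{z\in\mathbb{Z}^d}(X-X_z')^2\in[0,\infty].$$ Then $$\mathbb{E}_*\!\left[\exp\!\left(\left|X-\mathbb{E}_*[X]\right|^{\beta}\right)\right]\ \le\ C\;\mathbb{E}_*\!\left[\exp\!\left(\left(C\,\mathbb{V}_*[X]\right)^{\frac{\beta}{2-\beta}}\right)\right]^{\frac{2-\beta}{\beta}},$$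 where both sides take values in $[0,\infty]$ and $\exp(\infty)=\infty$. -/

import Mathlib

open MeasureTheory
open scoped ENNReal

noncomputable section

/-- The product probability measure `P₀^{ℤ^d}` on the space `ℤ^d → Ω₀` of configurations. -/
def productLaw {Ω₀ : Type*} [MeasurableSpace Ω₀] (d : ℕ) (P₀ : Measure Ω₀) :
    Measure ((Fin d → ℤ) → Ω₀) :=
  Measure.infinitePi (fun _ : Fin d → ℤ => P₀)

/-- `X'_z`: the conditional expectation of `X` given all the coordinates other than the one
at `z`. -/
def condExpOff {Ω₀ : Type*} [MeasurableSpace Ω₀] {d : ℕ} (P₀ : Measure Ω₀)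
    (X : ((Fin d → ℤ) → Ω₀) → ℝ) (z : Fin d → ℤ) : ((Fin d → ℤ) → Ω₀) → ℝ :=
  condExp (cylinderEvents (X := fun _ : Fin d → ℤ => Ω₀) {z}ᶜ) (productLaw d P₀) X

/-- `𝕍[X] = ∑_z (X - X'_z)²`, as a `[0,∞]`-valued random variable. -/
def verticalVar {Ω₀ : Type*} [MeasurableSpace Ω₀] {d : ℕ} (P₀ : Measure Ω₀)
    (X : ((Fin d → ℤ) → Ω₀) → ℝ) (ω : (Fin d → ℤ) → Ω₀) : ℝ≥0∞ :=
  ∑' z : Fin d → ℤ, ENNReal.ofReal ((X ω - condExpOff P₀ X z ω) ^ 2)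

end

set_option linter.unusedSectionVars false
set_option linter.unusedVariables false
set_option linter.unusedSimpArgs false

/-! Write T_q for the noise that keeps each coordinate with probability q and resamples it
otherwise, and E_i for averaging over the coordinate i. A deviation is a change of measure: if X ≥
E[X] + t has probability e^(-p), conditioning on this event gives a density bounded by e^p under
which the mean of X is shifted by t. Deform such a density h into the constant 1. By Cauchy–Schwarz,
each infinitesimal step moves the mean of X by at most the root of (mean of 𝕍 under the current
density) times (cost of the step). If v bounds the mean of 𝕍 under all densities bounded by e^(2p+5)
and the path stays among these, then t is at most of order √((p + 1) v). This is `deviation_le`,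
proved on finite product spaces.

The natural path is q ↦ T_q h, whose cost is paid by the entropy of h, at most p
(`mean_mul_sub_mean_le`). But 𝕍 sees X - X'_z at the current point only, so the increment h - E_i h
must be charged to h itself. This needs a one-sided regularity E_i h ≤ e h, which a conditioned
density lacks. A bridge with the tiny noise T = T_(1-δ), δ = e^(-ℓ), provides it: factorize h = f *
T g and move through T_a f * T_((1-δ)/a) g to r = T f * g (`mean_bridge_sub_le`). For g = (T
f)^(-(1-1/ℓ)) one has r = (T f)^(1/ℓ). Since T resamples a site with probability δ, E_i T f ≤ e^ℓ T
f, and the ℓ-th root turns this into E_i r ≤ e r. Such an f is the fixed point of a contraction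
(`exists_mul_noise_rpow_eq`). The construction also gives f ≤ e^(pℓ), so that where T f ≥ e^(-3ℓ) a
change of more than p + 3 sites is negligible. This controls both the cost of the bridge and the
size of the densities on it.

To reach exponential moments, put a = β / (2 - β) and let A be the mean of exp((C 𝕍)^a). The mean of
𝕍 under a density bounded by e^(2p+5) is at most M + e^(2p+5) E[𝕍; 𝕍 > M], and M of order (p + 1 +
log A)^(1/a) / C makes the last term harmless. As 1 + 1/a = 2/β, the deviation bound becomes λ t^β ≤
p + 1 + log A, that is, a tail e A e^(-λ t^β). Integrating the tail bounds E exp(b |X - E X|^β) by a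
multiple of A, and Jensen's inequality with b = max 1 a lowers the power of A to 1/b ≤ 1/a.

A general X is replaced by its means over the cells of a discretization of finitely many
coordinates. These approximate X in L¹, and by Jensen's inequality on each cell their square
function is controlled by 𝕍. -/

namespace NoiseSemigroup

open Finset Function

/-! ### Noise operators on a finite product space -/

section Algebra

variable {ι α : Type*} [Fintype ι] [DecidableEq ι] [Fintype α] [DecidableEq α]

/-- A probability vector on a finite type. -/
structure IsWeight (w : α → ℝ) : Prop where
  nonneg : ∀ a, 0 ≤ w a
  sum_eq_one : ∑ a, w a = 1

/-- Keep the letter `x` with probability `q`, resample it from `w` otherwise. -/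
noncomputable def siteKernel (w : α → ℝ) (q : ℝ) (x y : α) : ℝ :=
  q * (if x = y then 1 else 0) + (1 - q) * w y

/-- The product of the site kernels, with one parameter for each site. -/
noncomputable def kernel (w : α → ℝ) (q : ι → ℝ) (x y : ι → α) : ℝ :=
  ∏ i, siteKernel w (q i) (x i) (y i)

/-- The noise operator with kernel `kernel w q`. -/
noncomputable def noise (w : α → ℝ) (q : ι → ℝ) (u : (ι → α) → ℝ) (x : ι → α) : ℝ :=
  ∑ y, kernel w q x y * u y

/-- Expectation under the product of the weights. -/
noncomputable def mean (w : α → ℝ) (u : (ι → α) → ℝ) : ℝ :=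
  ∑ x, (∏ i, w (x i)) * u x

/-- Averaging over the coordinate `i`. -/
noncomputable def avg (w : α → ℝ) (i : ι) (u : (ι → α) → ℝ) (x : ι → α) : ℝ :=
  ∑ z, w z * u (update x i z)

variable {w : α → ℝ}

lemma IsWeight.le_one (hw : IsWeight w) (a : α) : w a ≤ 1 := by
  rw [← hw.sum_eq_one]
  exact single_le_sum (f := w) (fun b _ => hw.nonneg b) (mem_univ a)

lemma siteKernel_nonneg (hw : IsWeight w) {q : ℝ} (h0 : 0 ≤ q) (h1 : q ≤ 1) (x y : α) :
    0 ≤ siteKernel w q x y := by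
  have := hw.nonneg y
  have : 0 ≤ 1 - q := by linarith
  unfold siteKernel
  positivity

lemma sum_siteKernel (hw : IsWeight w) (q : ℝ) (x : α) : ∑ y, siteKernel w q x y = 1 := by
  simp [siteKernel, sum_add_distrib, ← mul_sum, hw.sum_eq_one]

lemma sum_siteKernel_mul (w : α → ℝ) (q : ℝ) (x : α) (u : α → ℝ) :
    ∑ y, siteKernel w q x y * u y = q * u x + (1 - q) * ∑ y, w y * u y := by
  simp [siteKernel, add_mul, sum_add_distrib, mul_sum, mul_assoc]

lemma sum_weight_mul_siteKernel (hw : IsWeight w) (q : ℝ) (y : α) :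
    ∑ z, w z * siteKernel w q z y = w y := by
  simp only [siteKernel, mul_add, sum_add_distrib, ← mul_assoc, ← sum_mul, hw.sum_eq_one]
  simp [mul_comm _ q, mul_assoc, ← mul_sum]
  ring

lemma siteKernel_symm (w : α → ℝ) (q : ℝ) (x y : α) :
    w x * siteKernel w q x y = w y * siteKernel w q y x := by
  unfold siteKernel
  by_cases h : x = y
  · subst h; ring
  · simp [h, Ne.symm h]; ring

lemma siteKernel_comp (hw : IsWeight w) (a b : ℝ) (x y : α) :
    ∑ z, siteKernel w a x z * siteKernel w b z y = siteKernel w (a * b) x y := by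
  rw [sum_siteKernel_mul w a x (fun z => siteKernel w b z y), sum_weight_mul_siteKernel hw]
  unfold siteKernel
  ring

lemma siteKernel_one (w : α → ℝ) (x y : α) :
    siteKernel w 1 x y = if x = y then 1 else 0 := by simp [siteKernel]

lemma siteKernel_zero (w : α → ℝ) (x y : α) : siteKernel w 0 x y = w y := by simp [siteKernel]

lemma siteKernel_le_one (hw : IsWeight w) {q : ℝ} (h0 : 0 ≤ q) (h1 : q ≤ 1) (x y : α) :
    siteKernel w q x y ≤ 1 := by
  rw [← sum_siteKernel hw q x]
  exact single_le_sum (f := siteKernel w q x) (fun b _ => siteKernel_nonneg hw h0 h1 x b)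
    (mem_univ y)

lemma kernel_nonneg (hw : IsWeight w) {q : ι → ℝ} (h0 : ∀ i, 0 ≤ q i) (h1 : ∀ i, q i ≤ 1)
    (x y : ι → α) : 0 ≤ kernel w q x y :=
  prod_nonneg fun i _ => siteKernel_nonneg hw (h0 i) (h1 i) _ _

/-- Fubini for products: it reduces the identities for `kernel` to a single site. -/
lemma sum_prod_eq (k : ι → α → ℝ) : ∑ y : ι → α, ∏ i, k i (y i) = ∏ i, ∑ a, k i a := by
  rw [prod_univ_sum]
  simp [Fintype.piFinset_univ]

lemma sum_kernel (hw : IsWeight w) (q : ι → ℝ) (x : ι → α) : ∑ y, kernel w q x y = 1 := by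
  unfold kernel
  rw [sum_prod_eq (fun i a => siteKernel w (q i) (x i) a)]
  simp [sum_siteKernel hw]

lemma kernel_comp (hw : IsWeight w) (a b : ι → ℝ) (x y : ι → α) :
    ∑ z, kernel w a x z * kernel w b z y = kernel w (a * b) x y := by
  unfold kernel
  simp only [← prod_mul_distrib]
  rw [sum_prod_eq (fun i c => siteKernel w (a i) (x i) c * siteKernel w (b i) c (y i))]
  simp [siteKernel_comp hw]

lemma kernel_symm (w : α → ℝ) (q : ι → ℝ) (x y : ι → α) :
    (∏ i, w (x i)) * kernel w q x y = (∏ i, w (y i)) * kernel w q y x := by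
  unfold kernel
  simp only [← prod_mul_distrib]
  exact prod_congr rfl fun i _ => siteKernel_symm w _ _ _

lemma noise_noise (hw : IsWeight w) (a b : ι → ℝ) (u : (ι → α) → ℝ) :
    noise w a (noise w b u) = noise w (a * b) u := by
  ext x
  simp only [noise, mul_sum, ← mul_assoc]
  rw [sum_comm]
  simp only [← sum_mul, kernel_comp hw]

lemma mean_mul_noise (w : α → ℝ) (q : ι → ℝ) (u v : (ι → α) → ℝ) :
    mean w (u * noise w q v) = mean w (noise w q u * v) := by
  simp only [mean, noise, Pi.mul_apply, mul_sum, sum_mul]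
  rw [sum_comm]
  refine sum_congr rfl fun y _ => sum_congr rfl fun x _ => ?_
  have := kernel_symm w q x y
  calc _ = ((∏ i, w (x i)) * kernel w q x y) * u x * v y := by ring
    _ = _ := by rw [this]; ring

lemma noise_const (hw : IsWeight w) (q : ι → ℝ) (c : ℝ) :
    noise w q (fun _ : ι → α => c) = fun _ => c := by
  ext x; simp [noise, ← sum_mul, sum_kernel hw]

lemma noise_sub (w : α → ℝ) (q : ι → ℝ) (u v : (ι → α) → ℝ) :
    noise w q (u - v) = noise w q u - noise w q v := by
  ext x; simp [noise, mul_sub, sum_sub_distrib]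

lemma noise_smul (w : α → ℝ) (q : ι → ℝ) (c : ℝ) (u : (ι → α) → ℝ) :
    noise w q (c • u) = c • noise w q u := by
  ext x; simp [noise, mul_sum, mul_left_comm]

lemma noise_mono (hw : IsWeight w) {q : ι → ℝ} (h0 : ∀ i, 0 ≤ q i) (h1 : ∀ i, q i ≤ 1)
    {u v : (ι → α) → ℝ} (h : ∀ x, u x ≤ v x) (x : ι → α) : noise w q u x ≤ noise w q v x :=
  sum_le_sum fun y _ => mul_le_mul_of_nonneg_left (h y) (kernel_nonneg hw h0 h1 x y)

lemma noise_nonneg (hw : IsWeight w) {q : ι → ℝ} (h0 : ∀ i, 0 ≤ q i) (h1 : ∀ i, q i ≤ 1)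
    {u : (ι → α) → ℝ} (h : ∀ x, 0 ≤ u x) (x : ι → α) : 0 ≤ noise w q u x :=
  sum_nonneg fun y _ => mul_nonneg (kernel_nonneg hw h0 h1 x y) (h y)

lemma noise_pos (hw : IsWeight w) {q : ι → ℝ} (h0 : ∀ i, 0 ≤ q i) (h1 : ∀ i, q i ≤ 1)
    {u : (ι → α) → ℝ} (h : ∀ x, 0 < u x) (x : ι → α) : 0 < noise w q u x := by
  have hs := sum_kernel hw q x
  obtain ⟨y, -, hy⟩ : ∃ y ∈ univ, 0 < kernel w q x y := by
    by_contra! hc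
    have : ∑ y, kernel w q x y ≤ 0 := sum_nonpos fun y hy => hc y hy
    linarith
  exact sum_pos' (fun y _ => mul_nonneg (kernel_nonneg hw h0 h1 x y) (h y).le)
    ⟨y, mem_univ y, mul_pos hy (h y)⟩

lemma noise_one (w : α → ℝ) (u : (ι → α) → ℝ) : noise w (1 : ι → ℝ) u = u := by
  ext x
  have : ∀ y, kernel w (1 : ι → ℝ) x y = if x = y then 1 else 0 := by
    intro y
    simp only [kernel, Pi.one_apply, siteKernel_one]
    by_cases h : x = y
    · simp [h]
    · obtain ⟨i, hi⟩ := Function.ne_iff.1 h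
      rw [if_neg h]
      exact prod_eq_zero (mem_univ i) (by simp [hi])
  simp [noise, this]

lemma noise_zero (w : α → ℝ) (u : (ι → α) → ℝ) (x : ι → α) :
    noise w (0 : ι → ℝ) u x = mean w u := by
  simp [noise, mean, kernel, siteKernel_zero]

lemma mean_one (hw : IsWeight w) : mean w (1 : (ι → α) → ℝ) = 1 := by
  simp only [mean, Pi.one_apply, mul_one]
  rw [sum_prod_eq (fun _ a => w a)]
  simp [hw.sum_eq_one]

lemma mean_noise (hw : IsWeight w) (q : ι → ℝ) (u : (ι → α) → ℝ) :
    mean w (noise w q u) = mean w u := by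
  have := mean_mul_noise w q 1 u
  have h1 : noise w q (1 : (ι → α) → ℝ) = 1 := noise_const hw q 1
  rwa [h1, one_mul, one_mul] at this

lemma mean_add (w : α → ℝ) (u v : (ι → α) → ℝ) : mean w (u + v) = mean w u + mean w v := by
  simp [mean, mul_add, sum_add_distrib]

lemma mean_sub (w : α → ℝ) (u v : (ι → α) → ℝ) : mean w (u - v) = mean w u - mean w v := by
  simp [mean, mul_sub, sum_sub_distrib]

lemma mean_smul (w : α → ℝ) (c : ℝ) (u : (ι → α) → ℝ) : mean w (c • u) = c * mean w u := by
  simp [mean, mul_sum, mul_left_comm]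

lemma mean_sum {κ : Type*} (s : Finset κ) (w : α → ℝ) (u : κ → (ι → α) → ℝ) :
    mean w (fun x => ∑ k ∈ s, u k x) = ∑ k ∈ s, mean w (u k) := by
  simp only [mean, mul_sum]
  exact sum_comm

lemma mean_mono (hw : IsWeight w) {u v : (ι → α) → ℝ} (h : ∀ x, u x ≤ v x) :
    mean w u ≤ mean w v :=
  sum_le_sum fun x _ => mul_le_mul_of_nonneg_left (h x) (prod_nonneg fun i _ => hw.nonneg _)

lemma mean_nonneg (hw : IsWeight w) {u : (ι → α) → ℝ} (h : ∀ x, 0 ≤ u x) : 0 ≤ mean w u :=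
  sum_nonneg fun x _ => mul_nonneg (prod_nonneg fun i _ => hw.nonneg _) (h x)

lemma mean_const (hw : IsWeight w) (c : ℝ) : mean w (fun _ : ι → α => c) = c := by
  have := mean_smul w c (1 : (ι → α) → ℝ)
  rw [mean_one hw, mul_one] at this
  convert this using 2
  ext; simp

lemma kernel_eq_mul_erase (w : α → ℝ) (q : ι → ℝ) (i : ι) (x y : ι → α) :
    kernel w q x y
      = siteKernel w (q i) (x i) (y i) * ∏ j ∈ univ.erase i, siteKernel w (q j) (x j) (y j) :=
  (mul_prod_erase _ _ (mem_univ i)).symm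

lemma kernel_update_left (w : α → ℝ) (q : ι → ℝ) (i : ι) (z : α) (x y : ι → α) :
    kernel w q (update x i z) y
      = siteKernel w (q i) z (y i) * ∏ j ∈ univ.erase i, siteKernel w (q j) (x j) (y j) := by
  rw [kernel_eq_mul_erase w q i]
  congr 1
  · simp
  · exact prod_congr rfl fun j hj => by rw [update_of_ne (ne_of_mem_erase hj)]

lemma kernel_update_param (w : α → ℝ) (q : ι → ℝ) (i : ι) (c : ℝ) (x y : ι → α) :
    kernel w (update q i c) x y
      = siteKernel w c (x i) (y i) * ∏ j ∈ univ.erase i, siteKernel w (q j) (x j) (y j) := by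
  rw [kernel_eq_mul_erase w _ i]
  congr 1
  · simp
  · exact prod_congr rfl fun j hj => by rw [update_of_ne (ne_of_mem_erase hj)]

lemma avg_noise (hw : IsWeight w) (i : ι) (q : ι → ℝ) (u : (ι → α) → ℝ) :
    avg w i (noise w q u) = noise w (update q i 0) u := by
  ext x
  simp only [avg, noise, mul_sum]
  rw [sum_comm]
  refine sum_congr rfl fun y _ => ?_
  simp only [kernel_update_left, kernel_update_param, siteKernel_zero]
  rw [← sum_weight_mul_siteKernel hw (q i) (y i), sum_mul, sum_mul]
  exact sum_congr rfl fun z _ => by ring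

lemma avg_eq_noise (hw : IsWeight w) (i : ι) (u : (ι → α) → ℝ) :
    avg w i u = noise w (update 1 i 0) u := by
  rw [← avg_noise hw, noise_one]

lemma noise_avg (hw : IsWeight w) (i : ι) (q : ι → ℝ) (u : (ι → α) → ℝ) :
    noise w q (avg w i u) = avg w i (noise w q u) := by
  rw [avg_eq_noise hw, avg_eq_noise hw, noise_noise hw, noise_noise hw, mul_comm]

lemma avg_avg (hw : IsWeight w) (i : ι) (u : (ι → α) → ℝ) :
    avg w i (avg w i u) = avg w i u := by
  rw [avg_eq_noise hw, avg_eq_noise hw, noise_noise hw]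
  congr 1
  ext j
  by_cases h : j = i
  · subst h; simp
  · simp [h]

lemma mean_avg (hw : IsWeight w) (i : ι) (u : (ι → α) → ℝ) : mean w (avg w i u) = mean w u := by
  rw [avg_eq_noise hw, mean_noise hw]

lemma mean_mul_avg (hw : IsWeight w) (i : ι) (u v : (ι → α) → ℝ) :
    mean w (u * avg w i v) = mean w (avg w i u * v) := by
  rw [avg_eq_noise hw, avg_eq_noise hw, mean_mul_noise]

lemma avg_mul_of_indep (w : α → ℝ) (i : ι) {k : (ι → α) → ℝ}
    (hk : ∀ x z, k (update x i z) = k x) (u : (ι → α) → ℝ) :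
    avg w i (k * u) = k * avg w i u := by
  ext x
  simp [avg, hk, mul_sum, mul_left_comm]

lemma avg_update (w : α → ℝ) (i : ι) (u : (ι → α) → ℝ) (x : ι → α) (z : α) :
    avg w i u (update x i z) = avg w i u x := by
  simp [avg]

lemma avg_sub (w : α → ℝ) (i : ι) (u v : (ι → α) → ℝ) :
    avg w i (u - v) = avg w i u - avg w i v := by
  ext x; simp [avg, mul_sub, sum_sub_distrib]

lemma avg_nonneg (hw : IsWeight w) (i : ι) {u : (ι → α) → ℝ} (h : ∀ x, 0 ≤ u x) (x : ι → α) :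
    0 ≤ avg w i u x :=
  sum_nonneg fun z _ => mul_nonneg (hw.nonneg z) (h _)

lemma avg_pos (hw : IsWeight w) (i : ι) {u : (ι → α) → ℝ} (h : ∀ x, 0 < u x) (x : ι → α) :
    0 < avg w i u x := by
  rw [avg_eq_noise hw]
  refine noise_pos hw (fun j => ?_) (fun j => ?_) h x <;>
  · by_cases hj : j = i
    · subst hj; simp
    · simp [hj]

/-- Conditioning on whether the site `i` is kept or resampled. -/
lemma noise_split (w : α → ℝ) (q : ι → ℝ) (i : ι) (u : (ι → α) → ℝ) (x : ι → α) :
    noise w q u x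
      = q i * noise w (update q i 1) u x + (1 - q i) * noise w (update q i 0) u x := by
  simp only [noise, mul_sum, ← sum_add_distrib]
  refine sum_congr rfl fun y _ => ?_
  rw [kernel_eq_mul_erase w q i, kernel_update_param, kernel_update_param, siteKernel_one,
    siteKernel_zero, siteKernel]
  ring

/-- The noise operator at a site is bounded below by the resampling operator. -/
lemma mul_avg_noise_le (hw : IsWeight w) {q : ι → ℝ} (h0 : ∀ i, 0 ≤ q i) (h1 : ∀ i, q i ≤ 1)
    (i : ι) {u : (ι → α) → ℝ} (hu : ∀ x, 0 ≤ u x) (x : ι → α) :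
    (1 - q i) * avg w i (noise w q u) x ≤ noise w q u x := by
  rw [noise_split w q i u x, avg_noise hw]
  have : 0 ≤ noise w (update q i 1) u x := by
    refine noise_nonneg hw (fun j => ?_) (fun j => ?_) hu x <;>
    · by_cases hj : j = i
      · subst hj; simp
      · simp [hj, h0, h1]
  have := mul_nonneg (h0 i) this
  linarith

/-- With probability at least `∏ i, q i` no site is resampled. -/
lemma prod_mul_le_noise (hw : IsWeight w) {q : ι → ℝ} (h0 : ∀ i, 0 ≤ q i) (h1 : ∀ i, q i ≤ 1)
    {u : (ι → α) → ℝ} (hu : ∀ x, 0 ≤ u x) (x : ι → α) :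
    (∏ i, q i) * u x ≤ noise w q u x := by
  refine le_trans ?_ (single_le_sum (f := fun y => kernel w q x y * u y)
    (fun y _ => mul_nonneg (kernel_nonneg hw h0 h1 x y) (hu y)) (mem_univ x))
  refine mul_le_mul_of_nonneg_right ?_ (hu x)
  refine prod_le_prod (fun i _ => h0 i) fun i _ => ?_
  have := mul_nonneg (sub_nonneg.2 (h1 i)) (hw.nonneg (x i))
  simp only [siteKernel, if_true]
  linarith

/-- Derivative of the homogeneous noise operator in its parameter. -/
lemma hasDerivAt_noise (hw : IsWeight w) (u : (ι → α) → ℝ) (x : ι → α) {q : ℝ} (hq : q ≠ 0) :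
    HasDerivAt (fun s : ℝ => noise w (fun _ : ι => s) u x)
      (q⁻¹ * ∑ i, (noise w (fun _ => q) u x - avg w i (noise w (fun _ => q) u) x)) q := by
  have hs : ∀ a b : α, HasDerivAt (fun s : ℝ => siteKernel w s a b)
      ((if a = b then 1 else 0) - w b) q := by
    intro a b
    have h1 := (hasDerivAt_id q).mul_const (if a = b then (1 : ℝ) else 0)
    have h2 := ((hasDerivAt_id q).const_sub 1).mul_const (w b)
    refine (h1.add h2).congr_deriv ?_
    simp [sub_eq_add_neg]
  have hk : ∀ y, HasDerivAt (fun s : ℝ => kernel w (fun _ : ι => s) x y * u y)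
      ((∑ i, (∏ j ∈ univ.erase i, siteKernel w q (x j) (y j))
        * ((if x i = y i then 1 else 0) - w (y i))) * u y) q := by
    intro y
    have := HasDerivAt.fun_finsetProd (u := (univ : Finset ι))
      (f := fun i s => siteKernel w s (x i) (y i)) (fun i _ => hs (x i) (y i))
    simpa [kernel] using this.mul_const (u y)
  have := HasDerivAt.fun_sum (u := (univ : Finset (ι → α))) fun y _ => hk y
  refine this.congr_deriv ?_
  simp only [avg_noise hw]
  rw [mul_sum]
  simp only [sum_mul]
  rw [sum_comm]
  refine sum_congr rfl fun i _ => ?_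
  -- The derivative of a site factor is the difference between keeping and resampling; the splitting
  -- identifies it with (T - E_i T) / q.
  rw [noise_split w (fun _ => q) i u x]
  have e : q⁻¹ * (q * noise w (update (fun _ => q) i 1) u x
      + (1 - q) * noise w (update (fun _ => q) i 0) u x
      - noise w (update (fun _ => q) i 0) u x)
      = noise w (update (fun _ => q) i 1) u x - noise w (update (fun _ => q) i 0) u x := by
    field_simp; ring
  rw [e]
  simp only [noise, ← sum_sub_distrib]
  refine sum_congr rfl fun y _ => ?_
  rw [kernel_update_param, kernel_update_param, siteKernel_one, siteKernel_zero]
  ring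

lemma continuous_noise (w : α → ℝ) (u : (ι → α) → ℝ) (x : ι → α) :
    Continuous (fun s : ℝ => noise w (fun _ : ι => s) u x) := by
  unfold noise kernel siteKernel
  fun_prop

/-! ### The noise as an average over random resampling maps -/

/-- Law of the letter that replaces the current one; `none` means that it is kept. -/
noncomputable def optWeight (w : α → ℝ) (q : ℝ) : Option α → ℝ
  | none => q
  | some z => (1 - q) * w z

/-- Resample the sites at which `o` is not `none`. -/
def resample (o : ι → Option α) (x : ι → α) : ι → α := fun i => (o i).getD (x i)

lemma optWeight_nonneg (hw : IsWeight w) {q : ℝ} (h0 : 0 ≤ q) (h1 : q ≤ 1) (o : Option α) :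
    0 ≤ optWeight w q o := by
  cases o with
  | none => exact h0
  | some z => exact mul_nonneg (by linarith) (hw.nonneg z)

/-- The maps `resample o` and their weights do not depend on the starting point, so using the same
`o` at two configurations couples their noises. -/
lemma noise_eq_sum_resample (w : α → ℝ) (q : ι → ℝ) (u : (ι → α) → ℝ) (x : ι → α) :
    noise w q u x = ∑ o : ι → Option α, (∏ i, optWeight w (q i) (o i)) * u (resample o x) := by
  have h : ∀ o : ι → Option α, (∏ i, optWeight w (q i) (o i)) * u (resample o x)
      = ∑ y, (∏ i, optWeight w (q i) (o i) * if (o i).getD (x i) = y i then 1 else 0) * u y := by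
    intro o
    rw [sum_eq_single (resample o x)]
    · congr 1
      exact prod_congr rfl fun i _ => by simp [resample]
    · intro y _ hy
      obtain ⟨i, hi⟩ := Function.ne_iff.1 hy.symm
      rw [prod_eq_zero (mem_univ i), zero_mul]
      rw [if_neg (show ¬ (o i).getD (x i) = y i from hi), mul_zero]
    · simp
  simp only [h]
  rw [sum_comm]
  refine sum_congr rfl fun y _ => ?_
  rw [← sum_mul, sum_prod_eq (fun i o => optWeight w (q i) o *
    if o.getD (x i) = y i then (1 : ℝ) else 0)]
  congr 1
  refine prod_congr rfl fun i _ => ?_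
  rw [Fintype.sum_option]
  simp [siteKernel, optWeight]

/-- Every `o` of nonzero weight has `o i = none`, and then `resample o` commutes with the update at
`i`. -/
lemma noise_update_of_eq_one (w : α → ℝ) {q : ι → ℝ} {i : ι} (hi : q i = 1) (u : (ι → α) → ℝ)
    (x : ι → α) (z : α) :
    noise w q u (update x i z) = noise w q (fun y => u (update y i z)) x := by
  rw [noise_eq_sum_resample, noise_eq_sum_resample]
  refine sum_congr rfl fun o _ => ?_
  cases ho : o i with
  | some a =>
    rw [prod_eq_zero (mem_univ i) (by simp [ho, hi, optWeight]), zero_mul, zero_mul]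
  | none =>
    congr 2
    ext j
    by_cases hj : j = i
    · subst hj; simp [resample, ho]
    · simp [resample, hj]

lemma noise_sq_le (hw : IsWeight w) {q : ι → ℝ} (h0 : ∀ i, 0 ≤ q i) (h1 : ∀ i, q i ≤ 1)
    (u : (ι → α) → ℝ) (x : ι → α) : (noise w q u x) ^ 2 ≤ noise w q (fun y => u y ^ 2) x := by
  have h := (even_two.convexOn_pow (𝕜 := ℝ)).map_sum_le
    (t := univ) (w := kernel w q x) (p := u) (fun y _ => kernel_nonneg hw h0 h1 x y)
    (sum_kernel hw q x) (fun _ _ => Set.mem_univ _)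
  simpa [noise] using h

lemma noise_rpow_le (hw : IsWeight w) {q : ι → ℝ} (h0 : ∀ i, 0 ≤ q i) (h1 : ∀ i, q i ≤ 1)
    {u : (ι → α) → ℝ} (hu : ∀ x, 0 ≤ u x) {s : ℝ} (hs0 : 0 ≤ s) (hs1 : s ≤ 1) (x : ι → α) :
    noise w q (fun y => u y ^ s) x ≤ (noise w q u x) ^ s := by
  have h := (Real.concaveOn_rpow hs0 hs1).le_map_sum
    (t := univ) (w := kernel w q x) (p := u) (fun y _ => kernel_nonneg hw h0 h1 x y)
    (sum_kernel hw q x) (fun y _ => hu y)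
  simpa [noise] using h

lemma avg_rpow_le (hw : IsWeight w) (i : ι) {u : (ι → α) → ℝ} (hu : ∀ x, 0 ≤ u x) {s : ℝ}
    (hs0 : 0 ≤ s) (hs1 : s ≤ 1) (x : ι → α) :
    avg w i (fun y => u y ^ s) x ≤ (avg w i u x) ^ s := by
  rw [avg_eq_noise hw, avg_eq_noise hw]
  refine noise_rpow_le hw (fun j => ?_) (fun j => ?_) hu hs0 hs1 x <;>
  · by_cases hj : j = i
    · subst hj; simp
    · simp [hj]

end Algebra

/-! ### The factorization h = f * T g with a regular other end -/

section Factorization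

variable {ι α : Type*} [Fintype ι] [DecidableEq ι] [Fintype α] [DecidableEq α] {w : α → ℝ}

/-- The logarithm of the noise operator applied to an exponential is `1`-Lipschitz. -/
lemma log_noise_exp_le (hw : IsWeight w) {q : ι → ℝ} (h0 : ∀ i, 0 ≤ q i) (h1 : ∀ i, q i ≤ 1)
    {u v : (ι → α) → ℝ} {c : ℝ} (h : ∀ x, u x ≤ v x + c) (x : ι → α) :
    Real.log (noise w q (fun y => Real.exp (u y)) x)
      ≤ Real.log (noise w q (fun y => Real.exp (v y)) x) + c := by
  have hu := noise_pos hw h0 h1 (u := fun y => Real.exp (u y)) (fun _ => Real.exp_pos _) x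
  have hv := noise_pos hw h0 h1 (u := fun y => Real.exp (v y)) (fun _ => Real.exp_pos _) x
  rw [← Real.log_exp c, ← Real.log_mul hv.ne' (Real.exp_pos c).ne']
  refine Real.log_le_log hu ?_
  have := noise_mono hw h0 h1 (u := fun y => Real.exp (u y))
    (v := Real.exp c • fun y => Real.exp (v y)) (fun y => by
      simp only [Pi.smul_apply, smul_eq_mul]
      rw [← Real.exp_add]
      exact Real.exp_le_exp.2 (by linarith [h y])) x
  rw [noise_smul] at this
  simpa [mul_comm] using this

lemma abs_log_noise_exp_sub_le (hw : IsWeight w) {q : ι → ℝ} (h0 : ∀ i, 0 ≤ q i)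
    (h1 : ∀ i, q i ≤ 1) {u v : (ι → α) → ℝ} {c : ℝ} (h : ∀ x, |u x - v x| ≤ c) (x : ι → α) :
    |Real.log (noise w q (fun y => Real.exp (u y)) x)
      - Real.log (noise w q (fun y => Real.exp (v y)) x)| ≤ c := by
  rw [abs_le]
  constructor
  · have := log_noise_exp_le hw h0 h1 (u := v) (v := u) (c := c)
      (fun x => by linarith [(abs_le.1 (h x)).1]) x
    linarith
  · have := log_noise_exp_le hw h0 h1 (u := u) (v := v) (c := c)
      (fun x => by linarith [(abs_le.1 (h x)).2]) x
    linarith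

/-- For u = log f the equation reads u = log h - L(-γ L u), where L u = log T(e^u). Since L is
1-Lipschitz in the sup norm, the right side contracts by γ < 1 and Banach's fixed point theorem
applies. -/
lemma exists_mul_noise_rpow_eq (hw : IsWeight w) {q : ι → ℝ} (h0 : ∀ i, 0 ≤ q i)
    (h1 : ∀ i, q i ≤ 1) {γ : ℝ} (hγ0 : 0 ≤ γ) (hγ1 : γ < 1) {h : (ι → α) → ℝ}
    (hh : ∀ x, 0 < h x) :
    ∃ f : (ι → α) → ℝ, (∀ x, 0 < f x) ∧
      ∀ x, f x * noise w q (fun y => noise w q f y ^ (-γ)) x = h x := by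
  set L : ((ι → α) → ℝ) → (ι → α) → ℝ :=
    fun u x => Real.log (noise w q (fun y => Real.exp (u y)) x) with hL
  set Φ : ((ι → α) → ℝ) → (ι → α) → ℝ :=
    fun u x => Real.log (h x) - L (fun y => -γ * L u y) x with hΦ
  have hlip : ContractingWith (Real.toNNReal γ) Φ := by
    refine ⟨by simpa using hγ1, LipschitzWith.of_dist_le_mul fun u v => ?_⟩
    rw [Real.coe_toNNReal _ hγ0]
    refine (dist_pi_le_iff (by positivity)).2 fun x => ?_
    have hd : ∀ x, |u x - v x| ≤ dist u v := fun x => by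
      rw [← Real.dist_eq]; exact dist_le_pi_dist u v x
    have hb := abs_log_noise_exp_sub_le hw h0 h1 hd
    have hc := abs_log_noise_exp_sub_le hw h0 h1 (u := fun y => -γ * L u y)
      (v := fun y => -γ * L v y) (c := γ * dist u v) (fun y => by
        rw [← mul_sub, abs_mul, abs_neg, abs_of_nonneg hγ0]
        exact mul_le_mul_of_nonneg_left (hb y) hγ0) x
    rw [Real.dist_eq, ← abs_neg]
    convert hc using 2
    simp only [hΦ, hL]
    ring
  set u := hlip.fixedPoint
  have hu : Φ u = u := hlip.fixedPoint_isFixedPt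
  refine ⟨fun x => Real.exp (u x), fun _ => Real.exp_pos _, fun x => ?_⟩
  have e : (fun y => noise w q (fun x => Real.exp (u x)) y ^ (-γ))
      = fun y => Real.exp (-γ * L u y) := by
    ext y
    rw [Real.rpow_def_of_pos (noise_pos hw h0 h1 (fun _ => Real.exp_pos _) y), mul_comm]
  have hp := noise_pos hw h0 h1 (u := fun y => Real.exp (-γ * L u y))
    (fun _ => Real.exp_pos _) x
  have hx := congrFun hu x
  have hx' : Real.exp (u x) = h x / noise w q (fun y => Real.exp (-γ * L u y)) x := by
    rw [← hx]
    change Real.exp (Real.log (h x) - Real.log _) = _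
    rw [Real.exp_sub, Real.exp_log (hh x), Real.exp_log hp]
  rw [e]
  change Real.exp (u x) * _ = _
  rw [hx', div_mul_cancel₀ _ hp.ne']

/-- A density `h ≤ e^p` factorizes as `f * T g`, where the density `r = g * T f` at the other end
is bounded by `e^p` and satisfies a one-sided regularity bound. -/
lemma exists_factorization (hw : IsWeight w) {ℓ p : ℝ} (hℓ : 1 ≤ ℓ) (hp : 0 ≤ p)
    {h : (ι → α) → ℝ} (hh : ∀ x, 0 < h x) (hh1 : mean w h = 1)
    (hhp : ∀ x, h x ≤ Real.exp p) :
    ∃ (γ : ℝ) (f g r : (ι → α) → ℝ), 0 ≤ γ ∧ γ ≤ 1 ∧ (∀ x, 0 < f x) ∧ (∀ x, 0 < g x) ∧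
      (∀ x, 0 < r x) ∧
      (∀ x, f x * noise w (fun _ => 1 - Real.exp (-ℓ)) g x = h x) ∧
      (∀ x, g x = noise w (fun _ => 1 - Real.exp (-ℓ)) f x ^ (-γ)) ∧
      (∀ x, r x = noise w (fun _ => 1 - Real.exp (-ℓ)) f x * g x) ∧
      mean w r = 1 ∧ (∀ x, r x ≤ Real.exp p) ∧ (∀ x, f x ≤ Real.exp (p * ℓ)) ∧
      (∀ i x, avg w i r x ≤ Real.exp 1 * r x) ∧
      (∀ x, Real.exp (-3) ≤ r x →
        Real.exp (-3 * ℓ) ≤ noise w (fun _ => 1 - Real.exp (-ℓ)) f x) := by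
  set δ := Real.exp (-ℓ) with hδ
  have hδ0 : 0 < δ := Real.exp_pos _
  have hδ1 : δ ≤ 1 := Real.exp_le_one_iff.2 (by linarith)
  have h0 : ∀ i : ι, 0 ≤ (fun _ : ι => 1 - δ) i := fun _ => by simpa using hδ1
  have h1 : ∀ i : ι, (fun _ : ι => 1 - δ) i ≤ 1 := fun _ => by simpa using hδ0.le
  have hℓ0 : 0 < ℓ := by linarith
  set θ := ℓ⁻¹ with hθ
  have hθ0 : 0 < θ := inv_pos.2 hℓ0
  have hθ1 : θ ≤ 1 := inv_le_one_of_one_le₀ hℓ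
  -- This γ leaves T f * g = (T f)^θ; the small exponent θ = 1/ℓ tames oscillations of T f by
  -- factors e^ℓ.
  obtain ⟨f, hf, hfh⟩ := exists_mul_noise_rpow_eq hw h0 h1 (γ := 1 - θ) (by linarith)
    (by linarith) hh
  set v := noise w (fun _ => 1 - δ) f with hv
  have hvpos : ∀ x, 0 < v x := noise_pos hw h0 h1 hf
  set g : (ι → α) → ℝ := fun y => v y ^ (-(1 - θ)) with hg
  have hgpos : ∀ x, 0 < g x := fun x => Real.rpow_pos_of_pos (hvpos x) _
  have hr : ∀ x, v x * g x = v x ^ θ := fun x => by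
    simp only [hg]
    rw [← Real.rpow_one_add' (hvpos x).le (by linarith)]
    congr 1; ring
  have hne : Nonempty (ι → α) := by
    by_contra hc
    have : IsEmpty (ι → α) := not_nonempty_iff.1 hc
    simp [mean] at hh1
  -- All upper bounds come from M = max T f. As g ≥ M^(-γ) and f * T g ≤ e^p, one gets f ≤ e^p M^γ;
  -- applying T yields M ≤ e^p M^γ, that is M^θ ≤ e^p.
  obtain ⟨x₀, hx₀⟩ := Finite.exists_max v
  have hM := hvpos x₀
  have hfM : ∀ x, f x ≤ Real.exp p * v x₀ ^ (1 - θ) := fun x => by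
    have h2 : v x₀ ^ (-(1 - θ)) ≤ noise w (fun _ => 1 - δ) g x := by
      have := noise_mono hw h0 h1 (u := fun _ => v x₀ ^ (-(1 - θ))) (v := g) (fun y =>
        Real.rpow_le_rpow_of_nonpos (hvpos y) (hx₀ y) (by linarith)) x
      rwa [noise_const hw] at this
    have h3 : f x * v x₀ ^ (-(1 - θ)) ≤ Real.exp p :=
      (mul_le_mul_of_nonneg_left h2 (hf x).le).trans ((hfh x).trans_le (hhp x))
    rw [Real.rpow_neg hM.le] at h3
    rwa [← div_eq_mul_inv, div_le_iff₀ (Real.rpow_pos_of_pos hM _)] at h3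
  have hMM : v x₀ ≤ Real.exp p * v x₀ ^ (1 - θ) := by
    have := noise_mono hw h0 h1 hfM x₀
    rwa [noise_const hw] at this
  have hMθ : v x₀ ^ θ ≤ Real.exp p := by
    have e : v x₀ = v x₀ ^ θ * v x₀ ^ (1 - θ) := by
      rw [← Real.rpow_add hM]; simp
    have hpos := Real.rpow_pos_of_pos hM (1 - θ)
    have : v x₀ ^ θ * v x₀ ^ (1 - θ) ≤ Real.exp p * v x₀ ^ (1 - θ) := by rw [← e]; exact hMM
    exact le_of_mul_le_mul_right this hpos
  have hMℓ : v x₀ ≤ Real.exp (p * ℓ) := by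
    have := Real.rpow_le_rpow (Real.rpow_nonneg hM.le _) hMθ hℓ0.le
    rwa [← Real.rpow_mul hM.le, hθ, inv_mul_cancel₀ hℓ0.ne', Real.rpow_one, ← Real.exp_mul]
      at this
  refine ⟨1 - θ, f, g, fun x => v x * g x, by linarith, by linarith, hf, hgpos,
    fun x => mul_pos (hvpos x) (hgpos x), hfh, fun x => rfl, fun x => rfl, ?_, ?_, ?_, ?_, ?_⟩
  · have := mean_mul_noise w (fun _ => 1 - δ) f g
    have e : f * noise w (fun _ => 1 - δ) g = h := funext hfh
    rw [e, hh1] at this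
    exact this.symm
  · intro x
    change v x * g x ≤ _
    rw [hr]
    exact (Real.rpow_le_rpow (hvpos x).le (hx₀ x) hθ0.le).trans hMθ
  · intro x
    refine (hfM x).trans ?_
    have : v x₀ ^ (1 - θ) ≤ Real.exp (p * ℓ) ^ (1 - θ) :=
      Real.rpow_le_rpow hM.le hMℓ (by linarith)
    refine (mul_le_mul_of_nonneg_left this (Real.exp_pos p).le).trans ?_
    rw [← Real.exp_mul, ← Real.exp_add]
    apply le_of_eq
    congr 1
    rw [hθ]; field_simp; ring
  · intro i x
    have e : (fun x => v x * g x) = fun x => v x ^ θ := funext hr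
    rw [e]
    -- Jensen for the concave power θ reduces the claim to E_i v ≤ e^ℓ v, which holds because the
    -- noise resamples the site with probability e^(-ℓ).
    refine (avg_rpow_le hw i (fun x => (hvpos x).le) hθ0.le hθ1 x).trans ?_
    have h2 := mul_avg_noise_le hw h0 h1 i (fun x => (hf x).le) x
    rw [← hv] at h2
    have h2 : avg w i v x ≤ Real.exp ℓ * v x := by
      have h3 : δ * avg w i v x ≤ v x := by simpa using h2
      have h4 := mul_le_mul_of_nonneg_left h3 (Real.exp_pos ℓ).le
      rwa [← mul_assoc, hδ, ← Real.exp_add, add_neg_cancel, Real.exp_zero, one_mul] at h4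
    refine (Real.rpow_le_rpow (avg_nonneg hw i (fun x => (hvpos x).le) x) h2 hθ0.le).trans ?_
    rw [Real.mul_rpow (Real.exp_pos _).le (hvpos x).le, ← Real.exp_mul, hθ,
      mul_inv_cancel₀ hℓ0.ne']
  · intro x hx
    change _ ≤ v x * g x at hx
    rw [hr] at hx
    have := Real.rpow_le_rpow (Real.exp_pos _).le hx hℓ0.le
    rwa [← Real.rpow_mul (hvpos x).le, hθ, inv_mul_cancel₀ hℓ0.ne', Real.rpow_one,
      ← Real.exp_mul] at this

end Factorization

/-! ### Only about p sites matter -/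

section Far

variable {ι α : Type*} [Fintype ι] [DecidableEq ι] [Fintype α] [DecidableEq α] {w : α → ℝ}

lemma pow_hammingDist (c : ℝ) (x y : ι → α) :
    c ^ hammingDist x y = ∏ i, if x i ≠ y i then c else 1 := by
  rw [prod_ite]; simp [hammingDist]

/-- Per site, a changed letter y has kernel weight δ w y, which the tilt turns into 2 w y; the
unchanged letter adds at most 1. -/
lemma sum_pow_hammingDist_mul_kernel_le (hw : IsWeight w) {δ : ℝ} (hδ0 : 0 < δ) (hδ1 : δ ≤ 1)
    (x : ι → α) :
    ∑ y, (2 / δ) ^ hammingDist x y * kernel w (fun _ => 1 - δ) x y ≤ 3 ^ Fintype.card ι := by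
  simp only [pow_hammingDist, kernel, ← prod_mul_distrib]
  rw [sum_prod_eq (fun i a => (if x i ≠ a then 2 / δ else 1) * siteKernel w (1 - δ) (x i) a)]
  rw [← card_univ, ← prod_const]
  refine prod_le_prod (fun i _ => sum_nonneg fun a _ => mul_nonneg (by split_ifs <;> positivity)
    (siteKernel_nonneg hw (by linarith) (by linarith) _ _)) fun i _ => ?_
  have hb : ∀ a, (if x i ≠ a then 2 / δ else 1) * siteKernel w (1 - δ) (x i) a
      ≤ (if x i = a then 1 else 0) + 2 * w a := by
    intro a
    have hwa := hw.nonneg a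
    by_cases h : x i = a
    · have := siteKernel_le_one hw (q := 1 - δ) (by linarith) (by linarith) (x i) a
      simp [h] at this ⊢
      linarith
    · simp [h, siteKernel]
      apply le_of_eq; field_simp
  refine (sum_le_sum fun a _ => hb a).trans ?_
  rw [sum_add_distrib, ← mul_sum, hw.sum_eq_one]
  simp; norm_num

/-- The part of `∑ y, 2 ^ d(x, y) * k(x, y) * f y` at Hamming distance more than `m` is
negligible. -/
lemma sum_far_le (hw : IsWeight w) {ℓ p : ℝ} (hℓ : 1 ≤ ℓ)
    (hsmall : 3 ^ Fintype.card ι * Real.exp (-ℓ) ≤ 1) {m : ℕ} (hm : p + 3 ≤ m)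
    {f : (ι → α) → ℝ} (hf0 : ∀ x, 0 ≤ f x) (hf : ∀ x, f x ≤ Real.exp (p * ℓ)) (x : ι → α) :
    ∑ y with m < hammingDist x y,
      2 ^ hammingDist x y * kernel w (fun _ => 1 - Real.exp (-ℓ)) x y * f y
        ≤ Real.exp (-3 * ℓ) := by
  set δ := Real.exp (-ℓ) with hδ
  have hδ0 : 0 < δ := Real.exp_pos _
  have hδ1 : δ ≤ 1 := Real.exp_le_one_iff.2 (by linarith)
  have hk : ∀ y, 0 ≤ kernel w (fun _ => 1 - δ) x y :=
    kernel_nonneg hw (fun _ => by linarith) (fun _ => by linarith) x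
  calc ∑ y with m < hammingDist x y, 2 ^ hammingDist x y * kernel w (fun _ => 1 - δ) x y * f y
      ≤ ∑ y with m < hammingDist x y, (δ ^ (m + 1) * Real.exp (p * ℓ)) *
          ((2 / δ) ^ hammingDist x y * kernel w (fun _ => 1 - δ) x y) := by
        refine sum_le_sum fun y hy => ?_
        have hd : m + 1 ≤ hammingDist x y := (mem_filter.1 hy).2
        have h1 : δ ^ hammingDist x y ≤ δ ^ (m + 1) := pow_le_pow_of_le_one hδ0.le hδ1 hd
        have h2 : (2 : ℝ) ^ hammingDist x y ≤ δ ^ (m + 1) * (2 / δ) ^ hammingDist x y := by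
          rw [div_pow, mul_div_assoc', le_div_iff₀ (by positivity), mul_comm]
          gcongr
        calc _ ≤ (δ ^ (m + 1) * (2 / δ) ^ hammingDist x y) * kernel w (fun _ => 1 - δ) x y
              * Real.exp (p * ℓ) := by
              gcongr
              · exact hf0 y
              · exact mul_nonneg (by positivity) (hk y)
              · exact hk y
              · exact hf y
          _ = _ := by ring
    _ ≤ ∑ y, (δ ^ (m + 1) * Real.exp (p * ℓ)) *
          ((2 / δ) ^ hammingDist x y * kernel w (fun _ => 1 - δ) x y) :=
        sum_le_sum_of_subset_of_nonneg (filter_subset _ _) fun y _ _ =>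
          mul_nonneg (by positivity) (mul_nonneg (by positivity) (hk y))
    _ ≤ (δ ^ (m + 1) * Real.exp (p * ℓ)) * 3 ^ Fintype.card ι := by
        rw [← mul_sum]
        exact mul_le_mul_of_nonneg_left (sum_pow_hammingDist_mul_kernel_le hw hδ0 hδ1 x)
          (by positivity)
    -- One of the m + 1 factors δ absorbs 3^n; since m ≥ p + 3, the others beat e^(pℓ) and leave
    -- e^(-3ℓ).
    _ = (3 ^ Fintype.card ι * δ) * (δ ^ m * Real.exp (p * ℓ)) := by ring
    _ ≤ 1 * (δ ^ m * Real.exp (p * ℓ)) := by gcongr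
    _ ≤ Real.exp (-3 * ℓ) := by
        rw [one_mul, hδ, ← Real.exp_nat_mul, ← Real.exp_add]
        refine Real.exp_le_exp.2 ?_
        nlinarith

/-- At a point where `T f` is not too small, the kernel tilted by `2 ^ d` increases `T f` by a
bounded factor only. -/
lemma sum_pow_hammingDist_le (hw : IsWeight w) {ℓ p : ℝ} (hℓ : 1 ≤ ℓ)
    (hsmall : 3 ^ Fintype.card ι * Real.exp (-ℓ) ≤ 1) {m : ℕ} (hm : p + 3 ≤ m)
    {f : (ι → α) → ℝ} (hf0 : ∀ x, 0 ≤ f x) (hf : ∀ x, f x ≤ Real.exp (p * ℓ)) {x : ι → α}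
    (hx : Real.exp (-3 * ℓ) ≤ noise w (fun _ => 1 - Real.exp (-ℓ)) f x) :
    ∑ y, 2 ^ hammingDist x y * kernel w (fun _ => 1 - Real.exp (-ℓ)) x y * f y
        ≤ (2 ^ m + 1) * noise w (fun _ => 1 - Real.exp (-ℓ)) f x := by
  have hδ0 : 0 < Real.exp (-ℓ) := Real.exp_pos _
  have hδ1 : Real.exp (-ℓ) ≤ 1 := Real.exp_le_one_iff.2 (by linarith)
  have hk : ∀ y, 0 ≤ kernel w (fun _ => 1 - Real.exp (-ℓ)) x y :=
    kernel_nonneg hw (fun _ => by linarith) (fun _ => by linarith) x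
  have hfar := sum_far_le hw hℓ hsmall hm hf0 hf x
  rw [← sum_filter_add_sum_filter_not univ (fun y => m < hammingDist x y)]
  have hnear : ∑ y with ¬ m < hammingDist x y,
      2 ^ hammingDist x y * kernel w (fun _ => 1 - Real.exp (-ℓ)) x y * f y
        ≤ 2 ^ m * noise w (fun _ => 1 - Real.exp (-ℓ)) f x := by
    rw [noise, mul_sum]
    refine le_trans (sum_le_sum fun y hy => ?_) (sum_le_sum_of_subset_of_nonneg
      (filter_subset _ _) fun y _ _ => mul_nonneg (by positivity) (mul_nonneg (hk y) (hf0 y)))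
    have hd : hammingDist x y ≤ m := not_lt.1 (mem_filter.1 hy).2
    rw [mul_assoc]
    refine mul_le_mul_of_nonneg_right ?_ (mul_nonneg (hk y) (hf0 y))
    exact pow_le_pow_right₀ (by norm_num) hd
  linarith

/-- The split at distance m of `sum_pow_hammingDist_le`, for counting changed sites; beyond m it
uses d + 1 ≤ 2^d. -/
lemma sum_hammingDist_le (hw : IsWeight w) {ℓ p : ℝ} (hℓ : 1 ≤ ℓ)
    (hsmall : 3 ^ Fintype.card ι * Real.exp (-ℓ) ≤ 1) {m : ℕ} (hm : p + 3 ≤ m)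
    {f : (ι → α) → ℝ} (hf0 : ∀ x, 0 ≤ f x) (hf : ∀ x, f x ≤ Real.exp (p * ℓ)) {x : ι → α}
    (hx : Real.exp (-3 * ℓ) ≤ noise w (fun _ => 1 - Real.exp (-ℓ)) f x) :
    ∑ y, (hammingDist x y + 1) * kernel w (fun _ => 1 - Real.exp (-ℓ)) x y * f y
        ≤ (m + 2) * noise w (fun _ => 1 - Real.exp (-ℓ)) f x := by
  have hδ0 : 0 < Real.exp (-ℓ) := Real.exp_pos _
  have hδ1 : Real.exp (-ℓ) ≤ 1 := Real.exp_le_one_iff.2 (by linarith)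
  have hk : ∀ y, 0 ≤ kernel w (fun _ => 1 - Real.exp (-ℓ)) x y :=
    kernel_nonneg hw (fun _ => by linarith) (fun _ => by linarith) x
  have hfar := sum_far_le hw hℓ hsmall hm hf0 hf x
  rw [← sum_filter_add_sum_filter_not univ (fun y => m < hammingDist x y)]
  have hnear : ∑ y with ¬ m < hammingDist x y,
      (hammingDist x y + 1 : ℝ) * kernel w (fun _ => 1 - Real.exp (-ℓ)) x y * f y
        ≤ (m + 1) * noise w (fun _ => 1 - Real.exp (-ℓ)) f x := by
    rw [noise, mul_sum]
    refine le_trans (sum_le_sum fun y hy => ?_) (sum_le_sum_of_subset_of_nonneg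
      (filter_subset _ _) fun y _ _ => mul_nonneg (by positivity) (mul_nonneg (hk y) (hf0 y)))
    have hd : hammingDist x y ≤ m := not_lt.1 (mem_filter.1 hy).2
    rw [mul_assoc]
    refine mul_le_mul_of_nonneg_right ?_ (mul_nonneg (hk y) (hf0 y))
    have : (hammingDist x y : ℝ) ≤ m := by exact_mod_cast hd
    linarith
  have hfar' : ∑ y with m < hammingDist x y,
      (hammingDist x y + 1 : ℝ) * kernel w (fun _ => 1 - Real.exp (-ℓ)) x y * f y
        ≤ Real.exp (-3 * ℓ) := by
    refine (sum_le_sum fun y hy => ?_).trans hfar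
    rw [mul_assoc, mul_assoc]
    refine mul_le_mul_of_nonneg_right ?_ (mul_nonneg (hk y) (hf0 y))
    exact_mod_cast Nat.succ_le_of_lt (Nat.lt_two_pow_self)
  linarith

end Far

/-! ### Densities and currents along the bridge -/

section Bridge

variable {ι α : Type*} [Fintype ι] [DecidableEq ι] [Fintype α] [DecidableEq α] {w : α → ℝ}

/-- Off the diagonal, q ≤ a gives 1 - a q ≤ 1 - q² ≤ 2 (1 - q). On it, the kernel increases with its
parameter and a q ≤ q. -/
lemma siteKernel_mul_le (hw : IsWeight w) {a q : ℝ} (hq0 : 0 ≤ q) (haq : q ≤ a) (ha1 : a ≤ 1)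
    (x y : α) :
    siteKernel w (a * q) x y ≤ (if x ≠ y then 2 else 1) * siteKernel w q x y := by
  have h0 := hw.nonneg y
  have h1 := hw.le_one y
  unfold siteKernel
  by_cases h : x = y
  · simp only [h, ne_eq, not_true_eq_false, if_true, if_false]
    nlinarith only [mul_nonneg (mul_nonneg hq0 (sub_nonneg.2 ha1)) (sub_nonneg.2 h1)]
  · simp only [h, ne_eq, not_false_eq_true, if_true, if_false]
    have : 0 ≤ 2 * (1 - q) - (1 - a * q) := by
      nlinarith only [mul_nonneg hq0 (sub_nonneg.2 haq), sq_nonneg (1 - q)]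
    nlinarith only [mul_nonneg this h0]

/-- At a site kept by `o` the two noises compose to the parameter a q, at the cost of a factor 2 for
a changed letter. At a resampled site the second kernel starts from the letter prescribed by `o`,
and the first sums to one. -/
lemma noise_comp_resample_le (hw : IsWeight w) {a q : ℝ} (hq0 : 0 ≤ q) (haq : q ≤ a)
    (ha1 : a ≤ 1) {f : (ι → α) → ℝ} (hf : ∀ x, 0 ≤ f x) (o : ι → Option α) (x : ι → α) :
    noise w (fun _ => a) (fun y => noise w (fun _ => q) f (resample o y)) x
      ≤ ∑ y, 2 ^ hammingDist (resample o x) y * kernel w (fun _ => q) (resample o x) y * f y := by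
  have e : noise w (fun _ => a) (fun y => noise w (fun _ => q) f (resample o y)) x
      = ∑ s, (∏ i, ∑ c, siteKernel w a (x i) c * siteKernel w q ((o i).getD c) (s i)) * f s := by
    simp only [noise, mul_sum, ← mul_assoc]
    rw [sum_comm]
    refine sum_congr rfl fun s _ => ?_
    rw [← sum_mul]
    congr 1
    rw [← sum_prod_eq (fun i c => siteKernel w a (x i) c * siteKernel w q ((o i).getD c) (s i))]
    simp only [prod_mul_distrib]
    rfl
  rw [e]
  refine sum_le_sum fun s _ => mul_le_mul_of_nonneg_right ?_ (hf s)
  rw [pow_hammingDist, kernel, ← prod_mul_distrib]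
  have hk : ∀ b c, 0 ≤ siteKernel w q b c := siteKernel_nonneg hw hq0 (haq.trans ha1)
  refine prod_le_prod (fun i _ => sum_nonneg fun c _ => mul_nonneg
    (siteKernel_nonneg hw (hq0.trans haq) ha1 _ _) (hk _ _)) fun i _ => ?_
  simp only [resample]
  rcases Option.eq_none_or_eq_some (o i) with ho | ⟨z, ho⟩
  · simp only [ho, Option.getD_none]
    rw [siteKernel_comp hw]
    exact siteKernel_mul_le hw hq0 haq ha1 _ _
  · simp only [ho, Option.getD_some]
    rw [← sum_mul, sum_siteKernel hw, one_mul]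
    refine le_mul_of_one_le_left (hk _ _) ?_
    split_ifs <;> norm_num

/-- A Cauchy–Schwarz bound for the harmonic mean of a noised function. -/
lemma noise_mul_noise_inv_le (hw : IsWeight w) {a b : ι → ℝ} (ha0 : ∀ i, 0 ≤ a i)
    (ha1 : ∀ i, a i ≤ 1) (hb0 : ∀ i, 0 ≤ b i) (hb1 : ∀ i, b i ≤ 1) {g : (ι → α) → ℝ}
    (hg : ∀ x, 0 < g x) (s : Set (ι → α)) {K : ℝ} (hK0 : 0 ≤ K) (x : ι → α)
    (hK : ∀ o : ι → Option α, resample o x ∈ s →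
      noise w a (fun y => (g (resample o y))⁻¹) x ≤ K * (g (resample o x))⁻¹) :
    noise w a (fun y => (noise w b g y)⁻¹) x * noise w b (s.indicator g) x ≤ K := by
  set S := noise w b (s.indicator g) x with hS
  have hind : ∀ y, 0 ≤ s.indicator g y := fun y => Set.indicator_nonneg (fun z _ => (hg z).le) y
  have hS0 : 0 ≤ S := noise_nonneg hw hb0 hb1 hind x
  set c : (ι → Option α) → ℝ := fun o => ∏ i, optWeight w (b i) (o i) with hc
  have hc0 : ∀ o, 0 ≤ c o := fun o =>
    prod_nonneg fun i _ => optWeight_nonneg hw (hb0 i) (hb1 i) (o i)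
  set l : (ι → Option α) → ℝ := fun o => s.indicator g (resample o x) with hl
  have hSsum : S = ∑ o, c o * l o := noise_eq_sum_resample w b _ x
  have hgb : ∀ y, 0 < noise w b g y := noise_pos hw hb0 hb1 hg
  -- Cauchy–Schwarz over `o`, with `l` evaluated from x and g from y through the same `o`. Applying
  -- the noise in y then produces exactly the terms that `hK` controls.
  have hcs : ∀ y, S ^ 2 * (noise w b g y)⁻¹
      ≤ ∑ o, c o * l o ^ 2 * (g (resample o y))⁻¹ := by
    intro y
    rw [← div_eq_mul_inv, div_le_iff₀ (hgb y), hSsum, noise_eq_sum_resample w b g y, mul_comm]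
    refine sum_sq_le_sum_mul_sum_of_sq_le_mul univ (fun o _ => mul_nonneg (hc0 o) (hg _).le)
      (fun o _ => mul_nonneg (mul_nonneg (hc0 o) (sq_nonneg _)) (inv_nonneg.2 (hg _).le))
      fun o _ => ?_
    have := (hg (resample o y)).ne'
    change _ ≤ c o * g (resample o y) * _
    apply le_of_eq
    field_simp
  have hmain : S ^ 2 * noise w a (fun y => (noise w b g y)⁻¹) x ≤ K * S := by
    calc S ^ 2 * noise w a (fun y => (noise w b g y)⁻¹) x
        = noise w a (fun y => S ^ 2 * (noise w b g y)⁻¹) x := by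
          simp only [noise, mul_sum, mul_left_comm]
      _ ≤ noise w a (fun y => ∑ o, c o * l o ^ 2 * (g (resample o y))⁻¹) x :=
          noise_mono hw ha0 ha1 hcs x
      _ = ∑ o, c o * l o ^ 2 * noise w a (fun y => (g (resample o y))⁻¹) x := by
          simp only [noise, mul_sum]
          rw [sum_comm]
          exact sum_congr rfl fun o _ => sum_congr rfl fun y _ => by ring
      _ ≤ ∑ o, K * (c o * l o) := by
          refine sum_le_sum fun o _ => ?_
          by_cases ho : resample o x ∈ s
          · have hlo : l o = g (resample o x) := by simp [hl, ho]
            have h1 := mul_le_mul_of_nonneg_left (hK o ho)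
              (mul_nonneg (hc0 o) (sq_nonneg (l o)))
            refine h1.trans (le_of_eq ?_)
            rw [hlo]
            have := (hg (resample o x)).ne'
            field_simp
          · simp [hl, ho]
      _ = K * S := by rw [hSsum, mul_sum]
  rcases hS0.eq_or_lt with h | h
  · rw [← h]; simpa using hK0
  · have : (noise w a (fun y => (noise w b g y)⁻¹) x * S) * S ≤ K * S := by
      calc _ = S ^ 2 * noise w a (fun y => (noise w b g y)⁻¹) x := by ring
        _ ≤ _ := hmain
    exact le_of_mul_le_mul_right this h

/-- The interpolating densities are bounded. -/
lemma noise_mul_noise_indicator_le (hw : IsWeight w) {ℓ p : ℝ} (hℓ : 1 ≤ ℓ)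
    (hsmall : 3 ^ Fintype.card ι * Real.exp (-ℓ) ≤ 1) {m : ℕ} (hm : p + 3 ≤ m)
    {γ : ℝ} (hγ0 : 0 ≤ γ) (hγ1 : γ ≤ 1) {f g : (ι → α) → ℝ} (hf0 : ∀ x, 0 < f x)
    (hf : ∀ x, f x ≤ Real.exp (p * ℓ))
    (hg : ∀ x, g x = noise w (fun _ => 1 - Real.exp (-ℓ)) f x ^ (-γ)) {R : ℝ} (hR : 0 ≤ R)
    (hfg : ∀ x, f x * noise w (fun _ => 1 - Real.exp (-ℓ)) g x ≤ R) {s : Set (ι → α)}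
    (hs : ∀ x ∈ s, Real.exp (-3 * ℓ) ≤ noise w (fun _ => 1 - Real.exp (-ℓ)) f x)
    {a b : ℝ} (ha : 1 - Real.exp (-ℓ) ≤ a) (ha1 : a ≤ 1) (hb0 : 0 ≤ b) (hb1 : b ≤ 1)
    (hab : a * b = 1 - Real.exp (-ℓ)) (x : ι → α) :
    noise w (fun _ => a) f x * noise w (fun _ => b) (s.indicator g) x
      ≤ R * (a ^ Fintype.card ι)⁻¹ * (2 ^ m + 1) := by
  have hδ0 : 0 < Real.exp (-ℓ) := Real.exp_pos _
  have hδ1 : Real.exp (-ℓ) < 1 := Real.exp_lt_one_iff.2 (by linarith)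
  set q := 1 - Real.exp (-ℓ) with hq
  have hq0 : 0 < q := by linarith
  have hq1 : q ≤ 1 := by linarith
  have ha0 : 0 < a := by linarith
  have hvpos : ∀ x, 0 < noise w (fun _ => q) f x :=
    noise_pos hw (fun _ => hq0.le) (fun _ => hq1) hf0
  have hgpos : ∀ x, 0 < g x := fun x => by rw [hg]; exact Real.rpow_pos_of_pos (hvpos x) _
  have hbg : ∀ x, 0 < noise w (fun _ => b) g x :=
    noise_pos hw (fun _ => hb0) (fun _ => hb1) hgpos
  have hind : ∀ y, 0 ≤ s.indicator g y :=
    fun y => Set.indicator_nonneg (fun z _ => (hgpos z).le) y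
  have han : 0 < a ^ Fintype.card ι := by positivity
  -- T_q = T_a T_b, and T_a keeps all sites with probability at least a^n; so the bound on f * T_q g
  -- also bounds f by a multiple of 1 / T_b g.
  have hf2 : ∀ y, f y ≤ R * (a ^ Fintype.card ι)⁻¹ * (noise w (fun _ => b) g y)⁻¹ := by
    intro y
    have h1 : a ^ Fintype.card ι * noise w (fun _ => b) g y ≤ noise w (fun _ => q) g y := by
      have := prod_mul_le_noise hw (q := fun _ : ι => a) (fun _ => ha0.le) (fun _ => ha1)
        (u := noise w (fun _ => b) g) (fun z => (hbg z).le) y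
      rw [noise_noise hw] at this
      have e : ((fun _ : ι => a) * fun _ => b) = fun _ => q := by ext; simp [hab]
      rw [e] at this
      simpa using this
    have h2 := (mul_le_mul_of_nonneg_left h1 (hf0 y).le).trans (hfg y)
    rw [mul_assoc, ← mul_inv, ← div_eq_mul_inv, le_div_iff₀ (mul_pos han (hbg y))]
    exact h2
  have hK : (1 : ℝ) ≤ 2 ^ m + 1 := by
    have : (0 : ℝ) < 2 ^ m := by positivity
    linarith
  have hmain := noise_mul_noise_inv_le hw (a := fun _ : ι => a) (b := fun _ => b)
    (fun _ => ha0.le) (fun _ => ha1) (fun _ => hb0) (fun _ => hb1) hgpos s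
    (K := 2 ^ m + 1) (by linarith) x (by
      intro o ho
      set z := resample o x with hz
      -- 1 / g = (T f)^γ is a concave power of T f, so Jensen moves T_a inside it; the tilted kernel
      -- is then controlled at the points of `s`.
      have e : ∀ y, (g y)⁻¹ = noise w (fun _ => q) f y ^ γ := fun y => by
        rw [hg, Real.rpow_neg (hvpos y).le, inv_inv]
      simp only [e]
      refine (noise_rpow_le hw (fun _ => ha0.le) (fun _ => ha1) (fun y => (hvpos _).le)
        hγ0 hγ1 x).trans ?_
      have h1 := (noise_comp_resample_le hw hq0.le ha ha1 (fun y => (hf0 y).le) o x).trans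
        (sum_pow_hammingDist_le hw hℓ hsmall hm (fun y => (hf0 y).le) hf (hs _ ho))
      refine (Real.rpow_le_rpow (noise_nonneg hw (fun _ => ha0.le) (fun _ => ha1)
        (fun y => (hvpos _).le) x) h1 hγ0).trans ?_
      rw [Real.mul_rpow (by linarith) (hvpos _).le]
      refine mul_le_mul_of_nonneg_right ?_ (Real.rpow_nonneg (hvpos _).le _)
      exact (Real.rpow_le_rpow_of_exponent_le hK hγ1).trans_eq (Real.rpow_one _))
  have h3 := noise_mono hw (q := fun _ : ι => a) (fun _ => ha0.le) (fun _ => ha1) hf2 x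
  have e3 : noise w (fun _ => a)
      (fun y => R * (a ^ Fintype.card ι)⁻¹ * (noise w (fun _ => b) g y)⁻¹) x
      = R * (a ^ Fintype.card ι)⁻¹ * noise w (fun _ => a)
        (fun y => (noise w (fun _ => b) g y)⁻¹) x := by
    simp only [noise, mul_sum, mul_left_comm]
  rw [e3] at h3
  calc _ ≤ (R * (a ^ Fintype.card ι)⁻¹ * noise w (fun _ => a)
        (fun y => (noise w (fun _ => b) g y)⁻¹) x) * noise w (fun _ => b) (s.indicator g) x :=
        mul_le_mul_of_nonneg_right h3 (noise_nonneg hw (fun _ => hb0) (fun _ => hb1) hind x)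
    _ = R * (a ^ Fintype.card ι)⁻¹ * (noise w (fun _ => a)
        (fun y => (noise w (fun _ => b) g y)⁻¹) x * noise w (fun _ => b) (s.indicator g) x) := by
        ring
    _ ≤ _ := mul_le_mul_of_nonneg_left hmain (by positivity)

/-- The number of resampled sites along the bridge. -/
lemma sum_mean_mul_avg_noise_le (hw : IsWeight w) {ℓ p : ℝ} (hℓ : 1 ≤ ℓ)
    (hsmall : 3 ^ Fintype.card ι * Real.exp (-ℓ) ≤ 1) {m : ℕ} (hm : p + 3 ≤ m)
    {f g : (ι → α) → ℝ} (hf0 : ∀ x, 0 ≤ f x) (hf : ∀ x, f x ≤ Real.exp (p * ℓ))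
    (hg0 : ∀ x, 0 ≤ g x)
    (hg : ∀ x, g x ≠ 0 → Real.exp (-3 * ℓ) ≤ noise w (fun _ => 1 - Real.exp (-ℓ)) f x)
    (hfg : mean w (g * noise w (fun _ => 1 - Real.exp (-ℓ)) f) ≤ 1) :
    Real.exp (-ℓ) * ∑ i, mean w (f * avg w i (noise w (fun _ => 1 - Real.exp (-ℓ)) g))
      ≤ m + 2 := by
  have hδ0 : 0 < Real.exp (-ℓ) := Real.exp_pos _
  have hδ1 : Real.exp (-ℓ) < 1 := Real.exp_lt_one_iff.2 (by linarith)
  set δ := Real.exp (-ℓ) with hδ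
  have hcard : (Fintype.card ι : ℝ) * δ ≤ 1 - δ := by
    have h1 : ((Fintype.card ι + 1 : ℕ) : ℝ) ≤ (3 : ℝ) ^ Fintype.card ι := by
      exact_mod_cast Nat.succ_le_of_lt (Nat.lt_pow_self (by norm_num : 1 < 3))
    push_cast at h1
    nlinarith
  -- At the other end T f is bounded below wherever g does not vanish.
  have hsym : ∀ i, mean w (f * avg w i (noise w (fun _ => 1 - δ) g))
      = mean w (g * avg w i (noise w (fun _ => 1 - δ) f)) := by
    intro i
    rw [avg_noise hw, avg_noise hw, mean_mul_noise, mul_comm]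
  simp only [hsym]
  have hpt : ∀ x, δ * ∑ i, avg w i (noise w (fun _ => 1 - δ) f) x
      ≤ ∑ y, (hammingDist x y + 1) * kernel w (fun _ => 1 - δ) x y * f y := by
    intro x
    simp only [avg_noise hw, noise, mul_sum]
    rw [sum_comm]
    refine sum_le_sum fun y _ => ?_
    -- At a changed letter δ w is the kernel itself. At an unchanged one it is at most δ / (1 - δ)
    -- times the kernel, and by `hcard` these errors add up to at most 1.
    have hki : ∀ i, δ * kernel w (update (fun _ => 1 - δ) i 0) x y
        ≤ ((if x i ≠ y i then 1 else 0) + δ / (1 - δ)) * kernel w (fun _ => 1 - δ) x y := by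
      intro i
      rw [kernel_update_param, siteKernel_zero, kernel_eq_mul_erase w _ i, ← mul_assoc,
        ← mul_assoc]
      refine mul_le_mul_of_nonneg_right ?_ (prod_nonneg fun j _ =>
        siteKernel_nonneg hw (by linarith) (by linarith) _ _)
      have h0 := hw.nonneg (y i)
      have h1 := hw.le_one (y i)
      have hq : 0 < 1 - δ := by linarith
      unfold siteKernel
      by_cases h : x i = y i
      · simp only [h, ne_eq, not_true_eq_false, if_true, if_false, zero_add, mul_one]
        rw [div_mul_eq_mul_div, le_div_iff₀ hq, mul_assoc]
        refine mul_le_mul_of_nonneg_left ?_ hδ0.le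
        nlinarith
      · simp only [h, ne_eq, not_false_eq_true, if_true, if_false]
        have : 0 ≤ δ / (1 - δ) * (δ * w (y i)) := by positivity
        nlinarith
    have hsum := sum_le_sum fun i (_ : i ∈ univ) => hki i
    rw [← sum_mul, sum_add_distrib] at hsum
    have hd : ∑ i, (if x i ≠ y i then (1 : ℝ) else 0) = hammingDist x y := by
      rw [sum_boole]; rfl
    rw [hd, sum_const, card_univ, nsmul_eq_mul] at hsum
    have hk0 := kernel_nonneg hw (q := fun _ : ι => 1 - δ) (fun _ => by linarith)
      (fun _ => by linarith) x y
    have h5 : (Fintype.card ι : ℝ) * (δ / (1 - δ)) ≤ 1 := by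
      rw [mul_div_assoc', div_le_one (by linarith)]; exact hcard
    calc ∑ i, δ * (kernel w (update (fun _ => 1 - δ) i 0) x y * f y)
        = (∑ i, δ * kernel w (update (fun _ => 1 - δ) i 0) x y) * f y := by
          rw [sum_mul]; exact sum_congr rfl fun i _ => by ring
      _ ≤ (hammingDist x y + 1) * kernel w (fun _ => 1 - δ) x y * f y := by
          refine mul_le_mul_of_nonneg_right (hsum.trans ?_) (hf0 y)
          exact mul_le_mul_of_nonneg_right (by linarith) hk0
  have hpt2 : ∀ x, g x * (δ * ∑ i, avg w i (noise w (fun _ => 1 - δ) f) x)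
      ≤ (m + 2) * (g x * noise w (fun _ => 1 - δ) f x) := by
    intro x
    by_cases hx : g x = 0
    · simp [hx]
    · have := (hpt x).trans (sum_hammingDist_le hw hℓ hsmall hm hf0 hf (hg x hx))
      calc _ ≤ g x * ((m + 2) * noise w (fun _ => 1 - δ) f x) :=
            mul_le_mul_of_nonneg_left this (hg0 x)
        _ = _ := by ring
  have e : δ * ∑ i, mean w (g * avg w i (noise w (fun _ => 1 - δ) f))
      = mean w (fun x => g x * (δ * ∑ i, avg w i (noise w (fun _ => 1 - δ) f) x)) := by
    rw [← mean_sum, ← mean_smul]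
    congr 1
    ext x
    simp only [Pi.smul_apply, Pi.mul_apply, smul_eq_mul, mul_sum]
    exact sum_congr rfl fun i _ => by ring
  rw [e]
  refine (mean_mono hw hpt2).trans ?_
  have := mean_smul w ((m : ℝ) + 2) (g * noise w (fun _ => 1 - δ) f)
  calc _ = ((m : ℝ) + 2) * mean w (g * noise w (fun _ => 1 - δ) f) := this
    _ ≤ ((m : ℝ) + 2) * 1 := by gcongr
    _ = _ := mul_one _

/-- Young's inequality for |D| √c; the hypothesis then replaces c e by g in the quadratic term. -/
lemma abs_mul_le_of_mul_le {D e g c κ : ℝ} (he : 0 ≤ e) (hc : 0 < c) (hκ : 0 < κ)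
    (h : c * e ≤ g) : |D| * e ≤ (√c)⁻¹ * (κ / 2 * (D ^ 2 * g) + (2 * κ)⁻¹ * e) := by
  have hs : 0 < √c := Real.sqrt_pos.2 hc
  have hcc : √c * √c = c := Real.mul_self_sqrt hc.le
  rw [inv_mul_eq_div, le_div_iff₀ hs]
  have h1 : D ^ 2 * (c * e) ≤ D ^ 2 * g := mul_le_mul_of_nonneg_left h (sq_nonneg D)
  have h2 : |D| * √c ≤ κ / 2 * (D ^ 2 * c) + (2 * κ)⁻¹ := by
    have h3 := sq_nonneg (κ * (|D| * √c) - 1)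
    have h4 : (|D| * √c) ^ 2 = D ^ 2 * c := by rw [mul_pow, sq_abs, sq (√c), hcc]
    rw [← h4]
    have : κ * (|D| * √c) ≤ κ * (κ / 2 * (|D| * √c) ^ 2 + (2 * κ)⁻¹) := by
      rw [mul_add, mul_inv, mul_left_comm κ 2⁻¹, mul_inv_cancel₀ hκ.ne']
      nlinarith
    exact le_of_mul_le_mul_left this hκ
  calc |D| * e * √c = (|D| * √c) * e := by ring
    _ ≤ (κ / 2 * (D ^ 2 * c) + (2 * κ)⁻¹) * e := mul_le_mul_of_nonneg_right h2 he
    _ = κ / 2 * (D ^ 2 * (c * e)) + (2 * κ)⁻¹ * e := by ring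
    _ ≤ _ := by gcongr

/-- The infinitesimal transport estimate along the bridge. -/
lemma mean_mul_avg_sub_le (hw : IsWeight w) {f g G k : (ι → α) → ℝ} (i : ι)
    (hf : ∀ x, 0 ≤ f x) (hg : ∀ x, 0 ≤ g x) (hk : ∀ x z, k (update x i z) = k x) {c c' κ : ℝ}
    (hc : 0 < c) (hc' : 0 < c') (hκ : 0 < κ) (hfc : ∀ x, c * avg w i f x ≤ f x)
    (hgc : ∀ x, c' * avg w i g x ≤ g x) :
    mean w (G * (f * avg w i g - g * avg w i f))
      ≤ ((√c)⁻¹ + (√c')⁻¹) * (κ / 2 * mean w (fun x => (G x - k x) ^ 2 * (f x * g x))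
        + (2 * κ)⁻¹ * mean w (f * avg w i g)) := by
  have hsym : mean w (g * avg w i f) = mean w (f * avg w i g) := by
    rw [mean_mul_avg hw, mul_comm]
  -- E_i is self-adjoint and fixes k, so the antisymmetric current does not move the mean of k;
  -- hence G may be replaced by G - k.
  have hk0 : mean w (k * (f * avg w i g - g * avg w i f)) = 0 := by
    have e1 : mean w (k * (f * avg w i g)) = mean w (k * (g * avg w i f)) := by
      have := mean_mul_avg hw i (k * f) g
      rw [avg_mul_of_indep w i hk] at this
      rw [← mul_assoc, this, mul_assoc, mul_comm (avg w i f) g]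
    rw [mul_sub, mean_sub, e1, sub_self]
  have e2 : mean w (G * (f * avg w i g - g * avg w i f))
      = mean w ((G - k) * (f * avg w i g - g * avg w i f)) := by
    rw [sub_mul, mean_sub, hk0, sub_zero]
  rw [e2]
  have hpt : ∀ x, ((G - k) * (f * avg w i g - g * avg w i f)) x
      ≤ ((√c)⁻¹ + (√c')⁻¹) * (κ / 2) * ((G x - k x) ^ 2 * (f x * g x))
        + ((√c')⁻¹ * (2 * κ)⁻¹ * (f * avg w i g) x + (√c)⁻¹ * (2 * κ)⁻¹ * (g * avg w i f) x) := by
    intro x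
    have h1 := mul_le_mul_of_nonneg_left (abs_mul_le_of_mul_le (D := G x - k x)
      (avg_nonneg hw i hg x) hc' hκ (hgc x)) (hf x)
    have h2 := mul_le_mul_of_nonneg_left (abs_mul_le_of_mul_le (D := G x - k x)
      (avg_nonneg hw i hf x) hc hκ (hfc x)) (hg x)
    have h3 : (G x - k x) * (f x * avg w i g x - g x * avg w i f x)
        ≤ f x * (|G x - k x| * avg w i g x) + g x * (|G x - k x| * avg w i f x) := by
      have ha := le_abs_self (G x - k x)
      have hb := neg_abs_le (G x - k x)
      have n1 := mul_nonneg (hf x) (avg_nonneg hw i hg x)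
      have n2 := mul_nonneg (hg x) (avg_nonneg hw i hf x)
      nlinarith
    simp only [Pi.mul_apply, Pi.sub_apply]
    refine h3.trans ((add_le_add h1 h2).trans (le_of_eq ?_))
    ring
  refine (mean_mono hw hpt).trans (le_of_eq ?_)
  have e3 := mean_add w (fun x => ((√c)⁻¹ + (√c')⁻¹) * (κ / 2) * ((G x - k x) ^ 2 * (f x * g x)))
    (fun x => (√c')⁻¹ * (2 * κ)⁻¹ * (f * avg w i g) x + (√c)⁻¹ * (2 * κ)⁻¹ * (g * avg w i f) x)
  have e4 := mean_add w (((√c')⁻¹ * (2 * κ)⁻¹) • (f * avg w i g))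
    (((√c)⁻¹ * (2 * κ)⁻¹) • (g * avg w i f))
  have e5 := mean_smul w (((√c)⁻¹ + (√c')⁻¹) * (κ / 2)) (fun x => (G x - k x) ^ 2 * (f x * g x))
  rw [mean_smul, mean_smul, hsym] at e4
  calc _ = _ := e3
    _ = _ := congrArg₂ (· + ·) e5 e4
    _ = _ := by ring

end Bridge

/-! ### Cost of the bridge -/

section Transport

variable {ι α : Type*} [Fintype ι] [DecidableEq ι] [Fintype α] [DecidableEq α] {w : α → ℝ}

lemma hasDerivAt_mean (w : α → ℝ) {u : ℝ → (ι → α) → ℝ} {u' : (ι → α) → ℝ} {q : ℝ}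
    (h : ∀ x, HasDerivAt (fun s => u s x) (u' x) q) :
    HasDerivAt (fun s => mean w (u s)) (mean w u') q :=
  HasDerivAt.fun_sum fun x _ => (h x).const_mul _

lemma continuousOn_mean (w : α → ℝ) {u : ℝ → (ι → α) → ℝ} {s : Set ℝ}
    (h : ∀ x, ContinuousOn (fun q => u q x) s) : ContinuousOn (fun q => mean w (u q)) s := by
  unfold mean
  exact continuousOn_finsetSum _ fun x _ => continuousOn_const.mul (h x)

/-- Transport of `f * T g` to `T f * g` along the bridge `T_a f * T_{Q / a} g`. -/
lemma mean_bridge_sub_le (hw : IsWeight w) {f g G : (ι → α) → ℝ} {k : ι → (ι → α) → ℝ}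
    (hf : ∀ x, 0 ≤ f x) (hg : ∀ x, 0 ≤ g x) (hk : ∀ i x z, k i (update x i z) = k i x)
    {δ v N μ : ℝ} (hδ0 : 0 < δ) (hδ1 : δ < 1) (hμ : 0 < μ)
    (hN : δ * ∑ i, mean w (f * avg w i (noise w (fun _ => 1 - δ) g)) ≤ N)
    (hv : ∀ a, 1 - δ < a → a < 1 → mean w (fun x => (∑ i, (G x - k i x) ^ 2)
      * (noise w (fun _ => a) f x * noise w (fun _ => (1 - δ) / a) g x)) ≤ v) :
    mean w (G * (f * noise w (fun _ => 1 - δ) g)) - mean w (G * (noise w (fun _ => 1 - δ) f * g))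
      ≤ (1 - δ)⁻¹ * (2 * μ * v + 2 * N / μ) := by
  set Q := 1 - δ with hQ
  have hQ0 : 0 < Q := by linarith
  set κ := μ / √δ with hκ
  have hsδ : 0 < √δ := Real.sqrt_pos.2 hδ0
  have hκ0 : 0 < κ := div_pos hμ hsδ
  set n := ∑ i, mean w (f * avg w i (noise w (fun _ => Q) g)) with hn
  set B := κ / 2 * v + (2 * κ)⁻¹ * n with hB
  set M : ℝ → ℝ := fun a => mean w (fun x => G x *
    (noise w (fun _ => a) f x * noise w (fun _ => Q / a) g x)) with hM
  -- A primitive of the bound on M'. That bound has inverse square root singularities at both ends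
  -- and total integral of order √δ, which the scaling κ = μ / √δ compensates.
  set S : ℝ → ℝ := fun a => Q⁻¹ * B * (2 * √(a - Q) - 2 * √(1 - a)) with hS
  have hcont : ContinuousOn (fun a => M a - S a) (Set.Icc Q 1) := by
    refine ContinuousOn.sub ?_ (by fun_prop)
    refine continuousOn_mean w fun x => continuousOn_const.mul
      ((continuous_noise w f x).continuousOn.mul ?_)
    refine (continuous_noise w g x).comp_continuousOn (continuousOn_const.div continuousOn_id ?_)
    intro a ha
    exact (hQ0.trans_le ha.1).ne'
  have hder : ∀ a ∈ Set.Ioo Q 1, ∃ d ≤ 0, HasDerivAt (fun a => M a - S a) d a := by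
    intro a ha
    obtain ⟨haQ, ha1⟩ := ha
    have ha0 : 0 < a := hQ0.trans haQ
    have hb0 : 0 < Q / a := div_pos hQ0 ha0
    have hb1 : Q / a < 1 := (div_lt_one ha0).2 haQ
    set fa := noise w (fun _ => a) f with hfa
    set gb := noise w (fun _ => Q / a) g with hgb
    have hfa0 : ∀ x, 0 ≤ fa x := noise_nonneg hw (fun _ => ha0.le) (fun _ => ha1.le) hf
    have hgb0 : ∀ x, 0 ≤ gb x := noise_nonneg hw (fun _ => hb0.le) (fun _ => hb1.le) hg
    have hMd : HasDerivAt M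
        (a⁻¹ * ∑ i, mean w (G * (fa * avg w i gb - gb * avg w i fa))) a := by
      have h1 : ∀ x, HasDerivAt (fun s => G x *
          (noise w (fun _ => s) f x * noise w (fun _ => Q / s) g x))
          (a⁻¹ * ∑ i, (G * (fa * avg w i gb - gb * avg w i fa)) x) a := by
        intro x
        have d1 := hasDerivAt_noise hw f x ha0.ne'
        have d2 := hasDerivAt_noise hw g x hb0.ne'
        have d3 : HasDerivAt (fun s : ℝ => Q / s) (-(Q / a ^ 2)) a := by
          have := (hasDerivAt_inv ha0.ne').const_mul Q
          refine this.congr_deriv ?_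
          field_simp
        have d4 := d2.comp a d3
        refine ((d1.mul d4).const_mul (G x)).congr_deriv ?_
        simp only [Function.comp_apply]
        rw [← hfa, ← hgb]
        simp only [Pi.mul_apply, Pi.sub_apply]
        have e1 : ∑ i, (gb x - avg w i gb x) = Fintype.card ι * gb x - ∑ i, avg w i gb x := by
          rw [sum_sub_distrib]; simp
        have e2 : ∑ i, (fa x - avg w i fa x) = Fintype.card ι * fa x - ∑ i, avg w i fa x := by
          rw [sum_sub_distrib]; simp
        have e3 : ∑ i, G x * (fa x * avg w i gb x - gb x * avg w i fa x)
            = G x * (fa x * ∑ i, avg w i gb x - gb x * ∑ i, avg w i fa x) := by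
          rw [← mul_sum, sum_sub_distrib, mul_sum, mul_sum]
        rw [e1, e2, e3]
        field_simp
        ring
      refine (hasDerivAt_mean w h1).congr_deriv ?_
      rw [← mean_sum, ← mean_smul]
      rfl
    have hSd : HasDerivAt S (Q⁻¹ * B * ((√(a - Q))⁻¹ + (√(1 - a))⁻¹)) a := by
      have d1 := ((hasDerivAt_id a).sub_const Q).sqrt (by simp; linarith)
      have d2 := ((hasDerivAt_id a).const_sub 1).sqrt (by simp; linarith)
      refine (((d1.const_mul 2).sub (d2.const_mul 2)).const_mul (Q⁻¹ * B)).congr_deriv ?_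
      simp only [id]
      have : 0 < √(a - Q) := Real.sqrt_pos.2 (by linarith)
      have : 0 < √(1 - a) := Real.sqrt_pos.2 (by linarith)
      field_simp
      ring
    refine ⟨_, ?_, hMd.sub hSd⟩
    -- The rate of resampling at `i` does not depend on a: T_a is self-adjoint, commutes with E_i,
    -- and composes with T_(Q/a) to T_Q.
    have hni : ∀ i, mean w (fa * avg w i gb) = mean w (f * avg w i (noise w (fun _ => Q) g)) := by
      intro i
      rw [hfa, hgb, ← mean_mul_noise, ← noise_avg hw, noise_noise hw, ← noise_avg hw]
      congr 3
      ext; simp; field_simp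
    have hb : ∀ i, mean w (G * (fa * avg w i gb - gb * avg w i fa))
        ≤ ((√(1 - a))⁻¹ + (√(a - Q))⁻¹) *
          (κ / 2 * mean w (fun x => (G x - k i x) ^ 2 * (fa x * gb x))
          + (2 * κ)⁻¹ * mean w (fa * avg w i gb)) := by
      intro i
      refine mean_mul_avg_sub_le hw i hfa0 hgb0 (hk i) (by linarith) (by linarith) hκ0 ?_ ?_
      · intro x
        simpa [← hfa] using
          mul_avg_noise_le hw (q := fun _ : ι => a) (fun _ => ha0.le) (fun _ => ha1.le) i hf x
      · intro x
        have h1 := mul_avg_noise_le hw (q := fun _ : ι => Q / a) (fun _ => hb0.le)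
          (fun _ => hb1.le) i hg x
        rw [← hgb] at h1
        refine le_trans (mul_le_mul_of_nonneg_right ?_ (avg_nonneg hw i hgb0 x)) h1
        have : 1 - Q / a = (a - Q) / a := by field_simp
        rw [this, le_div_iff₀ ha0]
        nlinarith
    have hsum : ∑ i, mean w (G * (fa * avg w i gb - gb * avg w i fa))
        ≤ ((√(1 - a))⁻¹ + (√(a - Q))⁻¹) * B := by
      refine (sum_le_sum fun i _ => hb i).trans ?_
      rw [← mul_sum, sum_add_distrib, ← mul_sum, ← mul_sum, sum_congr rfl fun i _ => hni i,
        ← hn, hB]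
      refine mul_le_mul_of_nonneg_left ?_ (by positivity)
      refine add_le_add_left (mul_le_mul_of_nonneg_left ?_ (by positivity)) _
      refine le_trans (le_of_eq ?_) (hv a haQ ha1)
      rw [← mean_sum]
      congr 1
      ext x
      rw [sum_mul]
    have hB0 : 0 ≤ B := by
      have hn0 : 0 ≤ n := sum_nonneg fun i _ => mean_nonneg hw fun x => mul_nonneg (hf x)
        (avg_nonneg hw i (noise_nonneg hw (fun _ => hQ0.le) (fun _ => by linarith) hg) x)
      have hv0 : 0 ≤ v := le_trans (mean_nonneg hw fun x => mul_nonneg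
        (sum_nonneg fun i _ => sq_nonneg _) (mul_nonneg (hfa0 x) (hgb0 x))) (hv a haQ ha1)
      positivity
    have haQ' : a⁻¹ ≤ Q⁻¹ := inv_anti₀ hQ0 haQ.le
    have hpos : 0 ≤ ((√(1 - a))⁻¹ + (√(a - Q))⁻¹) * B := by positivity
    have h5 : a⁻¹ * ∑ i, mean w (G * (fa * avg w i gb - gb * avg w i fa))
        ≤ Q⁻¹ * (((√(1 - a))⁻¹ + (√(a - Q))⁻¹) * B) :=
      (mul_le_mul_of_nonneg_left hsum (inv_pos.2 ha0).le).trans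
        (mul_le_mul_of_nonneg_right haQ' hpos)
    linarith
  have hanti : AntitoneOn (fun a => M a - S a) (Set.Icc Q 1) := by
    refine antitoneOn_of_deriv_nonpos (convex_Icc _ _) hcont ?_ ?_
    · rw [interior_Icc]
      intro a ha
      obtain ⟨d, -, hd⟩ := hder a ha
      exact hd.differentiableAt.differentiableWithinAt
    · rw [interior_Icc]
      intro a ha
      obtain ⟨d, hd0, hd⟩ := hder a ha
      rw [hd.deriv]; exact hd0
  have hfin := hanti (Set.left_mem_Icc.2 (by linarith)) (Set.right_mem_Icc.2 (by linarith))
    (by linarith : Q ≤ 1)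
  have eM1 : M 1 = mean w (G * (f * noise w (fun _ => Q) g)) := by
    simp only [hM, div_one]
    congr 1; ext x
    have : noise w (fun _ : ι => (1 : ℝ)) f = f := noise_one w f
    simp [this]
  have eMQ : M Q = mean w (G * (noise w (fun _ => Q) f * g)) := by
    simp only [hM, div_self hQ0.ne']
    congr 1; ext x
    have : noise w (fun _ : ι => (1 : ℝ)) g = g := noise_one w g
    simp [this]
  have eS : S 1 - S Q = Q⁻¹ * B * (4 * √δ) := by
    have e : (1 : ℝ) - Q = δ := by rw [hQ]; ring
    simp only [hS, sub_self, Real.sqrt_zero, e]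
    ring
  simp only at hfin
  have hfin' : M 1 - M Q ≤ Q⁻¹ * B * (4 * √δ) := by linarith
  rw [eM1, eMQ] at hfin'
  refine hfin'.trans ?_
  rw [mul_assoc]
  refine mul_le_mul_of_nonneg_left ?_ (inv_pos.2 hQ0).le
  have e6 : B * (4 * √δ) = 2 * μ * v + 2 * (δ * n) / μ := by
    rw [hB, hκ]
    have : √δ * √δ = δ := Real.mul_self_sqrt hδ0.le
    field_simp
    rw [sq (√δ), this]
    ring
  rw [e6]
  gcongr

end Transport

/-! ### Entropy production, the noise flow to the uniform density, Efron–Stein -/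

section Entropy

variable {ι α : Type*} [Fintype ι] [DecidableEq ι] [Fintype α] [DecidableEq α] {w : α → ℝ}

/-- The entropy production at the site `i`. -/
noncomputable def entropyProd (w : α → ℝ) (i : ι) (h : (ι → α) → ℝ) : ℝ :=
  mean w (fun x => (h x - avg w i h x) * Real.log (h x))

/-- Tangent plane at (A, B) of the convex, 1-homogeneous function a log(a / b). -/
lemma mul_log_tangent {a b A B : ℝ} (ha : 0 < a) (hb : 0 < b) (hA : 0 < A) (hB : 0 < B) :
    a * (Real.log A - Real.log B) + a - A / B * b ≤ a * (Real.log a - Real.log b) := by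
  have h := Real.log_le_sub_one_of_pos (x := A * b / (B * a)) (by positivity)
  rw [Real.log_div (by positivity) (by positivity), Real.log_mul hA.ne' hb.ne',
    Real.log_mul hB.ne' ha.ne'] at h
  have h2 := mul_le_mul_of_nonneg_left h ha.le
  have e : a * (A * b / (B * a) - 1) = A / B * b - a := by field_simp
  rw [e] at h2
  linarith

lemma log_sum_inequality {κ : Type*} (s : Finset κ) {k a b : κ → ℝ} (hk : ∀ y ∈ s, 0 ≤ k y)
    (ha : ∀ y ∈ s, 0 < a y) (hb : ∀ y ∈ s, 0 < b y) (hA : 0 < ∑ y ∈ s, k y * a y)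
    (hB : 0 < ∑ y ∈ s, k y * b y) :
    (∑ y ∈ s, k y * a y) * (Real.log (∑ y ∈ s, k y * a y) - Real.log (∑ y ∈ s, k y * b y))
      ≤ ∑ y ∈ s, k y * (a y * (Real.log (a y) - Real.log (b y))) := by
  set A := ∑ y ∈ s, k y * a y with hAdef
  set B := ∑ y ∈ s, k y * b y with hBdef
  have h := sum_le_sum fun y hy => mul_le_mul_of_nonneg_left
    (mul_log_tangent (ha y hy) (hb y hy) hA hB) (hk y hy)
  refine le_trans (le_of_eq ?_) h
  have e : ∀ y, k y * (a y * (Real.log A - Real.log B) + a y - A / B * b y)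
      = (k y * a y) * (Real.log A - Real.log B) + k y * a y - A / B * (k y * b y) := by
    intro y; ring
  simp only [e]
  rw [sum_sub_distrib, sum_add_distrib, ← sum_mul, ← mul_sum, ← hAdef, ← hBdef]
  field_simp
  ring

/-- E_i preserves means. In this form the entropy production is a mean of a jointly convex function
of a pair of values of h, ready for `log_sum_inequality`. -/
lemma entropyProd_eq (hw : IsWeight w) (i : ι) (h : (ι → α) → ℝ) :
    entropyProd w i h = mean w (fun x => ∑ z, w z *
      (h (update x i z) * (Real.log (h (update x i z)) - Real.log (h x)))) := by
  have e1 : (fun x => ∑ z, w z *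
      (h (update x i z) * (Real.log (h (update x i z)) - Real.log (h x))))
      = avg w i (fun x => h x * Real.log (h x)) - avg w i h * fun x => Real.log (h x) := by
    ext x
    simp only [avg, Pi.sub_apply, Pi.mul_apply, sum_mul, ← sum_sub_distrib]
    exact sum_congr rfl fun z _ => by ring
  rw [e1, mean_sub, mean_avg hw, ← mean_sub, entropyProd]
  congr 1
  ext x
  simp only [Pi.sub_apply, Pi.mul_apply]
  ring

/-- The noise does not touch `i`, so it averages both entries of the pair with one kernel; joint
convexity does the rest. -/
lemma entropyProd_noise_le_of_eq_one (hw : IsWeight w) {q : ι → ℝ} (h0 : ∀ i, 0 ≤ q i)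
    (h1 : ∀ i, q i ≤ 1) {i : ι} (hi : q i = 1) {h : (ι → α) → ℝ} (hh : ∀ x, 0 < h x) :
    entropyProd w i (noise w q h) ≤ entropyProd w i h := by
  rw [entropyProd_eq hw, entropyProd_eq hw]
  rw [← mean_noise hw q (fun x => ∑ z, w z *
      (h (update x i z) * (Real.log (h (update x i z)) - Real.log (h x))))]
  refine mean_mono hw fun x => ?_
  have e : noise w q (fun x => ∑ z, w z *
      (h (update x i z) * (Real.log (h (update x i z)) - Real.log (h x)))) x
      = ∑ z, w z * noise w q (fun x =>
        h (update x i z) * (Real.log (h (update x i z)) - Real.log (h x))) x := by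
    simp only [noise, mul_sum]
    rw [sum_comm]
    exact sum_congr rfl fun z _ => sum_congr rfl fun y _ => by ring
  rw [e]
  refine sum_le_sum fun z _ => mul_le_mul_of_nonneg_left ?_ (hw.nonneg z)
  rw [noise_update_of_eq_one w hi]
  exact log_sum_inequality univ (k := kernel w q x) (a := fun y => h (update y i z)) (b := h)
    (fun y _ => kernel_nonneg hw h0 h1 x y) (fun y _ => hh _) (fun y _ => hh y)
    (noise_pos hw h0 h1 (fun y => hh _) x) (noise_pos hw h0 h1 hh x)

/-- With h' noised at the other sites only, T_c h = c h' + (1 - c) E_i h'. The second part is equal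
at both points of a pair, so only the first contributes, with weight c. This makes the entropy
convex along the noise flow. -/
lemma entropyProd_noise_le (hw : IsWeight w) {c : ℝ} (hc0 : 0 ≤ c) (hc1 : c ≤ 1) (i : ι)
    {h : (ι → α) → ℝ} (hh : ∀ x, 0 < h x) :
    entropyProd w i (noise w (fun _ => c) h) ≤ c * entropyProd w i h := by
  set q : ι → ℝ := update (fun _ => c) i 1 with hq
  have hq0 : ∀ j, 0 ≤ q j := fun j => by
    by_cases hj : j = i
    · subst hj; simp [hq]
    · simp [hq, hj, hc0]
  have hq1 : ∀ j, q j ≤ 1 := fun j => by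
    by_cases hj : j = i
    · subst hj; simp [hq]
    · simp [hq, hj, hc1]
  refine le_trans ?_ (mul_le_mul_of_nonneg_left
    (entropyProd_noise_le_of_eq_one hw hq0 hq1 (i := i) (by simp [hq]) hh) hc0)
  set h' := noise w q h with hh'
  have hpos : ∀ x, 0 < h' x := noise_pos hw hq0 hq1 hh
  have e : ∀ x, noise w (fun _ => c) h x = c * h' x + (1 - c) * avg w i h' x := by
    intro x
    rw [noise_split w _ i, hh', avg_noise hw]
    simp [hq]
  rw [entropyProd_eq hw, entropyProd_eq hw, ← mean_smul]
  refine mean_mono hw fun x => ?_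
  simp only [Pi.smul_apply, smul_eq_mul, mul_sum]
  refine sum_le_sum fun z _ => ?_
  rw [mul_left_comm c]
  refine mul_le_mul_of_nonneg_left ?_ (hw.nonneg z)
  rw [e, e, avg_update]
  have ha := hpos (update x i z)
  have hb := hpos x
  have hm := avg_pos hw i hpos x
  have hc1' : 0 ≤ 1 - c := by linarith
  have key := log_sum_inequality (univ : Finset Bool) (k := fun t => cond t c (1 - c))
    (a := fun t => cond t (h' (update x i z)) (avg w i h' x))
    (b := fun t => cond t (h' x) (avg w i h' x))
    (by simp [hc0, hc1]) (by simp [ha, hm]) (by simp [hb, hm]) (by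
      simp only [Fintype.univ_bool, mem_singleton, Bool.true_eq_false, not_false_eq_true,
        sum_insert, sum_singleton, cond_true, cond_false]
      rcases hc0.eq_or_lt with h | h
      · rw [← h]; simpa using hm
      · have := mul_nonneg hc1' hm.le
        have := mul_pos h ha
        linarith) (by
      simp only [Fintype.univ_bool, mem_singleton, Bool.true_eq_false, not_false_eq_true,
        sum_insert, sum_singleton, cond_true, cond_false]
      rcases hc0.eq_or_lt with h | h
      · rw [← h]; simpa using hm
      · have := mul_nonneg hc1' hm.le
        have := mul_pos h hb
        linarith)
  simpa using key

/-- Where the one-sided regularity enters. If m ≤ h, use log x ≤ x - 1. Otherwise y = log(m / h)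
lies in [0, 1], and convexity of exp gives m / h ≤ 1 + 2 y. -/
lemma sq_sub_le_mul_log {h m : ℝ} (hh : 0 < h) (hm : 0 < m) (hmh : m ≤ Real.exp 1 * h) :
    (h - m) ^ 2 ≤ 2 * h * ((h - m) * (Real.log h - Real.log m)) := by
  rcases le_total m h with hle | hle
  · have h1 := Real.log_le_sub_one_of_pos (x := m / h) (by positivity)
    rw [Real.log_div hm.ne' hh.ne'] at h1
    have h2 : h - m ≤ h * (Real.log h - Real.log m) := by
      have := mul_le_mul_of_nonneg_left h1 hh.le
      have e : h * (m / h - 1) = m - h := by field_simp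
      rw [e] at this
      linarith
    nlinarith [mul_le_mul_of_nonneg_left h2 (sub_nonneg.2 hle), sq_nonneg (h - m)]
  · set y := Real.log m - Real.log h with hy
    have hy0 : 0 ≤ y := sub_nonneg.2 (Real.log_le_log hh hle)
    have hy1 : y ≤ 1 := by
      have := Real.log_le_log hm hmh
      rw [Real.log_mul (Real.exp_pos 1).ne' hh.ne', Real.log_exp] at this
      linarith
    have hexp : Real.exp y = m / h := by
      rw [hy, Real.exp_sub, Real.exp_log hm, Real.exp_log hh]
    have hconv := convexOn_exp.2 (Set.mem_univ (0 : ℝ)) (Set.mem_univ (1 : ℝ))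
      (sub_nonneg.2 hy1) hy0 (by ring)
    simp only [smul_eq_mul, mul_zero, mul_one, zero_add, Real.exp_zero] at hconv
    have he := Real.exp_one_lt_d9
    have h3 : m / h ≤ 1 + 2 * y := by rw [← hexp]; nlinarith
    have h4 : m - h ≤ 2 * h * y := by
      rw [div_le_iff₀ hh] at h3; linarith
    have h5 := mul_le_mul_of_nonneg_left h4 (sub_nonneg.2 hle)
    calc (h - m) ^ 2 = (m - h) * (m - h) := by ring
      _ ≤ (m - h) * (2 * h * y) := h5
      _ = _ := by rw [hy]; ring

/-- h - E_i h is orthogonal to functions not depending on the site `i`, so k may be subtracted from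
G and log E_i h from log h. Young's inequality weighted by h and `sq_sub_le_mul_log` conclude. -/
lemma mean_mul_sub_avg_le (hw : IsWeight w) {h G k : (ι → α) → ℝ} (i : ι) (hh : ∀ x, 0 < h x)
    (hk : ∀ x z, k (update x i z) = k x) (hreg : ∀ x, avg w i h x ≤ Real.exp 1 * h x) {lam : ℝ}
    (hlam : 0 < lam) :
    mean w (fun x => G x * (h x - avg w i h x))
      ≤ lam / 2 * mean w (fun x => (G x - k x) ^ 2 * h x) + lam⁻¹ * entropyProd w i h := by
  have hzero : ∀ u : (ι → α) → ℝ, (∀ x z, u (update x i z) = u x) →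
      mean w (u * (h - avg w i h)) = 0 := by
    intro u hu
    have := mean_avg hw i (u * (h - avg w i h))
    rw [avg_mul_of_indep w i hu, avg_sub, avg_avg hw, sub_self, mul_zero] at this
    rw [← this]; simp [mean]
  have e1 : mean w (fun x => G x * (h x - avg w i h x))
      = mean w (fun x => (G x - k x) * (h x - avg w i h x)) := by
    have h2 := hzero k hk
    have h3 := mean_sub w (fun x => G x * (h x - avg w i h x)) (k * (h - avg w i h))
    rw [h2, sub_zero] at h3
    rw [← h3]
    congr 1; ext x; simp; ring
  have e2 : entropyProd w i h
      = mean w (fun x => (h x - avg w i h x) * (Real.log (h x) - Real.log (avg w i h x))) := by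
    have h2 := hzero (fun x => Real.log (avg w i h x)) (fun x z => by rw [avg_update])
    have h3 := mean_sub w (fun x => (h x - avg w i h x) * Real.log (h x))
      ((fun x => Real.log (avg w i h x)) * (h - avg w i h))
    rw [h2, sub_zero] at h3
    rw [entropyProd, ← h3]
    congr 1; ext x; simp; ring
  rw [e1, e2, ← mean_smul, ← mean_smul, ← mean_add]
  refine mean_mono hw fun x => ?_
  simp only [Pi.add_apply, Pi.smul_apply, smul_eq_mul]
  have hx := hh x
  have key := sq_sub_le_mul_log hx (avg_pos hw i hh x) (hreg x)
  set D := G x - k x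
  set d := h x - avg w i h x
  set L := d * (Real.log (h x) - Real.log (avg w i h x))
  have h5 : D * d ≤ lam / 2 * (D ^ 2 * h x) + (2 * lam * h x)⁻¹ * d ^ 2 := by
    have : 0 ≤ (2 * lam * h x)⁻¹ * (lam * h x * D - d) ^ 2 := by positivity
    have e : (2 * lam * h x)⁻¹ * (lam * h x * D - d) ^ 2
        = lam / 2 * (D ^ 2 * h x) + (2 * lam * h x)⁻¹ * d ^ 2 - D * d := by
      field_simp; ring
    linarith
  refine h5.trans (add_le_add_right ?_ _)
  calc (2 * lam * h x)⁻¹ * d ^ 2 ≤ (2 * lam * h x)⁻¹ * (2 * h x * L) :=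
        mul_le_mul_of_nonneg_left key (by positivity)
    _ = lam⁻¹ * L := by field_simp

/-- Transport of a regular density to the uniform one along the noise semigroup. -/
lemma mean_mul_sub_mean_le (hw : IsWeight w) {r G : (ι → α) → ℝ} {k : ι → (ι → α) → ℝ}
    (hr : ∀ x, 0 < r x) (hr1 : mean w r = 1) {p : ℝ} (hp : 0 ≤ p)
    (hrp : ∀ x, r x ≤ Real.exp p) (hk : ∀ i x z, k i (update x i z) = k i x)
    (hreg : ∀ i x, avg w i r x ≤ Real.exp 1 * r x) {v lam : ℝ} (hlam : 0 < lam)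
    (hv : ∀ q, 0 < q → q ≤ 1 →
      mean w (fun x => (∑ i, (G x - k i x) ^ 2) * noise w (fun _ => q) r x) ≤ v) :
    mean w (G * r) - mean w G ≤ 2 * lam * v + 4 * p / lam := by
  set h : ℝ → (ι → α) → ℝ := fun q => noise w (fun _ => q) r with hh
  have hpos : ∀ q, 0 ≤ q → q ≤ 1 → ∀ x, 0 < h q x := fun q h0 h1 =>
    noise_pos hw (fun _ => h0) (fun _ => h1) hr
  have hmean : ∀ q, mean w (h q) = 1 := fun q => by rw [hh, mean_noise hw, hr1]
  have hreg' : ∀ q, 0 ≤ q → q ≤ 1 → ∀ i x, avg w i (h q) x ≤ Real.exp 1 * h q x := by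
    intro q h0 h1 i x
    have := noise_mono hw (q := fun _ : ι => q) (fun _ => h0) (fun _ => h1)
      (v := Real.exp 1 • r) (hreg i) x
    rw [noise_avg hw, noise_smul] at this
    simpa using this
  have hv0 : 0 ≤ v := le_trans (mean_nonneg hw fun x => mul_nonneg
    (sum_nonneg fun i _ => sq_nonneg _) (hpos 1 zero_le_one le_rfl x).le) (hv 1 one_pos le_rfl)
  set I : ℝ → ℝ := fun q => ∑ i, entropyProd w i (h q) with hI
  -- J is the derivative of the entropy H, and it is nondecreasing.
  set J : ℝ → ℝ := fun q => q⁻¹ * I q with hJ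
  set m : ℝ → ℝ := fun q => mean w (fun x => G x * h q x) with hm
  set H : ℝ → ℝ := fun q => mean w (fun x => h q x * Real.log (h q x)) with hH
  have hJmono : ∀ q s, 0 < q → q ≤ s → s ≤ 1 → J q ≤ J s := by
    intro q s hq hqs hs
    have hs0 : 0 < s := hq.trans_le hqs
    have e : h q = noise w (fun _ => q / s) (h s) := by
      simp only [hh]
      rw [noise_noise hw]
      congr 1
      ext; simp; field_simp
    have h1 : I q ≤ q / s * I s := by
      simp only [hI]
      rw [mul_sum]
      refine sum_le_sum fun i _ => ?_
      rw [e]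
      exact entropyProd_noise_le hw (by positivity) ((div_le_one hs0).2 hqs) i
        (hpos s hs0.le hs)
    have := mul_le_mul_of_nonneg_left h1 (inv_pos.2 hq).le
    refine this.trans (le_of_eq ?_)
    simp only [hJ]
    field_simp
  have hmd : ∀ q, 0 < q → HasDerivAt m
      (q⁻¹ * ∑ i, mean w (fun x => G x * (h q x - avg w i (h q) x))) q := by
    intro q hq
    refine (hasDerivAt_mean w fun x =>
      (hasDerivAt_noise hw r x hq.ne').const_mul (G x)).congr_deriv ?_
    rw [← mean_sum, ← mean_smul]
    congr 1
    ext x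
    simp only [Pi.smul_apply, smul_eq_mul, ← mul_sum]
    simp only [hh]
    ring
  have hmb : ∀ q, 0 < q → q ≤ 1 → ∀ l, 0 < l →
      q⁻¹ * ∑ i, mean w (fun x => G x * (h q x - avg w i (h q) x))
        ≤ q⁻¹ * (l / 2 * v) + l⁻¹ * J q := by
    intro q hq hq1 l hl
    have h1 : ∑ i, mean w (fun x => G x * (h q x - avg w i (h q) x))
        ≤ l / 2 * v + l⁻¹ * I q := by
      refine (sum_le_sum fun i _ => mean_mul_sub_avg_le hw i (hpos q hq.le hq1) (hk i)
        (hreg' q hq.le hq1 i) hl).trans ?_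
      rw [sum_add_distrib, ← mul_sum, ← mul_sum]
      refine add_le_add_left (mul_le_mul_of_nonneg_left ?_ (by positivity)) _
      refine le_trans (le_of_eq ?_) (hv q hq hq1)
      rw [← mean_sum]
      congr 1
      ext x
      rw [sum_mul]
    refine (mul_le_mul_of_nonneg_left h1 (inv_pos.2 hq).le).trans (le_of_eq ?_)
    simp only [hJ]
    ring
  have hHd : ∀ q, 0 < q → q ≤ 1 → HasDerivAt H (J q) q := by
    intro q hq hq1
    have h1 : ∀ x, HasDerivAt (fun s => h s x * Real.log (h s x))
        ((q⁻¹ * ∑ i, (h q x - avg w i (h q) x)) * (Real.log (h q x) + 1)) q := by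
      intro x
      have d := hasDerivAt_noise hw r x hq.ne'
      have hx := hpos q hq.le hq1 x
      refine (d.mul (d.log hx.ne')).congr_deriv ?_
      simp only [hh] at hx ⊢
      field_simp
    refine (hasDerivAt_mean w h1).congr_deriv ?_
    simp only [hJ, hI, entropyProd]
    rw [← mean_sum, ← mean_smul]
    have e0 : mean w (fun x => ∑ i, (h q x - avg w i (h q) x)) = 0 := by
      rw [mean_sum]
      refine sum_eq_zero fun i _ => ?_
      have := mean_sub w (h q) (avg w i (h q))
      rw [mean_avg hw, sub_self] at this
      exact this
    have e1 := mean_smul w q⁻¹ (fun x => ∑ i, (h q x - avg w i (h q) x))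
    rw [e0, mul_zero] at e1
    rw [← add_zero (mean w (q⁻¹ • _)), ← e1, ← mean_add]
    congr 1
    ext x
    simp only [Pi.add_apply, Pi.smul_apply, smul_eq_mul]
    rw [← sum_mul]
    ring
  have hmc : Continuous m := by
    simp only [hm, mean, hh]
    refine continuous_finsetSum _ fun x _ => continuous_const.mul
      (continuous_const.mul (continuous_noise w r x))
  have hHc : ContinuousOn H (Set.Icc (1 / 2) 1) := by
    intro q hq
    exact (hHd q (by linarith [hq.1]) hq.2).continuousAt.continuousWithinAt
  have e1 : h 1 = r := noise_one w r
  have hH1 : H 1 ≤ p := by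
    simp only [hH, e1]
    calc mean w (fun x => r x * Real.log (r x)) ≤ mean w (p • r) := by
          refine mean_mono hw fun x => ?_
          simp only [Pi.smul_apply, smul_eq_mul]
          rw [mul_comm]
          refine mul_le_mul_of_nonneg_right ?_ (hr x).le
          have := Real.log_le_log (hr x) (hrp x)
          rwa [Real.log_exp] at this
      _ = p := by rw [mean_smul, hr1, mul_one]
  have hH0 : 0 ≤ H (1 / 2) := by
    have h2 : mean w (h (1 / 2) - 1) ≤ H (1 / 2) := by
      refine mean_mono hw fun x => ?_
      have hx := hpos (1 / 2) (by norm_num) (by norm_num) x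
      have := Real.one_sub_inv_le_log_of_pos hx
      have := mul_le_mul_of_nonneg_left this hx.le
      rw [mul_sub, mul_inv_cancel₀ hx.ne', mul_one] at this
      simpa using this
    rwa [mean_sub, hmean, mean_one hw, sub_self] at h2
  -- By convexity the slope at 1/2 is at most that of the chord to 1, and 0 ≤ H (1/2), H 1 ≤ p.
  have hJhalf : J (1 / 2) ≤ 2 * p := by
    have := (convex_Icc (1 / 2 : ℝ) 1).mul_sub_le_image_sub_of_le_deriv (f := H) (C := J (1 / 2))
      hHc (by
        rw [interior_Icc]
        intro q hq
        exact (hHd q (by linarith [hq.1]) hq.2.le).differentiableAt.differentiableWithinAt) (by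
        rw [interior_Icc]
        intro q hq
        rw [(hHd q (by linarith [hq.1]) hq.2.le).deriv]
        exact hJmono _ _ (by norm_num) hq.1.le hq.2.le)
      (1 / 2) (Set.left_mem_Icc.2 (by norm_num)) 1 (Set.right_mem_Icc.2 (by norm_num))
      (by norm_num)
    linarith
  -- the part of the path over `[0, 1/2]`
  have hlow : m (1 / 2) - m 0 ≤ 3 / 2 * (lam / 2 * v + 2 * p / lam) := by
    set B := lam / 2 * v + 2 * p / lam with hB
    have hB0 : 0 ≤ B := by positivity
    have hanti : AntitoneOn (fun q => m q - 2 * B * √q) (Set.Icc 0 (1 / 2)) := by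
      have hd : ∀ q ∈ Set.Ioo (0 : ℝ) (1 / 2), ∃ d ≤ 0,
          HasDerivAt (fun q => m q - 2 * B * √q) d q := by
        intro q hq
        have hq0 := hq.1
        have hs : 0 < √q := Real.sqrt_pos.2 hq0
        refine ⟨_, ?_, (hmd q hq0).sub ((Real.hasDerivAt_sqrt hq0.ne').const_mul (2 * B))⟩
        -- 1 / q is not integrable at 0; a weight proportional to √q makes both terms multiples of 1
        -- / √q.
        have h1 := hmb q hq0 (by linarith [hq.2]) (lam * √q) (by positivity)
        have h2 : J q ≤ 2 * p := (hJmono q (1 / 2) hq0 hq.2.le (by norm_num)).trans hJhalf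
        have h3 : (lam * √q)⁻¹ * J q ≤ (lam * √q)⁻¹ * (2 * p) :=
          mul_le_mul_of_nonneg_left h2 (by positivity)
        have hsq : √q * √q = q := Real.mul_self_sqrt hq0.le
        have e : q⁻¹ * (lam * √q / 2 * v) + (lam * √q)⁻¹ * (2 * p)
            = 2 * B * (1 / (2 * √q)) := by
          rw [hB]
          nth_rewrite 1 [← hsq]
          field_simp
        linarith
      refine antitoneOn_of_deriv_nonpos (convex_Icc _ _) (by fun_prop) ?_ ?_
      · rw [interior_Icc]
        intro a ha
        obtain ⟨d, -, hd⟩ := hd a ha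
        exact hd.differentiableAt.differentiableWithinAt
      · rw [interior_Icc]
        intro a ha
        obtain ⟨d, hd0, hd⟩ := hd a ha
        rw [hd.deriv]; exact hd0
    have := hanti (Set.left_mem_Icc.2 (by norm_num)) (Set.right_mem_Icc.2 (by norm_num))
      (by norm_num : (0 : ℝ) ≤ 1 / 2)
    simp only [Real.sqrt_zero, mul_zero, sub_zero] at this
    have hsq : √(1 / 2 : ℝ) ≤ 3 / 4 := by
      rw [Real.sqrt_le_left (by norm_num)]; norm_num
    nlinarith
  -- the part of the path over `[1/2, 1]`
  have hhigh : m 1 - m (1 / 2) ≤ lam * v / 2 + lam⁻¹ * p := by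
    -- The bound J ≤ 2 p is not available here; J is absorbed as the derivative of H instead.
    have hd : ∀ q ∈ Set.Ioo (1 / 2 : ℝ) 1, ∃ d ≤ lam * v,
        HasDerivAt (fun q => m q - lam⁻¹ * H q) d q := by
      intro q hq
      have hq0 : 0 < q := by linarith [hq.1]
      refine ⟨_, ?_, (hmd q hq0).sub ((hHd q hq0 hq.2.le).const_mul lam⁻¹)⟩
      have h1 := hmb q hq0 hq.2.le lam hlam
      have h2 : q⁻¹ ≤ 2 := by
        rw [inv_le_comm₀ hq0 (by norm_num)]
        linarith [hq.1]
      have h3 : q⁻¹ * (lam / 2 * v) ≤ 2 * (lam / 2 * v) :=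
        mul_le_mul_of_nonneg_right h2 (by positivity)
      linarith
    have := (convex_Icc (1 / 2 : ℝ) 1).image_sub_le_mul_sub_of_deriv_le
      (f := fun q => m q - lam⁻¹ * H q) (C := lam * v)
      (hmc.continuousOn.sub (continuousOn_const.mul hHc)) (by
        rw [interior_Icc]
        intro q hq
        obtain ⟨d, -, hd⟩ := hd q hq
        exact hd.differentiableAt.differentiableWithinAt) (by
        rw [interior_Icc]
        intro q hq
        obtain ⟨d, hd0, hd⟩ := hd q hq
        rw [hd.deriv]; exact hd0)
      (1 / 2) (Set.left_mem_Icc.2 (by norm_num)) 1 (Set.right_mem_Icc.2 (by norm_num))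
      (by norm_num)
    have h5 : lam⁻¹ * H 1 - lam⁻¹ * H (1 / 2) ≤ lam⁻¹ * p := by
      rw [← mul_sub]
      exact mul_le_mul_of_nonneg_left (by linarith) (inv_pos.2 hlam).le
    linarith
  have em1 : m 1 = mean w (G * r) := by simp only [hm, e1]; rfl
  have em0 : m 0 = mean w G := by
    simp only [hm, hh]
    congr 1
    ext x
    have : noise w (fun _ : ι => (0 : ℝ)) r x = mean w r := noise_zero w r x
    rw [this, hr1, mul_one]
  rw [← em1, ← em0]
  have e7 : lam⁻¹ * p = p / lam := by rw [inv_mul_eq_div]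
  have e8 : 2 * p / lam = 2 * (p / lam) := mul_div_assoc _ _ _
  have e9 : 4 * p / lam = 4 * (p / lam) := mul_div_assoc _ _ _
  rw [e9]
  rw [e8] at hlow
  rw [e7] at hhigh
  have : 0 ≤ lam * v := by positivity
  linarith

/-- The Efron–Stein inequality. -/
lemma variance_le_sum_mean_sq (hw : IsWeight w) (F : (ι → α) → ℝ) :
    mean w (F * F) - mean w F ^ 2 ≤ ∑ i, mean w (fun x => (F x - avg w i F x) ^ 2) := by
  -- φ interpolates between (E F)² at q = 0 and E[F²] at q = 1.
  set φ : ℝ → ℝ := fun q => mean w (fun x => F x * noise w (fun _ => q) F x) with hφ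
  have hder : ∀ q ∈ Set.Ioo (0 : ℝ) 1, ∃ d ≤ ∑ i, mean w (fun x => (F x - avg w i F x) ^ 2),
      HasDerivAt φ d q := by
    intro q hq
    have hq0 := hq.1
    refine ⟨_, ?_, hasDerivAt_mean w fun x => (hasDerivAt_noise hw F x hq0.ne').const_mul (F x)⟩
    have e1 : mean w (fun x => F x * (q⁻¹ * ∑ i, (noise w (fun _ => q) F x
        - avg w i (noise w (fun _ => q) F) x)))
        = q⁻¹ * ∑ i, mean w (F * (noise w (fun _ => q) F - avg w i (noise w (fun _ => q) F))) := by
      rw [← mean_sum, ← mean_smul]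
      congr 1
      ext x
      simp only [Pi.smul_apply, Pi.mul_apply, Pi.sub_apply, smul_eq_mul, ← mul_sum]
      ring
    rw [e1, mul_sum]
    refine sum_le_sum fun i _ => ?_
    set D := F - avg w i F with hD
    have hD0 : avg w i D = 0 := by rw [hD, avg_sub, avg_avg hw, sub_self]
    have e2 : noise w (fun _ => q) F - avg w i (noise w (fun _ => q) F)
        = noise w (fun _ => q) D := by rw [hD, noise_sub, noise_avg hw]
    -- Since E_i D = 0, the noise at `i` acts as the factor q, which cancels the 1 / q of the
    -- derivative.
    have e3 : noise w (fun _ => q) D = q • noise w (update (fun _ => q) i 1) D := by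
      ext x
      rw [noise_split w _ i, ← avg_noise hw, ← noise_avg hw, hD0]
      simp [noise]
    have e4 : mean w (F * noise w (fun _ => q) D) = mean w (D * noise w (fun _ => q) D) := by
      have : mean w (avg w i F * noise w (fun _ => q) D) = 0 := by
        rw [← mean_mul_avg hw, ← noise_avg hw, hD0]
        simp [mean, noise]
      nth_rewrite 2 [hD]
      rw [sub_mul, mean_sub, this, sub_zero]
    rw [e2, e4, e3]
    have e5 : mean w (D * q • noise w (update (fun _ => q) i 1) D)
        = q * mean w (D * noise w (update (fun _ => q) i 1) D) := by
      rw [← mean_smul]; congr 1; ext x; simp; ring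
    rw [e5, inv_mul_cancel_left₀ hq0.ne']
    set N := noise w (update (fun _ => q) i 1) D with hN
    have hu0 : ∀ j, 0 ≤ update (fun _ : ι => q) i 1 j := fun j => by
      by_cases hj : j = i
      · subst hj; simp
      · simp [hj, hq0.le]
    have hu1 : ∀ j, update (fun _ : ι => q) i 1 j ≤ 1 := fun j => by
      by_cases hj : j = i
      · subst hj; simp
      · simp [hj, hq.2.le]
    have h6 : mean w (fun x => N x ^ 2) ≤ mean w (fun x => D x ^ 2) := by
      refine (mean_mono hw fun x => noise_sq_le hw hu0 hu1 D x).trans ?_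
      rw [mean_noise hw]
    have h7 : mean w (D * N) ≤ mean w ((1 / 2 : ℝ) • ((fun x => D x ^ 2) + fun x => N x ^ 2)) := by
      refine mean_mono hw fun x => ?_
      simp only [Pi.smul_apply, Pi.add_apply, Pi.mul_apply, smul_eq_mul]
      nlinarith [sq_nonneg (D x - N x)]
    rw [mean_smul, mean_add] at h7
    change mean w (D * N) ≤ mean w (fun x => D x ^ 2)
    linarith
  have hc : Continuous φ := by
    simp only [hφ, mean]
    exact continuous_finsetSum _ fun x _ => continuous_const.mul
      (continuous_const.mul (continuous_noise w F x))
  have := (convex_Icc (0 : ℝ) 1).image_sub_le_mul_sub_of_deriv_le (f := φ)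
    (C := ∑ i, mean w (fun x => (F x - avg w i F x) ^ 2)) hc.continuousOn (by
      rw [interior_Icc]
      intro q hq
      obtain ⟨d, -, hd⟩ := hder q hq
      exact hd.differentiableAt.differentiableWithinAt) (by
      rw [interior_Icc]
      intro q hq
      obtain ⟨d, hd0, hd⟩ := hder q hq
      rw [hd.deriv]; exact hd0)
    0 (Set.left_mem_Icc.2 (by norm_num)) 1 (Set.right_mem_Icc.2 (by norm_num)) (by norm_num)
  have ep1 : φ 1 = mean w (F * F) := by
    have : noise w (fun _ : ι => (1 : ℝ)) F = F := noise_one w F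
    simp only [hφ, this]; rfl
  have ep0 : φ 0 = mean w F ^ 2 := by
    have : ∀ x, noise w (fun _ : ι => (0 : ℝ)) F x = mean w F := noise_zero w F
    simp only [hφ, this]
    have := mean_smul w (mean w F) F
    rw [sq, ← this]
    congr 1; ext x; simp [mul_comm]
  rw [← ep1, ← ep0]
  linarith

end Entropy

/-! ### The deviation inequality on a finite product space -/

section Deviation

variable {ι α : Type*} [Fintype ι] [DecidableEq ι] [Fintype α] [DecidableEq α] {w : α → ℝ}

/-- Truncation to `[0, b]`. -/
noncomputable def clip (b y : ℝ) : ℝ := max 0 (min y b)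

lemma clip_nonneg (b y : ℝ) : 0 ≤ clip b y := le_max_left _ _

lemma clip_le {b : ℝ} (hb : 0 ≤ b) (y : ℝ) : clip b y ≤ b := max_le hb (min_le_right _ _)

lemma clip_of_le {b y : ℝ} (hb : 0 ≤ b) (h : b ≤ y) : clip b y = b := by
  rw [clip, min_eq_right h, max_eq_right hb]

lemma sq_clip_sub_clip_le (b y z : ℝ) : (clip b y - clip b z) ^ 2 ≤ (y - z) ^ 2 := by
  refine sq_le_sq.2 ?_
  unfold clip
  refine (abs_max_sub_max_le_max 0 (min y b) 0 (min z b)).trans ?_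
  rw [sub_self, abs_zero, max_eq_right (abs_nonneg _)]
  refine (abs_min_sub_min_le_max y b z b).trans ?_
  rw [sub_self, abs_zero, max_eq_left (abs_nonneg _)]

/-- Expand (y - t)² ≥ 0. The truncated function thus has mean at most the variance over 2 t. -/
lemma clip_le_sq {t y : ℝ} (ht : 0 < t) : clip (t / 2) (y - t / 2) ≤ y ^ 2 / (2 * t) := by
  unfold clip
  refine max_le (by positivity) ((min_le_left _ _).trans ?_)
  rw [le_div_iff₀ (by positivity)]
  nlinarith [sq_nonneg (y - t)]

/-- Source of the density bound e^(2p+5): e^p bounds h, 2 bounds the inverse probability a^(-n), and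
2^m + 1 comes from the tilted kernel. -/
lemma two_pow_bound {p : ℝ} (hp : 0 ≤ p) {m : ℕ} (hm : (m : ℝ) ≤ p + 4) :
    Real.exp p * 2 * (2 ^ m + 1) ≤ Real.exp (2 * p + 5) := by
  have h1 : (2 : ℝ) ^ (m + 2) ≤ Real.exp (p + 5) := by
    rw [← Real.exp_log (show (0 : ℝ) < 2 ^ (m + 2) by positivity), Real.log_pow]
    refine Real.exp_le_exp.2 ?_
    have hl := Real.log_two_lt_d9
    have hl0 := Real.log_pos (one_lt_two (α := ℝ))
    push_cast
    nlinarith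
  have h2 : (1 : ℝ) ≤ 2 ^ m := one_le_pow₀ (by norm_num)
  have e : Real.exp (2 * p + 5) = Real.exp p * Real.exp (p + 5) := by
    rw [← Real.exp_add]; congr 1; ring
  rw [e, mul_assoc]
  refine mul_le_mul_of_nonneg_left ?_ (Real.exp_pos p).le
  rw [pow_add] at h1
  linarith

set_option maxHeartbeats 800000 in
/-- A deviation with probability `e^{-p}` is at most of order `√((p + 1) v)`, if `v` bounds the
mean of the square function under all densities bounded by `e^{2 p + 5}`. -/
theorem deviation_le (hw : IsWeight w) (F : (ι → α) → ℝ) {t p v : ℝ} (ht : 0 < t) (hp : 0 ≤ p)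
    (hv0 : 0 < v)
    (hA : mean w ({x | mean w F + t ≤ F x}.indicator 1) = Real.exp (-p))
    (hv : ∀ ρ : (ι → α) → ℝ, (∀ x, 0 ≤ ρ x) → (∀ x, ρ x ≤ Real.exp (2 * p + 5)) →
      mean w ρ ≤ 1 → mean w (fun x => (∑ i, (F x - avg w i F x) ^ 2) * ρ x) ≤ v) :
    t ≤ 100 * √((p + 1) * v) := by
  set A : Set (ι → α) := {x | mean w F + t ≤ F x} with hAdef
  set n := Fintype.card ι with hn
  -- Makes 3^n e^(-ℓ) ≤ e^(-2) ≤ 1/4, whence also (1 - δ)^n ≥ 1/2.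
  set ℓ : ℝ := 2 * n + 2 with hℓdef
  have hℓ : 1 ≤ ℓ := by
    have : (0 : ℝ) ≤ n := Nat.cast_nonneg n
    linarith
  have he2 : (4 : ℝ) ≤ Real.exp 2 := by
    have h1 := Real.exp_one_gt_d9
    have : Real.exp 2 = Real.exp 1 * Real.exp 1 := by rw [← Real.exp_add]; norm_num
    rw [this]; nlinarith
  set δ := Real.exp (-ℓ) with hδ
  have hδ0 : 0 < δ := Real.exp_pos _
  have h3n : 3 ^ n * δ ≤ 1 / 4 := by
    have e : δ = (Real.exp 2)⁻¹ ^ n * (Real.exp 2)⁻¹ := by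
      rw [← Real.exp_neg, ← Real.exp_nat_mul, ← Real.exp_add, hδ, hℓdef]
      congr 1; ring
    rw [e, ← mul_assoc, ← mul_pow]
    have h4 : 3 * (Real.exp 2)⁻¹ ≤ 1 := by
      rw [← div_eq_mul_inv, div_le_one (Real.exp_pos 2)]; linarith
    have h5 : (3 * (Real.exp 2)⁻¹) ^ n ≤ 1 := pow_le_one₀ (by positivity) h4
    have h6 : (Real.exp 2)⁻¹ ≤ 1 / 4 := by
      rw [one_div]; exact inv_anti₀ (by norm_num) he2
    have h7 : 0 < (Real.exp 2)⁻¹ := by positivity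
    nlinarith
  have hδ4 : δ ≤ 1 / 4 := by
    have : (1 : ℝ) ≤ 3 ^ n := one_le_pow₀ (by norm_num)
    nlinarith
  have hδ1 : δ < 1 := by linarith
  have hsmall : 3 ^ Fintype.card ι * δ ≤ 1 := by rw [← hn]; linarith
  have hQn : ∀ a, 1 - δ ≤ a → (a ^ n)⁻¹ ≤ 2 := by
    intro a ha
    have h1 : 1 - n * δ ≤ (1 - δ) ^ n := by
      have := one_add_mul_le_pow (a := -δ) (by linarith) n
      calc 1 - n * δ = 1 + n * (-δ) := by ring
        _ ≤ _ := this
        _ = _ := by ring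
    have h2 : (n : ℝ) ≤ 3 ^ n := by exact_mod_cast (Nat.lt_pow_self (by norm_num)).le
    have h3 : (1 - δ) ^ n ≤ a ^ n := pow_le_pow_left₀ (by linarith) ha n
    have h4 : 1 / 2 ≤ a ^ n := by nlinarith
    calc (a ^ n)⁻¹ ≤ (1 / 2)⁻¹ := inv_anti₀ (by norm_num) h4
      _ = 2 := by norm_num
  -- the initial density
  set h : (ι → α) → ℝ := fun x => 3 / 4 * Real.exp p * A.indicator 1 x + 1 / 4 with hh
  have hind0 : ∀ x, 0 ≤ A.indicator (1 : (ι → α) → ℝ) x :=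
    fun x => Set.indicator_nonneg (fun _ _ => zero_le_one) x
  have hind1 : ∀ x, A.indicator (1 : (ι → α) → ℝ) x ≤ 1 :=
    fun x => Set.indicator_le_self' (fun _ _ => zero_le_one) x
  have hep : 1 ≤ Real.exp p := Real.one_le_exp hp
  -- The floor 1/4 in h is there for this positivity, which the fixed point argument needs.
  have hhpos : ∀ x, 0 < h x := fun x => by
    have := hind0 x
    simp only [hh]; positivity
  have hh1 : mean w h = 1 := by
    have e : h = (3 / 4 * Real.exp p) • A.indicator 1 + fun _ => 1 / 4 := by ext x; simp [hh]
    rw [e, mean_add, mean_smul, mean_const hw, hA, mul_assoc, ← Real.exp_add]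
    norm_num
  have hhp : ∀ x, h x ≤ Real.exp p := fun x => by
    have h1 := mul_le_mul_of_nonneg_left (hind1 x) (show 0 ≤ 3 / 4 * Real.exp p by positivity)
    simp only [hh]; linarith
  obtain ⟨γ, f, g, r, hγ0, hγ1, hf, hg, hr, hfg, hgv, hrv, hr1, hrp, hfp, hreg, hΓ⟩ :=
    exists_factorization hw hℓ hp hhpos hh1 hhp
  -- On `s` T f is at least e^(-3ℓ); off `s` r is less than e^(-3), so cutting g to `s` loses little
  -- mass.
  set s : Set (ι → α) := {x | Real.exp (-3) ≤ r x} with hs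
  set m := ⌈p + 3⌉₊ with hm
  have hm1 : p + 3 ≤ m := Nat.le_ceil _
  have hm2 : (m : ℝ) ≤ p + 4 := by
    have := (Nat.ceil_lt_add_one (show 0 ≤ p + 3 by linarith)).le
    linarith
  set gs := s.indicator g with hgs
  have hgs0 : ∀ x, 0 ≤ gs x := fun x => Set.indicator_nonneg (fun y _ => (hg y).le) x
  have hgsg : ∀ x, gs x ≤ g x := fun x => Set.indicator_le_self' (fun y _ => (hg y).le) x
  have hvpos : ∀ x, 0 < noise w (fun _ => 1 - δ) f x :=
    noise_pos hw (fun _ => by linarith) (fun _ => by linarith) hf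
  have hgsmean : mean w (noise w (fun _ => 1 - δ) f * gs) ≤ 1 := by
    refine (mean_mono hw fun x => ?_).trans_eq hr1
    rw [hrv]
    exact mul_le_mul_of_nonneg_left (hgsg x) (hvpos x).le
  -- the truncated function
  set G : (ι → α) → ℝ := fun x => clip (t / 2) (F x - mean w F - t / 2) with hG
  set k : ι → (ι → α) → ℝ := fun i x => clip (t / 2) (avg w i F x - mean w F - t / 2) with hk
  have hkind : ∀ i x z, k i (update x i z) = k i x := fun i x z => by
    simp only [hk, avg_update]
  have hGk : ∀ x, ∑ i, (G x - k i x) ^ 2 ≤ ∑ i, (F x - avg w i F x) ^ 2 := fun x =>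
    sum_le_sum fun i _ => by
      refine (sq_clip_sub_clip_le _ _ _).trans (le_of_eq ?_)
      ring
  have hV : ∀ ρ : (ι → α) → ℝ, (∀ x, 0 ≤ ρ x) → (∀ x, ρ x ≤ Real.exp (2 * p + 5)) →
      mean w ρ ≤ 1 → mean w (fun x => (∑ i, (G x - k i x) ^ 2) * ρ x) ≤ v := by
    intro ρ h0 h1 h2
    refine le_trans (mean_mono hw fun x => ?_) (hv ρ h0 h1 h2)
    exact mul_le_mul_of_nonneg_right (hGk x) (h0 x)
  -- Balances the two kinds of cost: lam * v = (p + 1) / lam = Y.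
  set lam := √((p + 1) / v) with hlam
  have hlam0 : 0 < lam := Real.sqrt_pos.2 (by positivity)
  set Y := √((p + 1) * v) with hY
  have hY0 : 0 < Y := Real.sqrt_pos.2 (by positivity)
  have hlv : lam * v = Y := by
    rw [hlam, hY, Real.sqrt_div (by linarith), Real.sqrt_mul (by linarith)]
    have : √v * √v = v := Real.mul_self_sqrt hv0.le
    have hsv : 0 < √v := Real.sqrt_pos.2 hv0
    rw [div_mul_eq_mul_div, div_eq_iff hsv.ne', mul_assoc, this]
  have hlp : (p + 1) / lam = Y := by
    rw [div_eq_iff hlam0.ne', hlam, hY, ← Real.sqrt_mul (by positivity)]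
    have : (p + 1) * v * ((p + 1) / v) = (p + 1) ^ 2 := by field_simp
    rw [this, Real.sqrt_sq (by linarith)]
  -- transport along the bridge
  have phase1 : mean w (G * (f * noise w (fun _ => 1 - δ) gs))
      - mean w (G * (noise w (fun _ => 1 - δ) f * gs)) ≤ 28 * Y := by
    have hN : δ * ∑ i, mean w (f * avg w i (noise w (fun _ => 1 - δ) gs)) ≤ m + 2 := by
      refine sum_mean_mul_avg_noise_le hw hℓ hsmall hm1 (fun x => (hf x).le) hfp hgs0 ?_ ?_
      · intro x hx
        have : x ∈ s := by
          by_contra hc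
          exact hx (Set.indicator_of_notMem hc g)
        exact hΓ x this
      · rw [mul_comm]; exact hgsmean
    have hb := mean_bridge_sub_le hw (G := G) (fun x => (hf x).le) hgs0 hkind hδ0 hδ1 hlam0 hN
      (v := v) (by
        intro a ha ha1
        have ha0 : 0 < a := by linarith
        have hb0 : 0 ≤ (1 - δ) / a := div_nonneg (by linarith) ha0.le
        have hb1 : (1 - δ) / a ≤ 1 := (div_le_one ha0).2 ha.le
        have hab : a * ((1 - δ) / a) = 1 - δ := by field_simp
        refine hV (fun x => noise w (fun _ => a) f x * noise w (fun _ => (1 - δ) / a) gs x)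
          ?_ ?_ ?_
        · intro x
          exact mul_nonneg (noise_nonneg hw (fun _ => ha0.le) (fun _ => ha1.le)
            (fun x => (hf x).le) x) (noise_nonneg hw (fun _ => hb0) (fun _ => hb1) hgs0 x)
        · intro x
          refine (noise_mul_noise_indicator_le hw hℓ hsmall hm1 hγ0 hγ1 hf hfp hgv
            (Real.exp_pos p).le (fun x => (hfg x).trans_le (hhp x)) (s := s) hΓ ha.le ha1.le
            hb0 hb1 hab x).trans ?_
          refine le_trans ?_ (two_pow_bound hp hm2)
          gcongr
          exact hQn a ha.le
        · have e : mean w (noise w (fun _ => a) f * noise w (fun _ => (1 - δ) / a) gs)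
              = mean w (noise w (fun _ => 1 - δ) f * gs) := by
            rw [← mean_mul_noise, noise_noise hw, ← mean_mul_noise]
            congr 3
            ext; simp [hab]
          exact e.trans_le hgsmean)
    refine hb.trans ?_
    have hq2 : (1 - δ)⁻¹ ≤ 2 := by
      calc (1 - δ)⁻¹ ≤ (1 / 2)⁻¹ := inv_anti₀ (by norm_num) (by linarith)
        _ = 2 := by norm_num
    have h6 : 2 * ((m : ℝ) + 2) / lam ≤ 12 * Y := by
      rw [← hlp, ← mul_div_assoc]
      exact div_le_div_of_nonneg_right (by linarith) hlam0.le
    have h7 : 2 * lam * v = 2 * Y := by rw [mul_assoc, hlv]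
    calc _ ≤ (1 - δ)⁻¹ * (14 * Y) := by
          refine mul_le_mul_of_nonneg_left (by linarith) (inv_nonneg.2 (by linarith))
      _ ≤ 2 * (14 * Y) := by gcongr
      _ = _ := by ring
  -- transport along the semigroup
  have phase2 : mean w (G * r) - mean w G ≤ 6 * Y := by
    have hb := mean_mul_sub_mean_le hw (G := G) hr hr1 hp hrp hkind hreg hlam0 (v := v) (by
      intro q hq hq1
      refine hV _ ?_ ?_ ?_
      · exact fun x => (noise_pos hw (fun _ => hq.le) (fun _ => hq1) hr x).le
      · intro x
        have := noise_mono hw (q := fun _ : ι => q) (fun _ => hq.le) (fun _ => hq1) hrp x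
        rw [noise_const hw] at this
        refine this.trans (Real.exp_le_exp.2 (by linarith))
      · rw [mean_noise hw, hr1])
    refine hb.trans ?_
    have h6 : 4 * p / lam ≤ 4 * Y := by
      rw [← hlp, ← mul_div_assoc]
      exact div_le_div_of_nonneg_right (by linarith) hlam0.le
    have h7 : 2 * lam * v = 2 * Y := by rw [mul_assoc, hlv]
    linarith
  -- the mean of the truncated function
  have hEG : mean w G ≤ v / (2 * t) := by
    have hone := hv (fun _ => 1) (fun _ => zero_le_one)
      (fun _ => Real.one_le_exp (by linarith)) (mean_const hw 1).le
    simp only [mul_one] at hone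
    rw [mean_sum] at hone
    have hes := (variance_le_sum_mean_sq hw F).trans hone
    have h1 : mean w G ≤ mean w ((2 * t)⁻¹ • fun x => (F x - mean w F) ^ 2) := by
      refine mean_mono hw fun x => ?_
      simp only [Pi.smul_apply, smul_eq_mul]
      rw [inv_mul_eq_div]
      exact clip_le_sq ht
    have e2 : mean w (fun x => (F x - mean w F) ^ 2) = mean w (F * F) - mean w F ^ 2 := by
      have e : (fun x => (F x - mean w F) ^ 2)
          = F * F - (2 * mean w F) • F + fun _ => mean w F ^ 2 := by
        ext x; simp; ring
      rw [e, mean_add, mean_sub, mean_smul, mean_const hw]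
      ring
    rw [mean_smul, e2, inv_mul_eq_div] at h1
    refine h1.trans ?_
    gcongr
  -- assembling
  have hG0 : ∀ x, 0 ≤ G x := fun x => clip_nonneg _ _
  have hG1 : ∀ x, G x ≤ t / 2 := fun x => clip_le (by linarith) _
  have hhG : 3 / 8 * t ≤ mean w (G * h) := by
    have h1 : mean w ((3 / 8 * t * Real.exp p) • A.indicator 1) ≤ mean w (G * h) := by
      refine mean_mono hw fun x => ?_
      simp only [Pi.smul_apply, Pi.mul_apply, smul_eq_mul]
      by_cases hx : x ∈ A
      · have hGx : G x = t / 2 := by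
          refine clip_of_le (by linarith) ?_
          have : mean w F + t ≤ F x := hx
          linarith
        simp only [hh, hGx, Set.indicator_of_mem hx, Pi.one_apply]
        nlinarith only [ht]
      · rw [Set.indicator_of_notMem hx]
        have := mul_nonneg (hG0 x) (hhpos x).le
        linarith
    rw [mean_smul, hA, mul_assoc, ← Real.exp_add] at h1
    simpa using h1
  -- The cut to `s` costs at most (t / 2) e^(-3) ≤ t / 40, thanks to the truncation G ≤ t / 2.
  have hsplit : mean w (G * h) ≤ mean w (G * (f * noise w (fun _ => 1 - δ) gs)) + t / 40 := by
    have e1 : mean w (G * h) - mean w (G * (f * noise w (fun _ => 1 - δ) gs))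
        = mean w (G * (f * noise w (fun _ => 1 - δ) (g - gs))) := by
      have hfg' : ∀ x, f x * noise w (fun _ => 1 - δ) g x = h x := hfg
      rw [← mean_sub, noise_sub]
      congr 1
      ext x
      simp only [Pi.mul_apply, Pi.sub_apply]
      rw [← hfg' x]
      ring
    have h2 : mean w (G * (f * noise w (fun _ => 1 - δ) (g - gs)))
        ≤ mean w ((t / 2) • (f * noise w (fun _ => 1 - δ) (g - gs))) := by
      refine mean_mono hw fun x => ?_
      simp only [Pi.smul_apply, Pi.mul_apply, smul_eq_mul]
      refine mul_le_mul_of_nonneg_right (hG1 x) (mul_nonneg (hf x).le ?_)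
      exact noise_nonneg hw (fun _ => by linarith) (fun _ => by linarith)
        (fun y => sub_nonneg.2 (hgsg y)) x
    rw [mean_smul, mean_mul_noise] at h2
    have h3 : mean w (noise w (fun _ => 1 - δ) f * (g - gs)) ≤ 1 / 20 := by
      have he3 : Real.exp (-3) ≤ 1 / 20 := by
        have h1 := Real.exp_one_gt_d9
        have : Real.exp 3 = Real.exp 1 * Real.exp 2 := by rw [← Real.exp_add]; norm_num
        have h20 : Real.exp 2 = Real.exp 1 * Real.exp 1 := by rw [← Real.exp_add]; norm_num
        have h21 : 20 ≤ Real.exp 3 := by rw [this, h20]; nlinarith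
        rw [Real.exp_neg, one_div]
        exact inv_anti₀ (by norm_num) h21
      calc _ ≤ mean w (fun _ : ι → α => Real.exp (-3)) := by
            refine mean_mono hw fun x => ?_
            simp only [Pi.mul_apply, Pi.sub_apply]
            by_cases hx : x ∈ s
            · rw [hgs, Set.indicator_of_mem hx, sub_self, mul_zero]
              exact (Real.exp_pos _).le
            · rw [hgs, Set.indicator_of_notMem hx, sub_zero, ← hrv]
              exact (not_le.1 hx).le
        _ ≤ 1 / 20 := by rw [mean_const hw]; exact he3
    have h4 := mul_le_mul_of_nonneg_left h3 (show 0 ≤ t / 2 by linarith)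
    linarith
  have hrG : mean w (G * (noise w (fun _ => 1 - δ) f * gs)) ≤ mean w (G * r) := by
    refine mean_mono hw fun x => ?_
    simp only [Pi.mul_apply]
    rw [hrv]
    exact mul_le_mul_of_nonneg_left (mul_le_mul_of_nonneg_left (hgsg x) (hvpos x).le) (hG0 x)
  -- 7/20 = 3/8 - 1/40 and 34 = 28 + 6; here 3/8 arises as h ≥ (3/4) e^p and G = t / 2 on A, whose
  -- probability is e^(-p).
  have htotal : 7 / 20 * t ≤ v / (2 * t) + 34 * Y := by linarith
  by_contra! hc
  have hvY : v ≤ Y ^ 2 := by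
    rw [hY, Real.sq_sqrt (by positivity)]
    nlinarith only [mul_nonneg hp hv0.le]
  have h8 : v / (2 * t) ≤ Y := by
    rw [div_le_iff₀ (by positivity)]
    nlinarith only [hvY, mul_lt_mul_of_pos_right hc hY0, sq_nonneg Y]
  linarith

end Deviation

end NoiseSemigroup

namespace NoiseSemigroup

/-! ### Density of discretized functions in L¹ -/

section Discretization

variable {I Ω₀ : Type*} [MeasurableSpace Ω₀]

/-- The discretized configuration on a finite set of sites. -/
def quant (s : Finset I) {k : ℕ} (κ : Ω₀ → Fin k) (ω : I → Ω₀) : s → Fin k := fun i => κ (ω i)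

lemma measurable_quant (s : Finset I) {k : ℕ} {κ : Ω₀ → Fin k} (hκ : Measurable κ) :
    Measurable (quant (I := I) s κ) :=
  measurable_pi_iff.2 fun i => hκ.comp (measurable_pi_apply _)

/-- Functions of finitely many discretized coordinates. -/
def IsDiscrete (Y : (I → Ω₀) → ℝ) : Prop :=
  ∃ (s : Finset I) (k : ℕ) (κ : Ω₀ → Fin k) (g : (s → Fin k) → ℝ),
    Measurable κ ∧ Y = fun ω => g (quant s κ ω)

lemma IsDiscrete.measurable {Y : (I → Ω₀) → ℝ} (hY : IsDiscrete Y) : Measurable Y := by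
  obtain ⟨s, k, κ, g, hκ, rfl⟩ := hY
  exact (measurable_of_finite g).comp (measurable_quant s hκ)

lemma IsDiscrete.map₂ (φ : ℝ → ℝ → ℝ) {Y Z : (I → Ω₀) → ℝ} (hY : IsDiscrete Y)
    (hZ : IsDiscrete Z) : IsDiscrete (fun ω => φ (Y ω) (Z ω)) := by
  classical
  obtain ⟨s, k, κ, g, hκ, rfl⟩ := hY
  obtain ⟨s', k', κ', g', hκ', rfl⟩ := hZ
  -- Common refinement: both sets of sites and the product of the two partitions.
  refine ⟨s ∪ s', k * k', fun a => finProdFinEquiv (κ a, κ' a),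
    fun x => φ (g fun i => (finProdFinEquiv.symm (x ⟨i, Finset.mem_union_left _ i.2⟩)).1)
      (g' fun i => (finProdFinEquiv.symm (x ⟨i, Finset.mem_union_right _ i.2⟩)).2), ?_, ?_⟩
  · exact (measurable_of_finite _).comp (hκ.prodMk hκ')
  · ext ω
    simp [quant]
    rfl

lemma isDiscrete_const (c : ℝ) : IsDiscrete (fun _ : I → Ω₀ => c) :=
  ⟨∅, 1, fun _ => 0, fun _ => c, measurable_const, rfl⟩

lemma isDiscrete_indicator_eval (i : I) {A : Set Ω₀} (hA : MeasurableSet A) :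
    IsDiscrete (Set.indicator {ω : I → Ω₀ | ω i ∈ A} 1) := by
  classical
  refine ⟨{i}, 2, fun a => if a ∈ A then 1 else 0,
    fun x => if x ⟨i, Finset.mem_singleton_self i⟩ = 1 then 1 else 0, ?_, ?_⟩
  · exact Measurable.ite hA measurable_const measurable_const
  · ext ω
    by_cases h : ω i ∈ A <;> simp [quant, Set.indicator, h]

/-- A ring that generates the product σ-algebra approximates every measurable set in measure, which
is what L¹ density requires. -/
lemma isSetRing_isDiscrete :
    IsSetRing {A : Set (I → Ω₀) | IsDiscrete (A.indicator (1 : (I → Ω₀) → ℝ))} where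
  empty_mem := by simpa using isDiscrete_const (I := I) (Ω₀ := Ω₀) 0
  union_mem A B hA hB := by
    have := IsDiscrete.map₂ (fun a b => a + b - a * b) hA hB
    refine (congrArg IsDiscrete ?_).mp this
    ext ω
    by_cases h : ω ∈ A <;> by_cases h' : ω ∈ B <;> simp [Set.indicator, h, h']
  sdiff_mem A B hA hB := by
    have := IsDiscrete.map₂ (fun a b => a - a * b) hA hB
    refine (congrArg IsDiscrete ?_).mp this
    ext ω
    by_cases h : ω ∈ A <;> by_cases h' : ω ∈ B <;> simp [Set.indicator, h, h']

lemma generateFrom_isDiscrete :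
    (MeasurableSpace.pi : MeasurableSpace (I → Ω₀))
      = MeasurableSpace.generateFrom {A | IsDiscrete (A.indicator (1 : (I → Ω₀) → ℝ))} := by
  refine le_antisymm ?_ (MeasurableSpace.generateFrom_le fun A hA => ?_)
  · refine iSup_le fun i => ?_
    rintro _ ⟨A, hA, rfl⟩
    exact MeasurableSpace.measurableSet_generateFrom (isDiscrete_indicator_eval i hA)
  · have hm : Measurable (A.indicator (1 : (I → Ω₀) → ℝ)) := IsDiscrete.measurable hA
    have : A = A.indicator (1 : (I → Ω₀) → ℝ) ⁻¹' {1} := by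
      ext ω
      by_cases h : ω ∈ A <;> simp [Set.indicator, h]
    rw [this]
    exact hm (measurableSet_singleton 1)

/-- Functions of finitely many discretized coordinates are dense in `L¹`. -/
lemma exists_isDiscrete_eLpNorm_sub_le (μ : Measure (I → Ω₀)) [IsFiniteMeasure μ]
    {X : (I → Ω₀) → ℝ} (hX : Integrable X μ) {ε : ℝ≥0∞} (hε : ε ≠ 0) :
    ∃ Y, eLpNorm (X - Y) 1 μ ≤ ε ∧ IsDiscrete Y := by
  refine MemLp.induction_dense ENNReal.one_ne_top IsDiscrete ?_ ?_ ?_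
    (memLp_one_iff_integrable.2 hX) hε
  · intro c A hA _ ε hε
    obtain ⟨η, hη, hηε⟩ : ∃ η : ℝ≥0∞, 0 < η ∧ ‖c‖ₑ * η ≤ ε := by
      refine ⟨ε / (‖c‖ₑ + 1), ENNReal.div_pos hε (by finiteness), ?_⟩
      calc ‖c‖ₑ * (ε / (‖c‖ₑ + 1)) ≤ (‖c‖ₑ + 1) * (ε / (‖c‖ₑ + 1)) := by gcongr; simp
        _ ≤ ε := ENNReal.mul_div_le
    obtain ⟨B, hB, hBA⟩ := exists_measure_symmDiff_lt_of_generateFrom_isSetRing (μ := μ)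
      isSetRing_isDiscrete ⟨{Set.univ}, Set.countable_singleton _, by
        simp only [Set.singleton_subset_iff, Set.mem_ofPred_eq, Set.indicator_univ]
        exact isDiscrete_const 1, by simp⟩
      generateFrom_isDiscrete hA hη
    have hBm : MeasurableSet B := by
      rw [generateFrom_isDiscrete]; exact MeasurableSpace.measurableSet_generateFrom hB
    refine ⟨B.indicator fun _ => c, ?_, ?_⟩
    · rw [eLpNorm_one_eq_lintegral_enorm]
      calc ∫⁻ ω, ‖(B.indicator (fun _ => c) - A.indicator fun _ => c) ω‖ₑ ∂μ
          ≤ ∫⁻ ω, (symmDiff B A).indicator (fun _ => ‖c‖ₑ) ω ∂μ := by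
            refine lintegral_mono fun ω => ?_
            by_cases h : ω ∈ A <;> by_cases h' : ω ∈ B <;>
              simp [Set.indicator, h, h', Set.mem_symmDiff]
        _ = ‖c‖ₑ * μ (symmDiff B A) := by
            rw [lintegral_indicator (hBm.symmDiff hA)]; simp
        _ ≤ ‖c‖ₑ * η := by gcongr
        _ ≤ ε := hηε
    · have := IsDiscrete.map₂ (fun a _ => c * a) hB hB
      refine (congrArg IsDiscrete ?_).mp this
      ext ω
      by_cases h : ω ∈ B <;> simp [Set.indicator, h]
  · intro f g hf hg
    exact IsDiscrete.map₂ (· + ·) hf hg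
  · intro f hf
    exact hf.measurable.aestronglyMeasurable

end Discretization

end NoiseSemigroup

namespace NoiseSemigroup

open Function

/-! ### Cell means and their square function -/

section Cells

variable {I Ω₀ : Type*} [DecidableEq I] [MeasurableSpace Ω₀]

/-- The law of a discretized coordinate. -/
noncomputable def cellWeight (P₀ : Measure Ω₀) {k : ℕ} (κ : Ω₀ → Fin k) (c : Fin k) : ℝ :=
  P₀.real (κ ⁻¹' {c})

lemma sum_setIntegral_preimage {Ω T : Type*} [MeasurableSpace Ω] [Fintype T] [MeasurableSpace T]
    [MeasurableSingletonClass T] {μ : Measure Ω} {π : Ω → T} (hπ : Measurable π) {X : Ω → ℝ}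
    (hX : Integrable X μ) : ∑ a, ∫ ω in π ⁻¹' {a}, X ω ∂μ = ∫ ω, X ω ∂μ := by
  rw [← integral_iUnion_fintype (fun a => hπ (measurableSet_singleton a)) ?_
    (fun a => hX.integrableOn)]
  · rw [← Set.preimage_iUnion, Set.iUnion_of_singleton, Set.preimage_univ,
      Measure.restrict_univ]
  · intro a b hab
    exact Disjoint.preimage _ (Set.disjoint_singleton.2 hab)

lemma sum_setLIntegral_preimage {Ω T : Type*} [MeasurableSpace Ω] [Fintype T]
    [MeasurableSpace T] [MeasurableSingletonClass T] {μ : Measure Ω} {π : Ω → T}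
    (hπ : Measurable π) (f : Ω → ℝ≥0∞) :
    ∑ a, ∫⁻ ω in π ⁻¹' {a}, f ω ∂μ = ∫⁻ ω, f ω ∂μ := by
  rw [← tsum_fintype (L := SummationFilter.unconditional _), ← lintegral_iUnion (fun a => hπ (measurableSet_singleton a)) ?_]
  · rw [← Set.preimage_iUnion, Set.iUnion_of_singleton, Set.preimage_univ,
      Measure.restrict_univ]
  · intro a b hab
    exact Disjoint.preimage _ (Set.disjoint_singleton.2 hab)

lemma ofReal_integral_le {Ω : Type*} [MeasurableSpace Ω] {μ : Measure Ω} {g : Ω → ℝ}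
    (hg : Integrable g μ) : ENNReal.ofReal (∫ ω, g ω ∂μ) ≤ ∫⁻ ω, ENNReal.ofReal (g ω) ∂μ := by
  rw [integral_eq_lintegral_pos_part_sub_lintegral_neg_part hg]
  exact (ENNReal.ofReal_le_ofReal (sub_le_self _ ENNReal.toReal_nonneg)).trans
    ENNReal.ofReal_toReal_le

variable (P₀ : Measure Ω₀) [IsProbabilityMeasure P₀] (s : Finset I) {k : ℕ} {κ : Ω₀ → Fin k}

lemma isWeight_cellWeight (hκ : Measurable κ) : IsWeight (cellWeight P₀ κ) where
  nonneg _ := measureReal_nonneg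
  sum_eq_one := by
    have := sum_setIntegral_preimage (μ := P₀) hκ (integrable_const (1 : ℝ))
    simpa [cellWeight] using this

lemma measureReal_quant_preimage (hκ : Measurable κ) (a : s → Fin k) :
    (Measure.infinitePi fun _ : I => P₀).real (quant s κ ⁻¹' {a})
      = ∏ i, cellWeight P₀ κ (a i) := by
  classical
  set t : I → Set Ω₀ := fun i => if h : i ∈ s then κ ⁻¹' {a ⟨i, h⟩} else Set.univ with ht
  have e : quant s κ ⁻¹' {a} = Set.pi s t := by
    ext ω
    simp only [Set.mem_preimage, Set.mem_singleton_iff, Set.mem_pi, Finset.mem_coe, ht]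
    constructor
    · intro h i hi
      simp only [hi, dif_pos, Set.mem_preimage, Set.mem_singleton_iff]
      rw [← h]; rfl
    · intro h
      ext i
      have := h i i.2
      simp only [i.2, dif_pos, Set.mem_preimage, Set.mem_singleton_iff] at this
      simp [quant, this]
  rw [e, measureReal_def, Measure.infinitePi_pi, ENNReal.toReal_prod, ← Finset.prod_attach]
  · refine Finset.prod_congr rfl fun i _ => ?_
    simp [ht, cellWeight, measureReal_def]
  · intro i hi
    simp only [ht, hi, dif_pos]
    exact hκ (measurableSet_singleton _)

lemma mean_cellWeight (hκ : Measurable κ) (u : (s → Fin k) → ℝ) :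
    mean (cellWeight P₀ κ) u
      = ∫ ω, u (quant s κ ω) ∂(Measure.infinitePi fun _ : I => P₀) := by
  classical
  have hm := measurable_quant (I := I) s hκ
  have hu : Measurable u := measurable_of_finite u
  have hint : Integrable (fun ω => u (quant s κ ω)) (Measure.infinitePi fun _ : I => P₀) :=
    (Integrable.of_finite (f := u)).comp_measurable hm
  rw [← sum_setIntegral_preimage hm hint, mean]
  refine Finset.sum_congr rfl fun a _ => ?_
  rw [← measureReal_quant_preimage P₀ s hκ]
  rw [setIntegral_congr_fun (hm (measurableSet_singleton a))
    (g := fun _ => u a) (fun ω hω => by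
      have : quant s κ ω = a := hω
      simp only [this])]
  simp

/-- The conditional mean of `X` on the cells of the discretization. -/
noncomputable def cellMean (κ : Ω₀ → Fin k) (X : (I → Ω₀) → ℝ) (a : s → Fin k) : ℝ :=
  (∫ ω in quant s κ ⁻¹' {a}, X ω ∂(Measure.infinitePi fun _ : I => P₀))
    / (Measure.infinitePi fun _ : I => P₀).real (quant s κ ⁻¹' {a})

variable {X : (I → Ω₀) → ℝ}

lemma measureReal_mul_cellMean (a : s → Fin k) :
    (Measure.infinitePi fun _ : I => P₀).real (quant s κ ⁻¹' {a}) * cellMean P₀ s κ X a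
      = ∫ ω in quant s κ ⁻¹' {a}, X ω ∂(Measure.infinitePi fun _ : I => P₀) := by
  by_cases h : (Measure.infinitePi fun _ : I => P₀).real (quant s κ ⁻¹' {a}) = 0
  · rw [h, zero_mul]
    rw [measureReal_eq_zero_iff] at h
    rw [Measure.restrict_eq_zero.2 h, integral_zero_measure]
  · rw [cellMean]; field_simp

lemma mean_cellMean (hκ : Measurable κ) (hX : Integrable X (Measure.infinitePi fun _ : I => P₀)) :
    mean (cellWeight P₀ κ) (cellMean P₀ s κ X)
      = ∫ ω, X ω ∂(Measure.infinitePi fun _ : I => P₀) := by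
  rw [← sum_setIntegral_preimage (measurable_quant (I := I) s hκ) hX, mean]
  refine Finset.sum_congr rfl fun a _ => ?_
  rw [← measureReal_quant_preimage P₀ s hκ, measureReal_mul_cellMean]

lemma indep_comap_cylinderEvents (i : I) :
    ProbabilityTheory.Indep (MeasurableSpace.comap (fun ω : I → Ω₀ => ω i) inferInstance)
      (cylinderEvents (X := fun _ : I => Ω₀) {i}ᶜ) (Measure.infinitePi fun _ : I => P₀) := by
  have h := ProbabilityTheory.iIndepFun_infinitePi (ι := I) (Ω := fun _ => Ω₀)
    (P := fun _ => P₀) (X := fun _ x => x) (fun _ => measurable_id)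
  have h2 := ProbabilityTheory.indep_iSup_of_disjoint
    (m := fun j => MeasurableSpace.comap (fun ω : I → Ω₀ => ω j) inferInstance)
    (fun j => (measurable_pi_apply j).comap_le) h.iIndep
    (S := {i}) (T := {i}ᶜ) disjoint_compl_right
  simpa [cylinderEvents] using h2

/-- The cell is C ∩ B, with C a condition on the coordinate i and B one on the others. As X'_i is
independent of C, the integral is μ(C) ∫_B X' = μ(C) ∫_B X, and B is the union of the cells with the
letter at i changed. -/
lemma setIntegral_condExp_cell (hκ : Measurable κ)
    (hX : Integrable X (Measure.infinitePi fun _ : I => P₀)) (a : s → Fin k) (i : s) :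
    ∫ ω in quant s κ ⁻¹' {a},
      condExp (cylinderEvents (X := fun _ : I => Ω₀) {(i : I)}ᶜ)
        (Measure.infinitePi fun _ : I => P₀) X ω ∂(Measure.infinitePi fun _ : I => P₀)
      = (Measure.infinitePi fun _ : I => P₀).real (quant s κ ⁻¹' {a})
        * avg (cellWeight P₀ κ) i (cellMean P₀ s κ X) a := by
  set μ := Measure.infinitePi fun _ : I => P₀ with hμ
  set X' := condExp (cylinderEvents (X := fun _ : I => Ω₀) {(i : I)}ᶜ) μ X with hX'
  have hmle : (cylinderEvents (X := fun _ : I => Ω₀) {(i : I)}ᶜ) ≤ MeasurableSpace.pi := cylinderEvents_le_pi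
  set B : Set (I → Ω₀) := {ω | ∀ j : s, j ≠ i → κ (ω j) = a j} with hB
  set C : Set (I → Ω₀) := {ω | κ (ω i) = a i} with hC
  have hBm : MeasurableSet[(cylinderEvents (X := fun _ : I => Ω₀) {(i : I)}ᶜ)] B := by
    have : B = ⋂ j : s, {ω | j ≠ i → κ (ω j) = a j} := by ext; simp [hB]
    rw [this]
    refine MeasurableSet.iInter fun j => ?_
    by_cases hj : j = i
    · rw [show {ω : I → Ω₀ | j ≠ i → κ (ω j) = a j} = Set.univ from
        Set.eq_univ_of_forall fun ω h => (h hj).elim]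
      exact MeasurableSet.univ
    · have hj' : (j : I) ∈ ({(i : I)}ᶜ : Set I) :=
        fun h => hj (Subtype.ext h)
      have := hκ.comp (measurable_cylinderEvent_apply (X := fun _ : I => Ω₀) hj')
      simp only [hj, ne_eq, not_false_eq_true, true_imp_iff]
      exact this (measurableSet_singleton (a j))
  have hCm : MeasurableSet[MeasurableSpace.comap (fun ω : I → Ω₀ => ω i) inferInstance] C :=
    ⟨κ ⁻¹' {a i}, hκ (measurableSet_singleton _), rfl⟩
  have hCm' : MeasurableSet C := (measurable_pi_apply (i : I)).comap_le _ hCm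
  have hBm' : MeasurableSet B := hmle _ hBm
  have hcell : quant s κ ⁻¹' {a} = C ∩ B := by
    ext ω
    simp only [Set.mem_preimage, Set.mem_singleton_iff, hB, hC, Set.mem_inter_iff,
      Set.mem_ofPred_eq, funext_iff, quant]
    constructor
    · exact fun h => ⟨h i, fun j _ => h j⟩
    · rintro ⟨h1, h2⟩ j
      by_cases hj : j = i
      · rw [hj]; exact h1
      · exact h2 j hj
  have hXint : Integrable X' μ := integrable_condExp
  have hind : ProbabilityTheory.IndepFun (C.indicator (1 : (I → Ω₀) → ℝ)) (B.indicator X') μ := by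
    refine ProbabilityTheory.indep_of_indep_of_le_left
      (ProbabilityTheory.indep_of_indep_of_le_right (indep_comap_cylinderEvents P₀ (i : I)) ?_) ?_
    · exact (Measurable.indicator stronglyMeasurable_condExp.measurable hBm).comap_le
    · exact (Measurable.indicator measurable_const hCm).comap_le
  have hprod : ∫ ω in C ∩ B, X' ω ∂μ = μ.real C * ∫ ω in B, X' ω ∂μ := by
    have := hind.integral_mul_eq_mul_integral
      ((measurable_const.indicator hCm').aestronglyMeasurable)
      ((hXint.indicator hBm').aestronglyMeasurable)
    rw [integral_indicator hBm', integral_indicator_one hCm'] at this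
    rw [← this, ← integral_indicator (hCm'.inter hBm')]
    congr 1
    ext ω
    by_cases h : ω ∈ C <;> by_cases h' : ω ∈ B <;> simp [Set.indicator, h, h']
  have hCw : μ.real C = cellWeight P₀ κ (a i) := by
    have := Measure.infinitePi_map_eval (fun _ : I => P₀) (i : I)
    have h2 := congrArg (fun ν => ν (κ ⁻¹' {a i})) this
    rw [Measure.map_apply (measurable_pi_apply _) (hκ (measurableSet_singleton _))] at h2
    rw [cellWeight, measureReal_def, measureReal_def, ← h2]
    rfl
  have hBX : ∫ ω in B, X ω ∂μ = ∑ z, ∫ ω in quant s κ ⁻¹' {update a i z}, X ω ∂μ := by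
    have hBU : B = ⋃ z, quant s κ ⁻¹' {update a i z} := by
      ext ω
      simp only [hB, Set.mem_ofPred_eq, Set.mem_iUnion, Set.mem_preimage, Set.mem_singleton_iff,
        funext_iff, quant]
      constructor
      · intro h
        refine ⟨κ (ω i), fun j => ?_⟩
        by_cases hj : j = i
        · subst hj; simp
        · simp [hj, h j hj]
      · rintro ⟨z, h⟩ j hj
        simpa [hj] using h j
    rw [hBU, integral_iUnion_fintype
      (fun z => measurable_quant s hκ (measurableSet_singleton _)) ?_ (fun z => hX.integrableOn)]
    intro z z' hz
    refine Disjoint.preimage _ (Set.disjoint_singleton.2 fun h => hz ?_)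
    have := congrFun h i
    simpa using this
  rw [hcell, hprod, setIntegral_condExp hmle hX hBm, hBX, hCw, ← hcell, avg, Finset.mul_sum,
    Finset.mul_sum]
  refine Finset.sum_congr rfl fun z _ => ?_
  rw [← measureReal_mul_cellMean, ← hμ, hμ, measureReal_quant_preimage P₀ s hκ,
    measureReal_quant_preimage P₀ s hκ, ← Finset.mul_prod_erase _ _ (Finset.mem_univ i),
    ← Finset.mul_prod_erase Finset.univ (fun j => cellWeight P₀ κ (a j)) (Finset.mem_univ i)]
  have e : ∏ j ∈ Finset.univ.erase i, cellWeight P₀ κ (update a i z j)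
      = ∏ j ∈ Finset.univ.erase i, cellWeight P₀ κ (a j) :=
    Finset.prod_congr rfl fun j hj => by rw [update_of_ne (Finset.ne_of_mem_erase hj)]
  rw [e, update_self]
  ring

/-- The square function of the cell means is controlled by that of `X`. -/
lemma ofReal_mul_sq_cellMean_le (hκ : Measurable κ)
    (hX : Integrable X (Measure.infinitePi fun _ : I => P₀)) (a : s → Fin k) (i : s) :
    ENNReal.ofReal ((Measure.infinitePi fun _ : I => P₀).real (quant s κ ⁻¹' {a})
      * (cellMean P₀ s κ X a - avg (cellWeight P₀ κ) i (cellMean P₀ s κ X) a) ^ 2)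
      ≤ ∫⁻ ω in quant s κ ⁻¹' {a}, ENNReal.ofReal ((X ω -
        condExp (cylinderEvents (X := fun _ : I => Ω₀) {(i : I)}ᶜ)
        (Measure.infinitePi fun _ : I => P₀) X ω) ^ 2) ∂(Measure.infinitePi fun _ : I => P₀) := by
  set D := cellMean P₀ s κ X a - avg (cellWeight P₀ κ) i (cellMean P₀ s κ X) a with hD
  have h1 := setIntegral_condExp_cell P₀ s hκ hX a i
  have h2 := measureReal_mul_cellMean P₀ s (κ := κ) (X := X) a
  set μ := Measure.infinitePi fun _ : I => P₀ with hμ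
  set X' := condExp (cylinderEvents (X := fun _ : I => Ω₀) {(i : I)}ᶜ) μ X with hX'
  have hint : Integrable (fun ω => X ω - X' ω) (μ.restrict (quant s κ ⁻¹' {a})) :=
    (hX.sub integrable_condExp).integrableOn
  -- Jensen through the tangent 2 D y - D² ≤ y²: only X - X' has to be integrable, not its square.
  have hint2 : Integrable (fun ω => 2 * D * (X ω - X' ω) - D ^ 2)
      (μ.restrict (quant s κ ⁻¹' {a})) :=
    (hint.const_mul _).sub (integrable_const _)
  have e : ∫ ω in quant s κ ⁻¹' {a}, (2 * D * (X ω - X' ω) - D ^ 2) ∂μ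
      = μ.real (quant s κ ⁻¹' {a}) * D ^ 2 := by
    rw [integral_sub (hint.const_mul _) (integrable_const _), integral_const_mul,
      integral_sub hX.integrableOn integrable_condExp.integrableOn, h1, ← h2]
    simp only [integral_const, measureReal_restrict_apply_univ, smul_eq_mul]
    rw [hD]
    ring
  rw [← e]
  refine (ofReal_integral_le hint2).trans (lintegral_mono fun ω => ?_)
  refine ENNReal.ofReal_le_ofReal ?_
  nlinarith [sq_nonneg (X ω - X' ω - D)]

/-- The `[0, ∞]`-valued square function. -/
noncomputable def squareFn (X : (I → Ω₀) → ℝ) (ω : I → Ω₀) : ℝ≥0∞ :=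
  ∑' z : I, ENNReal.ofReal ((X ω - condExp (cylinderEvents (X := fun _ : I => Ω₀) {z}ᶜ)
    (Measure.infinitePi fun _ : I => P₀) X ω) ^ 2)

/-- ρ is constant on cells, so the one-cell estimate is summed over cells and over the sites of `s`;
the other terms of the square function are dropped. -/
lemma ofReal_mean_sq_mul_le (hκ : Measurable κ)
    (hX : Integrable X (Measure.infinitePi fun _ : I => P₀)) {ρ : (s → Fin k) → ℝ}
    (hρ : ∀ a, 0 ≤ ρ a) :
    ENNReal.ofReal (mean (cellWeight P₀ κ) (fun a => (∑ i, (cellMean P₀ s κ X a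
      - avg (cellWeight P₀ κ) i (cellMean P₀ s κ X) a) ^ 2) * ρ a))
      ≤ ∫⁻ ω, ENNReal.ofReal (ρ (quant s κ ω)) * squareFn P₀ X ω
        ∂(Measure.infinitePi fun _ : I => P₀) := by
  have hm := measurable_quant (I := I) s hκ
  rw [← sum_setLIntegral_preimage hm, mean, ENNReal.ofReal_sum_of_nonneg]
  · refine Finset.sum_le_sum fun a _ => ?_
    have e1 : ∫⁻ ω in quant s κ ⁻¹' {a}, ENNReal.ofReal (ρ (quant s κ ω)) * squareFn P₀ X ω
        ∂(Measure.infinitePi fun _ : I => P₀)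
        = ENNReal.ofReal (ρ a) * ∫⁻ ω in quant s κ ⁻¹' {a}, squareFn P₀ X ω
        ∂(Measure.infinitePi fun _ : I => P₀) := by
      rw [← lintegral_const_mul' _ _ ENNReal.ofReal_ne_top]
      refine setLIntegral_congr_fun (hm (measurableSet_singleton a)) fun ω hω => ?_
      have : quant s κ ω = a := hω
      simp only [this]
    rw [e1, ← measureReal_quant_preimage P₀ s hκ, ← mul_assoc, mul_comm,
      ENNReal.ofReal_mul (hρ a)]
    gcongr
    rw [Finset.mul_sum, ENNReal.ofReal_sum_of_nonneg
      (fun i _ => mul_nonneg measureReal_nonneg (sq_nonneg _))]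
    refine (Finset.sum_le_sum fun i _ => ofReal_mul_sq_cellMean_le P₀ s hκ hX a i).trans ?_
    rw [← lintegral_finsetSum']
    · refine lintegral_mono fun ω => ?_
      rw [squareFn]
      have := Finset.sum_coe_sort s (fun z : I => ENNReal.ofReal ((X ω -
        condExp (cylinderEvents (X := fun _ : I => Ω₀) {z}ᶜ)
          (Measure.infinitePi fun _ : I => P₀) X ω) ^ 2))
      rw [this]
      exact ENNReal.sum_le_tsum s
    · intro i _
      exact ((hX.aemeasurable.sub integrable_condExp.aemeasurable).pow_const 2).ennreal_ofReal.restrict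
  · intro a _
    exact mul_nonneg (Finset.prod_nonneg fun _ _ => measureReal_nonneg)
      (mul_nonneg (Finset.sum_nonneg fun _ _ => sq_nonneg _) (hρ a))

/-- Where the square function is at most M, use that ρ has mass at most 1; elsewhere use ρ ≤ R. -/
lemma lintegral_density_mul_le [Countable I] (hκ : Measurable κ) (hXm : Measurable X)
    {ρ : (s → Fin k) → ℝ} (hρ : ∀ a, 0 ≤ ρ a) {R : ℝ} (hR : ∀ a, ρ a ≤ R)
    (hρ1 : mean (cellWeight P₀ κ) ρ ≤ 1) (M : ℝ≥0∞) :
    ∫⁻ ω, ENNReal.ofReal (ρ (quant s κ ω)) * squareFn P₀ X ω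
        ∂(Measure.infinitePi fun _ : I => P₀)
      ≤ M + ENNReal.ofReal R * ∫⁻ ω, {ω | M < squareFn P₀ X ω}.indicator (squareFn P₀ X) ω
        ∂(Measure.infinitePi fun _ : I => P₀) := by
  have hm := measurable_quant (I := I) s hκ
  have hρm : Measurable fun ω : I → Ω₀ => ENNReal.ofReal (ρ (quant s κ ω)) :=
    ((measurable_of_finite ρ).comp hm).ennreal_ofReal
  have hint : Integrable (fun ω => ρ (quant s κ ω)) (Measure.infinitePi fun _ : I => P₀) :=
    (Integrable.of_finite (f := ρ)).comp_measurable hm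
  have h1 : ∫⁻ ω, ENNReal.ofReal (ρ (quant s κ ω)) ∂(Measure.infinitePi fun _ : I => P₀) ≤ 1 := by
    rw [← ofReal_integral_eq_lintegral_ofReal hint (Filter.Eventually.of_forall fun ω => hρ _),
      ← mean_cellWeight P₀ s hκ]
    exact ENNReal.ofReal_le_one.2 hρ1
  calc _ ≤ ∫⁻ ω, (M * ENNReal.ofReal (ρ (quant s κ ω)) + ENNReal.ofReal R *
        {ω | M < squareFn P₀ X ω}.indicator (squareFn P₀ X) ω)
          ∂(Measure.infinitePi fun _ : I => P₀) := by
        refine lintegral_mono fun ω => ?_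
        by_cases h : M < squareFn P₀ X ω
        · rw [Set.indicator_of_mem (show ω ∈ {ω | M < squareFn P₀ X ω} from h)]
          refine le_trans ?_ le_add_self
          gcongr
          exact hR _
        · rw [Set.indicator_of_notMem (show ω ∉ {ω | M < squareFn P₀ X ω} from h)]
          rw [mul_zero, add_zero, mul_comm]
          gcongr
          exact not_lt.1 h
    _ = M * ∫⁻ ω, ENNReal.ofReal (ρ (quant s κ ω)) ∂(Measure.infinitePi fun _ : I => P₀)
        + ENNReal.ofReal R * ∫⁻ ω, {ω | M < squareFn P₀ X ω}.indicator (squareFn P₀ X) ω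
          ∂(Measure.infinitePi fun _ : I => P₀) := by
        rw [lintegral_add_left (hρm.const_mul _), lintegral_const_mul _ hρm,
          lintegral_const_mul' _ _ ENNReal.ofReal_ne_top]
    _ ≤ _ := by
        gcongr
        exact mul_le_of_le_one_right' h1

/-- The deviation inequality for the cell means of `X`. -/
lemma cellMean_deviation_le [Countable I] (hκ : Measurable κ) (hXm : Measurable X)
    (hX : Integrable X (Measure.infinitePi fun _ : I => P₀)) {t p v : ℝ} (ht : 0 < t)
    (hp : 0 ≤ p) (hv0 : 0 < v) {M : ℝ≥0∞}
    (hA : (Measure.infinitePi fun _ : I => P₀).real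
      {ω | (∫ ω, X ω ∂(Measure.infinitePi fun _ : I => P₀)) + t
        ≤ cellMean P₀ s κ X (quant s κ ω)} = Real.exp (-p))
    (hv : M + ENNReal.ofReal (Real.exp (2 * p + 5)) *
      ∫⁻ ω, {ω | M < squareFn P₀ X ω}.indicator (squareFn P₀ X) ω
        ∂(Measure.infinitePi fun _ : I => P₀) ≤ ENNReal.ofReal v) :
    t ≤ 100 * √((p + 1) * v) := by
  classical
  refine deviation_le (isWeight_cellWeight P₀ hκ) (cellMean P₀ s κ X) ht hp hv0 ?_ ?_
  · rw [mean_cellMean P₀ s hκ hX, mean_cellWeight P₀ s hκ, ← hA]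
    rw [← integral_indicator_one]
    · rfl
    · exact measurableSet_le measurable_const
        ((measurable_of_finite (cellMean P₀ s κ X)).comp (measurable_quant s hκ))
  · intro ρ h0 h1 h2
    rw [← ENNReal.ofReal_le_ofReal_iff hv0.le]
    exact (ofReal_mean_sq_mul_le P₀ s hκ hX h0).trans
      ((lintegral_density_mul_le P₀ s hκ hXm h0 h1 h2 M).trans hv)

/-- The cell means approximate `X` as well as any function of the discretization, up to a
factor `2`. -/
lemma lintegral_sub_cellMean_le (hκ : Measurable κ)
    (hX : Integrable X (Measure.infinitePi fun _ : I => P₀)) (g : (s → Fin k) → ℝ) :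
    ∫⁻ ω, ‖X ω - cellMean P₀ s κ X (quant s κ ω)‖ₑ ∂(Measure.infinitePi fun _ : I => P₀)
      ≤ 2 * ∫⁻ ω, ‖X ω - g (quant s κ ω)‖ₑ ∂(Measure.infinitePi fun _ : I => P₀) := by
  set μ := Measure.infinitePi fun _ : I => P₀ with hμ
  have hm := measurable_quant (I := I) s hκ
  -- On a cell, the difference of g and the cell mean, times the mass of the cell, is the integral
  -- of g - X.
  have h1 : ∫⁻ ω, ‖g (quant s κ ω) - cellMean P₀ s κ X (quant s κ ω)‖ₑ ∂μ
      ≤ ∫⁻ ω, ‖X ω - g (quant s κ ω)‖ₑ ∂μ := by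
    rw [← sum_setLIntegral_preimage hm, ← sum_setLIntegral_preimage (μ := μ) hm
      (fun ω => ‖X ω - g (quant s κ ω)‖ₑ)]
    refine Finset.sum_le_sum fun a _ => ?_
    have hms := hm (measurableSet_singleton a)
    rw [setLIntegral_congr_fun (g := fun _ => ‖g a - cellMean P₀ s κ X a‖ₑ) hms (fun ω hω => by
        have : quant s κ ω = a := hω
        simp only [this]),
      setLIntegral_congr_fun (f := fun ω => ‖X ω - g (quant s κ ω)‖ₑ)
        (g := fun ω => ‖X ω - g a‖ₑ) hms (fun ω hω => by
        have : quant s κ ω = a := hω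
        simp only [this])]
    refine le_trans (le_of_eq ?_) (enorm_integral_le_lintegral_enorm _)
    have e : ∫ ω in quant s κ ⁻¹' {a}, (X ω - g a) ∂μ
        = (cellMean P₀ s κ X a - g a) * μ.real (quant s κ ⁻¹' {a}) := by
      rw [integral_sub hX.integrableOn (integrable_const _), ← measureReal_mul_cellMean]
      simp only [integral_const, measureReal_restrict_apply_univ, smul_eq_mul]
      ring
    rw [e, enorm_mul, lintegral_const, Measure.restrict_apply_univ, enorm_sub_rev]
    congr 1
    rw [Real.enorm_of_nonneg measureReal_nonneg, ofReal_measureReal]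
  have hXa : AEMeasurable (fun ω => ‖X ω - g (quant s κ ω)‖ₑ) μ :=
    (hX.aemeasurable.sub ((measurable_of_finite g).comp hm).aemeasurable).enorm
  calc _ ≤ ∫⁻ ω, (‖X ω - g (quant s κ ω)‖ₑ
        + ‖g (quant s κ ω) - cellMean P₀ s κ X (quant s κ ω)‖ₑ) ∂μ := by
        refine lintegral_mono fun ω => ?_
        refine le_trans (le_of_eq ?_) (enorm_add_le _ _)
        congr 1; ring
    _ = _ + _ := lintegral_add_left' hXa _
    _ ≤ _ := by rw [two_mul]; gcongr

end Cells

end NoiseSemigroup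

namespace NoiseSemigroup

/-! ### From the exponential moment of the square function to tails of X -/

section Tail

/-- `exp (u ^ a)` with values in `[0, ∞]`. -/
noncomputable def expRpow (a : ℝ) (u : ℝ≥0∞) : ℝ≥0∞ := EReal.exp ((u ^ a : ℝ≥0∞) : EReal)

lemma expRpow_ofReal {a x : ℝ} (ha : 0 ≤ a) (hx : 0 ≤ x) :
    expRpow a (ENNReal.ofReal x) = ENNReal.ofReal (Real.exp (x ^ a)) := by
  rw [expRpow, ENNReal.ofReal_rpow_of_nonneg hx ha, EReal.coe_ennreal_ofReal,
    max_eq_left (Real.rpow_nonneg hx a), EReal.exp_coe]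

lemma expRpow_top {a : ℝ} (ha : 0 < a) : expRpow a ∞ = ∞ := by
  simp [expRpow, ENNReal.top_rpow_of_pos ha]

lemma one_le_expRpow (a : ℝ) (u : ℝ≥0∞) : 1 ≤ expRpow a u := by
  rw [← EReal.exp_zero]
  exact EReal.exp_monotone (EReal.coe_ennreal_nonneg _)

/-- For x = u^a and r = 1/a, raise x / (2 r) ≤ exp(x / (2 r)) to the power r. -/
lemma exists_le_mul_exp_rpow {a : ℝ} (ha : 0 < a) :
    ∃ c : ℝ, 0 < c ∧ ∀ u : ℝ, 0 ≤ u → u ≤ c * Real.exp (u ^ a / 2) := by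
  set r := a⁻¹ with hr
  have hr0 : 0 < r := inv_pos.2 ha
  refine ⟨(2 * r) ^ r, by positivity, fun u hu => ?_⟩
  set x := u ^ a with hx
  have hx0 : 0 ≤ x := Real.rpow_nonneg hu a
  have hux : u = x ^ r := by rw [hx, hr, Real.rpow_rpow_inv hu ha.ne']
  have h1 : x / (2 * r) ≤ Real.exp (x / (2 * r)) := by
    linarith [Real.add_one_le_exp (x / (2 * r))]
  have h2 := Real.rpow_le_rpow (by positivity) h1 hr0.le
  rw [← Real.exp_mul, Real.div_rpow hx0 (by positivity), div_le_iff₀ (by positivity)] at h2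
  rw [hux, mul_comm]
  refine h2.trans (le_of_eq ?_)
  congr 2
  field_simp

/-- The truncated first moment is small compared to the exponential moment. -/
lemma mul_lintegral_indicator_le {Ω : Type*} [MeasurableSpace Ω] {μ : Measure Ω}
    {V : Ω → ℝ≥0∞} {a c : ℝ} (ha : 0 < a) (hc0 : 0 < c)
    (hc : ∀ u : ℝ, 0 ≤ u → u ≤ c * Real.exp (u ^ a / 2)) {C A y M : ℝ} (hC : 0 < C) (hA : 0 < A)
    (hM0 : 0 ≤ M) (hM : 2 * (y + Real.log A) ≤ M ^ a)
    (hV : ∫⁻ ω, expRpow a (ENNReal.ofReal C * V ω) ∂μ ≤ ENNReal.ofReal A) :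
    ENNReal.ofReal (Real.exp y) *
      ∫⁻ ω, {ω | ENNReal.ofReal (M / C) < V ω}.indicator V ω ∂μ ≤ ENNReal.ofReal (c / C) := by
  have hpt : ∀ ω, {ω | ENNReal.ofReal (M / C) < V ω}.indicator V ω
      ≤ ENNReal.ofReal (c / C * (Real.exp (-y) * A⁻¹))
        * expRpow a (ENNReal.ofReal C * V ω) := by
    intro ω
    by_cases h : ENNReal.ofReal (M / C) < V ω
    · rw [Set.indicator_of_mem (show ω ∈ {ω | ENNReal.ofReal (M / C) < V ω} from h)]
      by_cases hVt : V ω = ∞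
      · rw [hVt, ENNReal.mul_top (ENNReal.ofReal_pos.2 hC).ne', expRpow_top ha,
          ENNReal.mul_top (ENNReal.ofReal_pos.2 (by positivity)).ne']
      · set x := (V ω).toReal with hx
        have hVx : V ω = ENNReal.ofReal x := (ENNReal.ofReal_toReal hVt).symm
        have hx0 : 0 ≤ x := ENNReal.toReal_nonneg
        rw [hVx, ENNReal.ofReal_lt_ofReal_iff_of_nonneg (by positivity), div_lt_iff₀ hC] at h
        rw [hVx, ← ENNReal.ofReal_mul hC.le, expRpow_ofReal ha.le (by positivity),
          ← ENNReal.ofReal_mul (by positivity)]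
        refine ENNReal.ofReal_le_ofReal ?_
        have h1 := hc (C * x) (by positivity)
        have h2 : M ^ a ≤ (C * x) ^ a := Real.rpow_le_rpow hM0 (by linarith) ha.le
        -- Above the threshold half of the exponent exceeds y + log A and pays for e^y and A; the
        -- other half has already bounded C x.
        have h3 : Real.exp ((C * x) ^ a / 2)
            ≤ Real.exp (-y) * A⁻¹ * Real.exp ((C * x) ^ a) := by
          have : A⁻¹ = Real.exp (-Real.log A) := by rw [Real.exp_neg, Real.exp_log hA]
          rw [this, ← Real.exp_add, ← Real.exp_add]
          exact Real.exp_le_exp.2 (by linarith)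
        have h4 : C * x ≤ c * (Real.exp (-y) * A⁻¹ * Real.exp ((C * x) ^ a)) :=
          h1.trans (mul_le_mul_of_nonneg_left h3 hc0.le)
        rw [div_mul_eq_mul_div, div_mul_eq_mul_div, le_div_iff₀ hC]
        linarith
    · rw [Set.indicator_of_notMem (show ω ∉ {ω | ENNReal.ofReal (M / C) < V ω} from h)]
      exact zero_le
  calc _ ≤ ENNReal.ofReal (Real.exp y) * ∫⁻ ω, ENNReal.ofReal (c / C * (Real.exp (-y) * A⁻¹))
        * expRpow a (ENNReal.ofReal C * V ω) ∂μ := by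
        gcongr with ω
        exact hpt ω
    _ = ENNReal.ofReal (Real.exp y) * (ENNReal.ofReal (c / C * (Real.exp (-y) * A⁻¹))
        * ∫⁻ ω, expRpow a (ENNReal.ofReal C * V ω) ∂μ) := by
        rw [lintegral_const_mul' _ _ ENNReal.ofReal_ne_top]
    _ ≤ ENNReal.ofReal (Real.exp y) * (ENNReal.ofReal (c / C * (Real.exp (-y) * A⁻¹))
        * ENNReal.ofReal A) := by gcongr
    _ = ENNReal.ofReal (c / C) := by
        rw [← ENNReal.ofReal_mul (by positivity), ← ENNReal.ofReal_mul (by positivity)]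
        congr 1
        rw [Real.exp_neg]
        field_simp

variable {I Ω₀ : Type*} [DecidableEq I] [Countable I] [MeasurableSpace Ω₀] (P₀ : Measure Ω₀)
  [IsProbabilityMeasure P₀] {X : (I → Ω₀) → ℝ}

/-- The tail bound for the cell means. -/
lemma measureReal_cellMean_le (s : Finset I) {k : ℕ} {κ : Ω₀ → Fin k} (hκ : Measurable κ)
    (hXm : Measurable X) (hX : Integrable X (Measure.infinitePi fun _ : I => P₀))
    {β a c : ℝ} (hβ : 0 < β) (ha : 0 < a) (hβa : 1 + a⁻¹ = 2 / β) (hc0 : 0 < c)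
    (hc : ∀ u : ℝ, 0 ≤ u → u ≤ c * Real.exp (u ^ a / 2)) {C A lam t : ℝ} (hC : 0 < C)
    (hlam : lam * (100 * √((10 ^ a⁻¹ + c) / C)) ^ β ≤ 1) (hA : 1 ≤ A)
    (hV : ∫⁻ ω, expRpow a (ENNReal.ofReal C * squareFn P₀ X ω)
      ∂(Measure.infinitePi fun _ : I => P₀) ≤ ENNReal.ofReal A) (hlam0 : 0 ≤ lam) (ht : 0 < t) :
    (Measure.infinitePi fun _ : I => P₀).real
      {ω | (∫ ω, X ω ∂(Measure.infinitePi fun _ : I => P₀)) + t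
        ≤ cellMean P₀ s κ X (quant s κ ω)} ≤ Real.exp 1 * A * Real.exp (-(lam * t ^ β)) := by
  set μ := Measure.infinitePi fun _ : I => P₀ with hμ
  set E : Set (I → Ω₀) := {ω | (∫ ω, X ω ∂μ) + t ≤ cellMean P₀ s κ X (quant s κ ω)} with hE
  -- A null event is not of probability e^(-p) for any p.
  rcases (measureReal_nonneg : 0 ≤ μ.real E).eq_or_lt with h0 | hpos
  · rw [← h0]; positivity
  set p := -Real.log (μ.real E) with hp
  have hp0 : 0 ≤ p := by
    have := Real.log_nonpos measureReal_nonneg (measureReal_le_one : μ.real E ≤ 1)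
    linarith
  have hpE : μ.real E = Real.exp (-p) := by rw [hp, neg_neg, Real.exp_log hpos]
  set L := Real.log A with hL
  have hL0 : 0 ≤ L := Real.log_nonneg hA
  -- y dominates p + 1, and 10 y dominates 2 (2 p + 5 + L). The resulting y * y^(1/a) = y^(2/β) has
  -- square root y^(1/β), so t^β is linear in y.
  set y := p + 1 + L with hy
  have hy1 : 1 ≤ y := by linarith
  set K := (10 : ℝ) ^ a⁻¹ + c with hK
  have hK0 : 0 < K := by positivity
  have ha' : 0 < a⁻¹ := inv_pos.2 ha
  set M := (2 * (2 * p + 5 + L)) ^ a⁻¹ with hM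
  have hM0 : 0 ≤ M := by positivity
  have hMa : 2 * (2 * p + 5 + L) ≤ M ^ a := by
    rw [hM, Real.rpow_inv_rpow (by positivity) ha.ne']
  have hbound := mul_lintegral_indicator_le (y := 2 * p + 5) ha hc0 hc hC (by linarith) hM0 hMa hV
  have hMK : M + c ≤ K * y ^ a⁻¹ := by
    have h1 : M ≤ (10 * y) ^ a⁻¹ := Real.rpow_le_rpow (by positivity) (by linarith) ha'.le
    rw [Real.mul_rpow (by norm_num) (by linarith)] at h1
    have h2 : 1 ≤ y ^ a⁻¹ := Real.one_le_rpow hy1 ha'.le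
    rw [hK, add_mul]
    nlinarith
  have hdev := cellMean_deviation_le P₀ s hκ hXm hX ht hp0 (v := K * y ^ a⁻¹ / C) (by positivity)
    (M := ENNReal.ofReal (M / C)) hpE (by
      refine (add_le_add_right hbound _).trans ?_
      rw [← ENNReal.ofReal_add (by positivity) (by positivity), ← add_div]
      refine ENNReal.ofReal_le_ofReal ?_
      gcongr)
  have h1 : √((p + 1) * (K * y ^ a⁻¹ / C)) ≤ √(K / C) * y ^ (1 / β) := by
    have h2 : (p + 1) * (K * y ^ a⁻¹ / C) ≤ K / C * y ^ (2 / β) := by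
      rw [← hβa, Real.rpow_add (by linarith), Real.rpow_one]
      have h3 : 0 ≤ K * y ^ a⁻¹ / C := by positivity
      calc (p + 1) * (K * y ^ a⁻¹ / C) ≤ y * (K * y ^ a⁻¹ / C) := by gcongr; linarith
        _ = _ := by ring
    refine (Real.sqrt_le_sqrt h2).trans (le_of_eq ?_)
    rw [Real.sqrt_mul (by positivity)]
    congr 1
    rw [Real.sqrt_eq_rpow, ← Real.rpow_mul (by linarith)]
    congr 1
    ring
  have h2 : t ≤ 100 * √(K / C) * y ^ (1 / β) := by
    rw [mul_assoc]
    exact hdev.trans (by gcongr)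
  have h3 : t ^ β ≤ (100 * √(K / C)) ^ β * y := by
    refine (Real.rpow_le_rpow ht.le h2 hβ.le).trans (le_of_eq ?_)
    rw [Real.mul_rpow (by positivity) (by positivity), ← Real.rpow_mul (by linarith),
      one_div_mul_cancel hβ.ne', Real.rpow_one]
  have h4 : lam * t ^ β ≤ y := by
    calc lam * t ^ β ≤ lam * ((100 * √(K / C)) ^ β * y) := by gcongr
      _ = (lam * (100 * √(K / C)) ^ β) * y := by ring
      _ ≤ 1 * y := by gcongr
      _ = y := one_mul y
  have e : Real.exp 1 * A * Real.exp (-(lam * t ^ β)) = Real.exp (1 + L - lam * t ^ β) := by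
    rw [sub_eq_add_neg, Real.exp_add, Real.exp_add, hL, Real.exp_log (by linarith)]
  rw [e, hpE]
  exact Real.exp_le_exp.2 (by linarith)

/-- The tail bound for `X`. -/
lemma measure_deviation_le (hXm : Measurable X)
    (hX : Integrable X (Measure.infinitePi fun _ : I => P₀))
    {β a c : ℝ} (hβ : 0 < β) (ha : 0 < a) (hβa : 1 + a⁻¹ = 2 / β) (hc0 : 0 < c)
    (hc : ∀ u : ℝ, 0 ≤ u → u ≤ c * Real.exp (u ^ a / 2)) {C A lam t : ℝ} (hC : 0 < C)
    (hlam : lam * (100 * √((10 ^ a⁻¹ + c) / C)) ^ β ≤ 1) (hA : 1 ≤ A)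
    (hV : ∫⁻ ω, expRpow a (ENNReal.ofReal C * squareFn P₀ X ω)
      ∂(Measure.infinitePi fun _ : I => P₀) ≤ ENNReal.ofReal A) (hlam0 : 0 ≤ lam) (ht : 0 < t) :
    (Measure.infinitePi fun _ : I => P₀)
      {ω | (∫ ω, X ω ∂(Measure.infinitePi fun _ : I => P₀)) + t ≤ X ω}
        ≤ ENNReal.ofReal (Real.exp 1 * A * Real.exp (-(lam * t ^ β))) := by
  set μ := Measure.infinitePi fun _ : I => P₀ with hμ
  -- Cell means are used at a lower level t₀. By Markov's inequality they differ from X by t - t₀ or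
  -- more with probability at most η; the 2 in ε = r η / 2 offsets that of
  -- `lintegral_sub_cellMean_le`. Afterwards t₀ tends to t.
  have hstep : ∀ t₀, 0 < t₀ → t₀ < t → μ {ω | (∫ ω, X ω ∂μ) + t ≤ X ω}
      ≤ ENNReal.ofReal (Real.exp 1 * A * Real.exp (-(lam * t₀ ^ β))) := by
    intro t₀ ht₀ htt
    refine ENNReal.le_of_forall_pos_le_add fun η hη _ => ?_
    set r := ENNReal.ofReal (t - t₀) with hr
    have hr0 : r ≠ 0 := (ENNReal.ofReal_pos.2 (by linarith)).ne'
    have hrt : r ≠ ∞ := ENNReal.ofReal_ne_top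
    have hη0 : (η : ℝ≥0∞) ≠ 0 := by exact_mod_cast hη.ne'
    obtain ⟨Y, hY, s, k, κ, g, hκ, rfl⟩ := exists_isDiscrete_eLpNorm_sub_le μ hX
      (ε := r * η / 2) (by simp [hr0, hη0])
    rw [eLpNorm_one_eq_lintegral_enorm] at hY
    have happ := (lintegral_sub_cellMean_le P₀ s hκ hX g).trans
      (mul_le_mul_right hY 2)
    rw [ENNReal.mul_div_cancel (by norm_num) (by norm_num)] at happ
    have hmeas : AEMeasurable (fun ω => ‖X ω - cellMean P₀ s κ X (quant s κ ω)‖ₑ) μ :=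
      (hXm.sub ((measurable_of_finite (cellMean P₀ s κ X)).comp
        (measurable_quant s hκ))).enorm.aemeasurable
    have hmarkov := (meas_ge_le_lintegral_div hmeas hr0 hrt).trans
      (ENNReal.div_le_div_right happ r)
    rw [mul_comm r, ENNReal.mul_div_cancel_right hr0 hrt] at hmarkov
    have hcell := measureReal_cellMean_le P₀ s hκ hXm hX hβ ha hβa hc0 hc hC hlam hA hV hlam0 ht₀
    have hsub : {ω | (∫ ω, X ω ∂μ) + t ≤ X ω}
        ⊆ {ω | (∫ ω, X ω ∂μ) + t₀ ≤ cellMean P₀ s κ X (quant s κ ω)}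
          ∪ {ω | r ≤ ‖X ω - cellMean P₀ s κ X (quant s κ ω)‖ₑ} := by
      intro ω hω
      have hω : (∫ ω, X ω ∂μ) + t ≤ X ω := hω
      by_cases h : (∫ ω, X ω ∂μ) + t₀ ≤ cellMean P₀ s κ X (quant s κ ω)
      · exact Or.inl h
      · right
        have h := not_le.1 h
        change r ≤ _
        rw [Real.enorm_eq_ofReal_abs, hr]
        exact ENNReal.ofReal_le_ofReal ((by linarith : t - t₀ ≤ _).trans (le_abs_self _))
    refine (measure_mono hsub).trans ((measure_union_le _ _).trans (add_le_add ?_ hmarkov))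
    rw [← ofReal_measureReal]
    exact ENNReal.ofReal_le_ofReal hcell
  have hcont : Filter.Tendsto
      (fun t₀ : ℝ => ENNReal.ofReal (Real.exp 1 * A * Real.exp (-(lam * t₀ ^ β))))
      (nhdsWithin t (Set.Iio t))
      (nhds (ENNReal.ofReal (Real.exp 1 * A * Real.exp (-(lam * t ^ β))))) := by
    refine tendsto_nhdsWithin_of_tendsto_nhds ?_
    have : ContinuousAt (fun t₀ : ℝ => t₀ ^ β) t := Real.continuousAt_rpow_const t β (Or.inl ht.ne')
    exact (ENNReal.continuous_ofReal.continuousAt.comp (continuousAt_const.mul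
      (Real.continuous_exp.continuousAt.comp (continuousAt_const.mul this).neg)))
  refine ge_of_tendsto hcont ?_
  have h1 : ∀ᶠ t₀ in nhdsWithin t (Set.Iio t), 0 < t₀ :=
    nhdsWithin_le_nhds (lt_mem_nhds ht)
  filter_upwards [h1, self_mem_nhdsWithin] with t₀ h0 h1
  exact hstep t₀ h0 h1

/-- Conditional expectations are odd only up to null sets; as `I` is countable, one null set serves
all sites. -/
lemma squareFn_neg : squareFn P₀ (-X) =ᵐ[Measure.infinitePi fun _ : I => P₀] squareFn P₀ X := by
  have h : ∀ᵐ ω ∂(Measure.infinitePi fun _ : I => P₀), ∀ z : I,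
      condExp (cylinderEvents (X := fun _ : I => Ω₀) {z}ᶜ)
        (Measure.infinitePi fun _ : I => P₀) (-X) ω
      = -condExp (cylinderEvents (X := fun _ : I => Ω₀) {z}ᶜ)
        (Measure.infinitePi fun _ : I => P₀) X ω :=
    ae_all_iff.2 fun z => condExp_neg X _
  filter_upwards [h] with ω hω
  unfold squareFn
  refine tsum_congr fun z => ?_
  rw [hω z, Pi.neg_apply]
  congr 1
  ring

/-- The two-sided tail bound. -/
lemma measure_abs_deviation_le (hXm : Measurable X)
    (hX : Integrable X (Measure.infinitePi fun _ : I => P₀))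
    {β a c : ℝ} (hβ : 0 < β) (ha : 0 < a) (hβa : 1 + a⁻¹ = 2 / β) (hc0 : 0 < c)
    (hc : ∀ u : ℝ, 0 ≤ u → u ≤ c * Real.exp (u ^ a / 2)) {C A lam t : ℝ} (hC : 0 < C)
    (hlam : lam * (100 * √((10 ^ a⁻¹ + c) / C)) ^ β ≤ 1) (hA : 1 ≤ A)
    (hV : ∫⁻ ω, expRpow a (ENNReal.ofReal C * squareFn P₀ X ω)
      ∂(Measure.infinitePi fun _ : I => P₀) ≤ ENNReal.ofReal A) (hlam0 : 0 ≤ lam) (ht : 0 < t) :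
    (Measure.infinitePi fun _ : I => P₀)
      {ω | t ≤ |X ω - ∫ ω, X ω ∂(Measure.infinitePi fun _ : I => P₀)|}
        ≤ ENNReal.ofReal (2 * Real.exp 1 * A * Real.exp (-(lam * t ^ β))) := by
  set μ := Measure.infinitePi fun _ : I => P₀ with hμ
  have h1 := measure_deviation_le P₀ hXm hX hβ ha hβa hc0 hc hC hlam hA hV hlam0 ht
  have h2 := measure_deviation_le P₀ (X := -X) hXm.neg hX.neg hβ ha hβa hc0 hc hC hlam hA (by
    refine le_trans (le_of_eq (lintegral_congr_ae ?_)) hV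
    filter_upwards [squareFn_neg P₀ (X := X)] with ω hω
    rw [hω]) hlam0 ht
  have hsub : {ω | t ≤ |X ω - ∫ ω, X ω ∂μ|}
      ⊆ {ω | (∫ ω, X ω ∂μ) + t ≤ X ω} ∪ {ω | (∫ ω, (-X) ω ∂μ) + t ≤ (-X) ω} := by
    intro ω hω
    have hω : t ≤ |X ω - ∫ ω, X ω ∂μ| := hω
    rcases le_abs.1 hω with h | h
    · left
      change (∫ ω, X ω ∂μ) + t ≤ X ω
      linarith
    · right
      change (∫ ω, (-X) ω ∂μ) + t ≤ (-X) ω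
      simp only [Pi.neg_apply, integral_neg]
      linarith
  refine (measure_mono hsub).trans ((measure_union_le _ _).trans ((add_le_add h1 h2).trans ?_))
  rw [← ENNReal.ofReal_add (by positivity) (by positivity)]
  refine ENNReal.ofReal_le_ofReal (le_of_eq ?_)
  ring

end Tail

/-! ### From tails to exponential moments -/

section Moment

/-- From a tail bound to an exponential moment. -/
lemma lintegral_exp_le_of_tail {Ω : Type*} [MeasurableSpace Ω] {μ : Measure Ω}
    [IsProbabilityMeasure μ] {Z : Ω → ℝ} (hZm : Measurable Z) (hZ : ∀ ω, 0 ≤ Z ω) {β b B : ℝ}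
    (hβ : 0 < β) (hb : 0 ≤ b) (hB : 1 ≤ B)
    (htail : ∀ t, 0 < t → μ {ω | t ≤ Z ω}
      ≤ ENNReal.ofReal (B * Real.exp (-((b + 1) * t ^ β)))) :
    ∫⁻ ω, ENNReal.ofReal (Real.exp (b * Z ω ^ β)) ∂μ
      ≤ ENNReal.ofReal (2 * Real.exp b * B) := by
  set S : ℕ → Set Ω := fun n => {ω | (n : ℝ) ^ (1 / β) ≤ Z ω} with hS
  have hSm : ∀ n, MeasurableSet (S n) := fun n => measurableSet_le measurable_const hZm
  have hSμ : ∀ n, μ (S n) ≤ ENNReal.ofReal (B * Real.exp (-((b + 1) * n))) := by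
    intro n
    rcases Nat.eq_zero_or_pos n with h | h
    · subst h
      refine prob_le_one.trans ?_
      rw [← ENNReal.ofReal_one]
      refine ENNReal.ofReal_le_ofReal ?_
      simpa using hB
    · have hn : (0 : ℝ) < n := by exact_mod_cast h
      have := htail ((n : ℝ) ^ (1 / β)) (by positivity)
      rwa [← Real.rpow_mul hn.le, one_div_mul_cancel hβ.ne', Real.rpow_one] at this
  -- Slice by n = ⌊Z^β⌋. The extra 1 in the rate b + 1 leaves a geometric series of ratio e^(-1).
  have hpt : ∀ ω, ENNReal.ofReal (Real.exp (b * Z ω ^ β))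
      ≤ ∑' n : ℕ, (S n).indicator (fun _ => ENNReal.ofReal (Real.exp (b * (n + 1)))) ω := by
    intro ω
    set n := ⌊Z ω ^ β⌋₊ with hn
    have hz0 : 0 ≤ Z ω ^ β := Real.rpow_nonneg (hZ ω) β
    refine le_trans ?_ (ENNReal.le_tsum n)
    have hmem : ω ∈ S n := by
      change (n : ℝ) ^ (1 / β) ≤ Z ω
      have h1 : (n : ℝ) ≤ Z ω ^ β := Nat.floor_le hz0
      have h2 := Real.rpow_le_rpow (Nat.cast_nonneg n) h1 (by positivity : 0 ≤ 1 / β)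
      rwa [← Real.rpow_mul (hZ ω), mul_one_div_cancel hβ.ne', Real.rpow_one] at h2
    rw [Set.indicator_of_mem hmem]
    refine ENNReal.ofReal_le_ofReal (Real.exp_le_exp.2 ?_)
    exact mul_le_mul_of_nonneg_left (Nat.lt_floor_add_one _).le hb
  have hr0 : 0 ≤ Real.exp (-1) := (Real.exp_pos _).le
  have hr1 : Real.exp (-1) ≤ 1 / 2 := by
    rw [Real.exp_neg, one_div]
    exact inv_anti₀ (by norm_num) (by linarith [Real.exp_one_gt_d9])
  calc _ ≤ ∫⁻ ω, ∑' n : ℕ, (S n).indicator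
        (fun _ => ENNReal.ofReal (Real.exp (b * (n + 1)))) ω ∂μ := lintegral_mono hpt
    _ = ∑' n : ℕ, ENNReal.ofReal (Real.exp (b * (n + 1))) * μ (S n) := by
        rw [lintegral_tsum fun n => (measurable_const.indicator (hSm n)).aemeasurable]
        refine tsum_congr fun n => ?_
        rw [lintegral_indicator (hSm n)]
        simp
    _ ≤ ∑' n : ℕ, ENNReal.ofReal (Real.exp b * B * Real.exp (-1) ^ n) := by
        refine ENNReal.tsum_le_tsum fun n => ?_
        calc _ ≤ ENNReal.ofReal (Real.exp (b * (n + 1)))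
              * ENNReal.ofReal (B * Real.exp (-((b + 1) * n))) := by gcongr; exact hSμ n
          _ = _ := by
              rw [← ENNReal.ofReal_mul (Real.exp_pos _).le]
              congr 1
              rw [← Real.exp_nat_mul]
              have : Real.exp (b * (n + 1)) * (B * Real.exp (-((b + 1) * n)))
                  = B * (Real.exp (b * (n + 1)) * Real.exp (-((b + 1) * n))) := by ring
              rw [this, ← Real.exp_add, mul_comm (Real.exp b) B, mul_assoc, ← Real.exp_add]
              congr 2
              ring
    _ = ENNReal.ofReal (∑' n : ℕ, Real.exp b * B * Real.exp (-1) ^ n) :=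
        (ENNReal.ofReal_tsum_of_nonneg (fun n => by positivity)
          ((summable_geometric_of_lt_one hr0 (by linarith)).mul_left _)).symm
    _ ≤ _ := by
        refine ENNReal.ofReal_le_ofReal ?_
        rw [tsum_mul_left, tsum_geometric_of_lt_one hr0 (by linarith)]
        have : (1 - Real.exp (-1))⁻¹ ≤ 2 := by
          calc (1 - Real.exp (-1))⁻¹ ≤ (1 / 2)⁻¹ := inv_anti₀ (by norm_num) (by linarith)
            _ = 2 := by norm_num
        calc Real.exp b * B * (1 - Real.exp (-1))⁻¹ ≤ Real.exp b * B * 2 := by gcongr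
          _ = _ := by ring

/-- Monotonicity of L^p norms on a probability space. -/
lemma lintegral_exp_le_rpow {Ω : Type*} [MeasurableSpace Ω] {μ : Measure Ω}
    [IsProbabilityMeasure μ] {Z : Ω → ℝ} (hZ : Measurable Z) {b : ℝ} (hb : 1 ≤ b) :
    ∫⁻ ω, ENNReal.ofReal (Real.exp (Z ω)) ∂μ
      ≤ (∫⁻ ω, ENNReal.ofReal (Real.exp (b * Z ω)) ∂μ) ^ (1 / b) := by
  have h := eLpNorm'_le_eLpNorm'_of_exponent_le one_pos hb μ
    (f := fun ω => Real.exp (Z ω)) hZ.exp.aestronglyMeasurable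
  simp only [eLpNorm', one_div, ENNReal.rpow_one, inv_one] at h
  rw [one_div]
  have e1 : ∀ ω, ‖Real.exp (Z ω)‖ₑ = ENNReal.ofReal (Real.exp (Z ω)) := fun ω =>
    Real.enorm_of_nonneg (Real.exp_pos _).le
  have e2 : ∀ ω, ENNReal.ofReal (Real.exp (Z ω)) ^ b = ENNReal.ofReal (Real.exp (b * Z ω)) := by
    intro ω
    rw [ENNReal.ofReal_rpow_of_nonneg (Real.exp_pos _).le (by linarith), ← Real.exp_mul, mul_comm]
  simpa only [e1, e2] using h

end Moment

end NoiseSemigroup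

/-! ### Choice of constants and conclusion -/

open NoiseSemigroup in
theorem proposition2p2 (β : ℝ) (hβ₀ : 0 < β) (hβ₂ : β < 2) :
    ∃ C : ℝ, 1 ≤ C ∧
      ∀ (d : ℕ) (Ω₀ : Type*) [MeasurableSpace Ω₀] (P₀ : Measure Ω₀) [IsProbabilityMeasure P₀]
        (X : ((Fin d → ℤ) → Ω₀) → ℝ), Measurable X → Integrable X (productLaw d P₀) →
        ∫⁻ ω, ENNReal.ofReal (Real.exp (|X ω - ∫ ω', X ω' ∂(productLaw d P₀)| ^ β))
            ∂(productLaw d P₀)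
          ≤ ENNReal.ofReal C *
            (∫⁻ ω, EReal.exp
                (((ENNReal.ofReal C * verticalVar P₀ X ω) ^ (β / (2 - β)) : ℝ≥0∞) : EReal)
              ∂(productLaw d P₀)) ^ ((2 - β) / β) := by
  set a := β / (2 - β) with ha
  have ha0 : 0 < a := div_pos hβ₀ (by linarith)
  have hainv : (2 - β) / β = a⁻¹ := by rw [ha, inv_div]
  have hβa : 1 + a⁻¹ = 2 / β := by rw [← hainv]; field_simp; ring
  obtain ⟨c, hc0, hc⟩ := exists_le_mul_exp_rpow ha0
  -- b ≥ 1 allows Jensen's inequality; b ≥ a gives A^(1/b) ≤ A^(1/a), because A ≥ 1.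
  set b := max 1 a with hb
  have hb1 : 1 ≤ b := le_max_left _ _
  have hba : a ≤ b := le_max_right _ _
  set lam := b + 1 with hlam
  have hlam0 : 0 < lam := by linarith
  set K := (10 : ℝ) ^ a⁻¹ + c with hK
  have hK0 : 0 < K := by positivity
  -- C ≥ C₁ makes `hlamC` true, and C₂ collects the prefactors of the tail bound and of its
  -- integration.
  set C₁ := K * (100 * lam ^ (1 / β)) ^ 2 with hC₁
  set C₂ := 2 * Real.exp b * (2 * Real.exp 1) with hC₂
  set C := max 1 (max C₁ C₂) with hC
  have hC1 : 1 ≤ C := le_max_left _ _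
  have hCC₁ : C₁ ≤ C := (le_max_left _ _).trans (le_max_right _ _)
  have hCC₂ : C₂ ≤ C := (le_max_right _ _).trans (le_max_right _ _)
  have hC0 : 0 < C := by linarith
  have hlamC : lam * (100 * √(K / C)) ^ β ≤ 1 := by
    have hl : 0 < lam ^ (1 / β) := Real.rpow_pos_of_pos hlam0 _
    have h1 : √(K / C) ≤ (100 * lam ^ (1 / β))⁻¹ := by
      rw [Real.sqrt_le_left (by positivity), inv_pow, div_le_iff₀ hC0, ← div_eq_inv_mul,
        le_div_iff₀ (by positivity)]
      exact hCC₁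
    have h2 : 100 * √(K / C) ≤ (lam ^ (1 / β))⁻¹ := by
      calc 100 * √(K / C) ≤ 100 * (100 * lam ^ (1 / β))⁻¹ := by gcongr
        _ = _ := by field_simp
    have h3 := Real.rpow_le_rpow (by positivity) h2 hβ₀.le
    rw [Real.inv_rpow hl.le, ← Real.rpow_mul hlam0.le, one_div_mul_cancel hβ₀.ne',
      Real.rpow_one] at h3
    calc lam * (100 * √(K / C)) ^ β ≤ lam * lam⁻¹ := by gcongr
      _ = 1 := mul_inv_cancel₀ hlam0.ne'
  refine ⟨C, hC1, ?_⟩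
  intro d Ω₀ _ P₀ _ X hXm hX
  rw [hainv]
  set μ := productLaw d P₀ with hμ
  have hprob : IsProbabilityMeasure μ := by
    rw [hμ, productLaw]; infer_instance
  set A₀ := ∫⁻ ω, EReal.exp (((ENNReal.ofReal C * verticalVar P₀ X ω) ^ a : ℝ≥0∞) : EReal) ∂μ
    with hA₀
  have hA₀1 : 1 ≤ A₀ := by
    have : ∫⁻ _, (1 : ℝ≥0∞) ∂μ ≤ A₀ := lintegral_mono fun ω => one_le_expRpow a _
    simpa using this
  by_cases htop : A₀ = ∞
  · rw [htop, ENNReal.top_rpow_of_pos (inv_pos.2 ha0),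
      ENNReal.mul_top (ENNReal.ofReal_pos.2 hC0).ne']
    exact le_top
  set A := A₀.toReal with hA
  have hAA : ENNReal.ofReal A = A₀ := ENNReal.ofReal_toReal htop
  have hA1 : 1 ≤ A := by
    have := ENNReal.toReal_mono htop hA₀1
    simpa using this
  have hZm : Measurable fun ω => |X ω - ∫ ω', X ω' ∂μ| := (hXm.sub_const _).abs
  have hmom := lintegral_exp_le_of_tail (μ := μ) hZm (fun ω => abs_nonneg _) (b := b)
    (B := 2 * Real.exp 1 * A) hβ₀ (by linarith) (by
      have := Real.one_le_exp (zero_le_one (α := ℝ))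
      nlinarith)
    (fun t ht => measure_abs_deviation_le P₀ hXm hX hβ₀ ha0 hβa hc0 hc hC0 hlamC hA1 hAA.ge
      hlam0.le ht)
  refine (lintegral_exp_le_rpow (hZm.pow_const β) hb1).trans ?_
  calc _ ≤ ENNReal.ofReal (2 * Real.exp b * (2 * Real.exp 1 * A)) ^ (1 / b) :=
        ENNReal.rpow_le_rpow hmom (by positivity)
    _ = ENNReal.ofReal ((C₂ * A) ^ (1 / b)) := by
        rw [ENNReal.ofReal_rpow_of_nonneg (by positivity) (by positivity)]
        congr 2
        rw [hC₂]; ring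
    _ ≤ ENNReal.ofReal (C * A ^ a⁻¹) := by
        refine ENNReal.ofReal_le_ofReal ?_
        have hC₂1 : 1 ≤ C₂ := by
          have h1 := Real.one_le_exp (zero_le_one (α := ℝ))
          have h2 := Real.one_le_exp (show 0 ≤ b by linarith)
          rw [hC₂]; nlinarith
        rw [Real.mul_rpow (by linarith) (by linarith)]
        refine mul_le_mul ?_ ?_ (by positivity) hC0.le
        · refine le_trans ?_ hCC₂
          exact (Real.rpow_le_rpow_of_exponent_le hC₂1 (by
            rw [div_le_one (by linarith)]; exact hb1)).trans_eq (Real.rpow_one _)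
        · refine Real.rpow_le_rpow_of_exponent_le hA1 ?_
          rw [one_div]
          exact inv_anti₀ ha0 hba
    _ = ENNReal.ofReal C * A₀ ^ a⁻¹ := by
        rw [ENNReal.ofReal_mul hC0.le, ← hAA,
          ENNReal.ofReal_rpow_of_nonneg (by linarith) (inv_pos.2 ha0).le]
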